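/- **Setting.** Let $P$ be the set of primes and $D$ a non-principal ultrafilter on $P$. Let ${}^*\mathbb Z=\mathbb Z^P/D$ and ${}^*\mathbb Q=\mathbb Q^P/D$ be the non-standard integers and rationals, $\mathfrak p\in{}^*\mathbb Z$ the class of the identity sequence $(p)_{p\in P}$, and $\mathrm F_{\mathfrak p}=\prod_{p\in P}\mathbb F_p/D$, a pseudo-finite field onto which ${}^*\mathbb Z$ maps by reduction modulo $\mathfrak p$. For $x=[x_p]\in \mathrm F_{\mathfrak p}$ and $n=[n_p]\in{}^*\mathbb Z$ put $x^n=[x_p^{n_p}]$ (for $x\neq0$ if $n$ is negative). "Standard" means "in $\mathbb Z$". $\mathrm{st}$ is the standard part of a finite non-standard rational. Call $(\mathfrak l,\mu,\mathfrak i,\iota)\in({}^*\mathbb Z)^4$ a *scale* if * $\mu>0$, $\iota>0$, $\mathfrak l=\mu^2$, $\mathfrak i=\iota^2$; * every standard $m\ge1$ divides $\mathfrak l$, and $m\,\mathfrak i\,\mathfrak l$ divides $\mathfrak p-1$ for every standard $m\ge1$; * $\mathfrak l^n<\mathfrak i$ for every standard $n\ge 0$; * either $\mathfrak i^2+1=\mathfrak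 p$ and $T(\mathfrak l,\mathbb Q(\mathfrak l))$ holds, or $\mathfrak i,\mathfrak l$ are algebraically independent in $\mathrm F_{\mathfrak p}$ and $T(\mathfrak l,\mathbb Q(\mathfrak l,\mathfrak i))$ holds. Here, for a subfield $k\subseteq\mathrm F_{\mathfrak p}$, $T(\mathfrak l,k)$ says: there is $f:\mathbb N\to\mathbb Z_{>0}$ such that for all standard $n$ and $c_1,\dots,c_n\in k$, whenever $x_1,\dots,x_n\in\mathrm F_{\mathfrak p}$ satisfy $x_i^{\mathfrak l}=1$ for all $i$, $\sum_{i}c_ix_i=1$, and $\sum_{i\in J}c_ix_i\ne1$ for every proper subset $J$ of $\{1,\dots,n\}$, then $x_i^{f(n)}=1$ for all $i$. Given a scale, let $\mathbb U={}^*\mathbb Z/(\mathfrak p-1)\mathfrak l\,{}^*\mathbb Z$, a pseudo-finite cyclic group, $\mathbf v=\mathfrak p-1$ and $\mathbf u=(\mathfrak p-1)/\mathfrak i$. For $w\in\{\mathbf u,\mathbf v\}$ and $\alpha\in{}^*\mathbb Q$ with $\alpha w\in{}^*\mathbb Z$ write $\alpha w$ also for its class in $\mathbb U$. Put $$'\mathbb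 R'=\Big\{\tfrac{K}{m\mathfrak l}\mathbf u\Big\},\qquad 'i\mathbb R'=\Big\{\tfrac{K}{m\mathfrak l}\mathbf v\Big\},\qquad K\in{}^*\mathbb Z,\ -\tfrac{l\mathfrak l}{2}\le K\le \tfrac{l\mathfrak l}{2},\ l,m\ge1\text{ standard}.$$ For a pseudo-generator $\varepsilon$ of $\mathrm F_{\mathfrak p}^\times$ (every element of $\mathrm F_{\mathfrak p}^\times$ is $\varepsilon^n$ for some $n\in{}^*\mathbb Z$) let $\exp_{\mathfrak p}:\mathbb U\to\mathrm F_{\mathfrak p}^\times$ be induced by $n\mapsto\varepsilon^n$. A place $\mathrm F_{\mathfrak p}\to\mathbb C\cup\{\infty\}$ is a map sending $1$ to $1$ and preserving sums and products whenever these are defined in $\mathbb C\cup\{\infty\}$ ($\infty+\infty$ and $0\cdot\infty$ are undefined; $\infty+b=\infty$ for $b\in\mathbb C$, $\infty\cdot b=\infty$ for $b\ne0$, including $b=\infty$). Likewise a map $\mathbb U\to\mathbb C\cup\{\infty\}$ is called additive if it sends $0$ to $0$ and preserves all sums that are defined in $\mathbb C\cup\{\infty\}$. **Theorem.** (1) There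 are non-principal $D$ such that every standard $m\ge1$ divides $\mathfrak p-1$; and for every such $D$ there is a scale. (2) For every non-principal $D$ and every scale $(\mathfrak l,\mu,\mathfrak i,\iota)$ there are a pseudo-generator $\varepsilon$ of $\mathrm F_{\mathfrak p}^\times$, a surjective place $\mathrm{lm}_{\mathrm F}:\mathrm F_{\mathfrak p}\to\mathbb C\cup\{\infty\}$ and a surjective additive map $\mathrm{lm}_{\mathbb U}:\mathbb U\to\mathbb C\cup\{\infty\}$ such that: * $\mathrm{lm}_{\mathrm F}(\exp_{\mathfrak p}(x))=\exp(\mathrm{lm}_{\mathbb U}(x))$ for every $x\in\mathbb U$ with $\mathrm{lm}_{\mathbb U}(x)\neq\infty$; * $\mathrm{lm}_{\mathbb U}('\mathbb R')=\mathbb R$ and $\mathrm{lm}_{\mathbb U}('i\mathbb R')=i\mathbb R$; moreover $\mathrm{lm}_{\mathrm F}(\exp_{\mathfrak p}('\mathbb R'))=\mathbb R_{>0}$ and $\mathrm{lm}_{\mathrm F}(\exp_{\mathfrak p}('i\mathbb R'))=\{w\in\mathbb C:|w|=1\}$; * for every $l\in{}^*\mathbb Z$ with $|l|<m\mathfrak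 l$ for some standard $m$, with $z=\mathrm{st}(l/\mathfrak l)\in\mathbb R$, $$\mathrm{lm}_{\mathrm F}\big(\exp_{\mathfrak p}(\tfrac{l}{2\mathfrak l}\mathbf u)\big)=e^{-\pi z},\qquad \mathrm{lm}_{\mathrm F}\big(\exp_{\mathfrak p}(\tfrac{l}{2\mathfrak l}\mathbf v)\big)=e^{i\pi z};$$ * $\mathrm{lm}_{\mathrm F}(\mu)=\infty$, $\mathrm{lm}_{\mathrm F}(1/\mu)=0$ and $\mathrm{lm}_{\mathrm F}(\iota)=e^{-\pi i/4}$; * for every positive rational $a$ that is a square in $\mathbb Q$, with internal (hyperfinite) sums over $n\in{}^*\mathbb Z$, $$\mathrm{lm}_{\mathrm F}\Big(\frac1\mu\sum_{-\frac{\mathfrak i\mathfrak l}{2a}\le n<\frac{\mathfrak i\mathfrak l}{2a}}\exp_{\mathfrak p}\big(a\tfrac{n^2}{2\mathfrak l}\mathbf u\big)\Big)=\frac1{\sqrt a}=\int_{\mathbb R}e^{-a\pi x^2}dx,$$ $$\mathrm{lm}_{\mathrm F}\Big(\frac1\mu\sum_{-\frac{\mathfrak l}{2a}\le n<\frac{\mathfrak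 l}{2a}}\exp_{\mathfrak p}\big(a\tfrac{n^2}{2\mathfrak l}\mathbf v\big)\Big)=\frac{e^{\pi i/4}}{\sqrt a}=\lim_{R\to\infty}\int_{-R}^{R}e^{ia\pi x^2}dx.$$ -/

import Mathlib

noncomputable section

namespace PseudoFinite

open Filter

/-! ## Non-standard numbers and the pseudo-finite field -/

/-- The ring of non-standard integers, the ultrapower of `ℤ` over the set of primes. -/
abbrev StarZ (D : Ultrafilter Nat.Primes) : Type := Germ (D : Filter Nat.Primes) ℤ

/-- The ordered field of non-standard rationals. -/
abbrev StarQ (D : Ultrafilter Nat.Primes) : Type := Germ (D : Filter Nat.Primes) ℚ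

/-- The inclusion of the non-standard integers in the non-standard rationals. -/
def toQ {D : Ultrafilter Nat.Primes} (n : StarZ D) : StarQ D := n.map (fun k : ℤ => (k : ℚ))

/-- The non-standard prime `𝔭`, the class of the sequence of all primes. -/
def bigPrime (D : Ultrafilter Nat.Primes) : StarZ D :=
  ((fun p : Nat.Primes => ((p : ℕ) : ℤ)) : Nat.Primes → ℤ)

instance factPrime (p : Nat.Primes) : Fact (p : ℕ).Prime := ⟨p.2⟩

/-- The ideal of the sequences that vanish `D`-almost everywhere. -/
def nullIdeal (D : Ultrafilter Nat.Primes) : Ideal (∀ p : Nat.Primes, ZMod p) where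
  carrier := {f | ∀ᶠ p in D, f p = 0}
  zero_mem' := Eventually.of_forall fun _ => rfl
  add_mem' := by
    intro f g hf hg
    filter_upwards [hf, hg] with p h1 h2
    simp [h1, h2]
  smul_mem' := by
    intro c f hf
    filter_upwards [hf] with p h
    simp [h]

theorem mem_nullIdeal {D : Ultrafilter Nat.Primes} {f : ∀ p : Nat.Primes, ZMod p} :
    f ∈ nullIdeal D ↔ ∀ᶠ p in D, f p = 0 := Iff.rfl

/-- The field `F_𝔭`, the ultraproduct of the prime fields `ℤ/p` with respect to `D`. -/
abbrev PF (D : Ultrafilter Nat.Primes) : Type := (∀ p : Nat.Primes, ZMod p) ⧸ nullIdeal D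

/-- The class of a sequence in the ultraproduct. -/
abbrev PF.mk {D : Ultrafilter Nat.Primes} (f : ∀ p : Nat.Primes, ZMod p) : PF D :=
  Ideal.Quotient.mk (nullIdeal D) f

theorem PF.mk_eq_mk {D : Ultrafilter Nat.Primes} {f g : ∀ p : Nat.Primes, ZMod p} :
    (PF.mk f : PF D) = PF.mk g ↔ ∀ᶠ p in D, f p = g p := by
  rw [PF.mk, PF.mk, Ideal.Quotient.eq, mem_nullIdeal]
  simp only [Pi.sub_apply, sub_eq_zero]

instance nullIdeal_isMaximal (D : Ultrafilter Nat.Primes) : (nullIdeal D).IsMaximal := by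
  rw [Ideal.isMaximal_iff]
  refine ⟨fun h => ?_, fun J f hJ hf hfJ => ?_⟩
  · obtain ⟨p, hp⟩ := (mem_nullIdeal.1 h).exists
    exact one_ne_zero hp
  · have hne : ∀ᶠ p in D, f p ≠ 0 := Ultrafilter.eventually_not.2 hf
    have h1 : (fun p => (f p)⁻¹) * f ∈ J := J.mul_mem_left _ hfJ
    have h2 : 1 - (fun p => (f p)⁻¹) * f ∈ J := by
      apply hJ
      rw [mem_nullIdeal]
      filter_upwards [hne] with p hp
      simp [inv_mul_cancel₀ hp]
    simpa using J.add_mem h2 h1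

instance fieldPF (D : Ultrafilter Nat.Primes) : Field (PF D) :=
  Ideal.Quotient.field (nullIdeal D)

/-- Reduction of non-standard integers modulo `𝔭`. -/
def res {D : Ultrafilter Nat.Primes} (n : StarZ D) : PF D :=
  n.liftOn (fun f => PF.mk fun p => (f p : ZMod p)) fun _ _ h =>
    PF.mk_eq_mk.2 (h.mono fun _ hp => congrArg _ hp)

/-- Internal exponentiation: the class of `(x_p)` to the power of the class of `(n_p)` is the
class of `(x_p ^ n_p)`. -/
def ipow {D : Ultrafilter Nat.Primes} (x : PF D) (n : StarZ D) : PF D :=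
  Quotient.liftOn₂' x n (fun f k => PF.mk fun p => f p ^ k p) fun f k g l h1 h2 => by
    have h1' : (PF.mk f : PF D) = PF.mk g := Quotient.sound' h1
    rw [PF.mk_eq_mk] at h1' ⊢
    filter_upwards [h1', show ∀ᶠ p in D, k p = l p from h2] with p hp hq
    rw [hp, hq]

theorem ipow_mk {D : Ultrafilter Nat.Primes} (f : ∀ p : Nat.Primes, ZMod p)
    (k : Nat.Primes → ℤ) :
    ipow (PF.mk f : PF D) (k : StarZ D) = PF.mk fun p => f p ^ k p := rfl

/-- `ε` generates the multiplicative group of `F_𝔭` in the pseudo-finite sense. -/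
def IsPseudoGenerator {D : Ultrafilter Nat.Primes} (ε : (PF D)ˣ) : Prop :=
  ∀ x : PF D, x ≠ 0 → ∃ n : StarZ D, ipow (ε : PF D) n = x

/-! ## The pseudo-finite cyclic group and its exponential map -/

/-- The pseudo-finite cyclic group of order `(𝔭 - 1)𝔩`. -/
abbrev UGroup (D : Ultrafilter Nat.Primes) (𝔩 : StarZ D) : Type :=
  StarZ D ⧸ Ideal.span {(bigPrime D - 1) * 𝔩}

/-- The class of `n`, that is `n` times the generator. -/
abbrev UGroup.mk {D : Ultrafilter Nat.Primes} (𝔩 : StarZ D) (n : StarZ D) : UGroup D 𝔩 :=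
  Ideal.Quotient.mk (Ideal.span {(bigPrime D - 1) * 𝔩}) n

theorem ipow_add_period {D : Ultrafilter Nat.Primes} (ε : (PF D)ˣ) (m n t : StarZ D)
    (h : m - n = (bigPrime D - 1) * t) : ipow (ε : PF D) m = ipow (ε : PF D) n := by
  obtain ⟨f, hf⟩ := Ideal.Quotient.mk_surjective (ε : PF D)
  have hne : ∀ᶠ p in D, f p ≠ 0 := by
    rw [Ultrafilter.eventually_not]
    intro h0
    apply ε.ne_zero
    rw [← hf]
    exact Ideal.Quotient.eq_zero_iff_mem.2 h0
  rw [← hf]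
  induction m using Germ.inductionOn with | h m => ?_
  induction n using Germ.inductionOn with | h n => ?_
  induction t using Germ.inductionOn with | h t => ?_
  have h' : ∀ᶠ p : Nat.Primes in D, m p - n p = (((p : ℕ) : ℤ) - 1) * t p := Germ.coe_eq.1 h
  refine PF.mk_eq_mk.2 ?_
  filter_upwards [hne, h'] with p hp hq
  have e : m p = n p + (((p : ℕ) : ℤ) - 1) * t p := by linarith
  have hF : f p ^ (((p : ℕ) : ℤ) - 1) = 1 := by
    have h1 : (((p : ℕ) : ℤ) - 1) = (((p : ℕ) - 1 : ℕ) : ℤ) := by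
      have := p.2.one_lt
      omega
    rw [h1, zpow_natCast]
    exact ZMod.pow_card_sub_one_eq_one hp
  rw [e, zpow_add₀ hp, zpow_mul, hF, one_zpow, mul_one]

/-- The map `exp_𝔭`, sending `n` times the generator to `ε ^ n`. -/
def expP {D : Ultrafilter Nat.Primes} {𝔩 : StarZ D} (ε : (PF D)ˣ) (u : UGroup D 𝔩) : PF D :=
  Quotient.liftOn' u (fun n => ipow (ε : PF D) n) fun a b h => by
    have h' : UGroup.mk 𝔩 a = UGroup.mk 𝔩 b := Quotient.sound' h
    rw [Ideal.Quotient.eq, Ideal.mem_span_singleton] at h'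
    obtain ⟨t, ht⟩ := h'
    exact ipow_add_period ε a b (𝔩 * t) (by rw [ht, mul_assoc])

theorem expP_mk {D : Ultrafilter Nat.Primes} {𝔩 : StarZ D} (ε : (PF D)ˣ) (n : StarZ D) :
    expP ε (UGroup.mk 𝔩 n) = ipow (ε : PF D) n := rfl

/-- The element `α • w` of the group, for a non-standard rational `α` and a non-standard integer
`w` such that `α w` is a non-standard integer; the floor is then exact. -/
def scaled {D : Ultrafilter Nat.Primes} (𝔩 : StarZ D) (α : StarQ D) (w : StarZ D) : UGroup D 𝔩 :=
  UGroup.mk 𝔩 ((α * toQ w).map (fun q : ℚ => ⌊q⌋))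

/-- The large unit `𝐯 = 𝔭 - 1`. -/
def unitV (D : Ultrafilter Nat.Primes) : StarZ D := bigPrime D - 1

/-- The small unit `𝐮 = (𝔭 - 1) / 𝔦`; the division is exact when `𝔦` divides `𝔭 - 1`. -/
def unitU {D : Ultrafilter Nat.Primes} (𝔦 : StarZ D) : StarZ D := (bigPrime D - 1) / 𝔦

/-- The set of the `(K / (m𝔩)) • w` with `-l𝔩/2 ≤ K ≤ l𝔩/2` and `l, m` standard. It is `'ℝ'` for
`w = 𝐮` and `'iℝ'` for `w = 𝐯`. -/
def scaleLine {D : Ultrafilter Nat.Primes} (𝔩 w : StarZ D) : Set (UGroup D 𝔩) :=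
  {x | ∃ (K : StarZ D) (l m : ℕ), 0 < l ∧ 0 < m ∧
    -((l : StarZ D) * 𝔩) ≤ 2 * K ∧ 2 * K ≤ (l : StarZ D) * 𝔩 ∧
    x = scaled 𝔩 (toQ K / ((m : StarQ D) * toQ 𝔩)) w}

/-! ## Assumptions on the scales -/

/-- Uniform torsion of the solutions of linear equations in `𝔩`-th roots of unity, with
coefficients in `k`: a non-degenerate solution of `∑ cᵢ xᵢ = 1` in `n` such roots of unity consists
of roots of unity of order dividing `f n`, a standard number that depends on `n` only. -/
def UniformRootTorsion {D : Ultrafilter Nat.Primes} (𝔩 : StarZ D) (k : Subfield (PF D)) : Prop :=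
  ∃ f : ℕ → ℕ, (∀ n, 0 < f n) ∧ ∀ (n : ℕ) (c x : Fin n → PF D),
    (∀ i, c i ∈ k) → (∀ i, ipow (x i) 𝔩 = 1) → ∑ i, c i * x i = 1 →
    (∀ J : Finset (Fin n), J ≠ Finset.univ → ∑ i ∈ J, c i * x i ≠ 1) →
    ∀ i, x i ^ f n = 1

/-- The assumptions on the non-standard integers `𝔩 = μ²` and `𝔦 = ι²`. -/
structure IsScale (D : Ultrafilter Nat.Primes) (𝔩 μ 𝔦 ι : StarZ D) : Prop where
  mu_pos : 0 < μ
  iota_pos : 0 < ι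
  l_eq : 𝔩 = μ ^ 2
  i_eq : 𝔦 = ι ^ 2
  highly_divisible : ∀ m : ℕ, 0 < m → (m : StarZ D) ∣ 𝔩
  dvd_sub_one : ∀ m : ℕ, 0 < m → (m : StarZ D) * (𝔦 * 𝔩) ∣ bigPrime D - 1
  pow_lt : ∀ n : ℕ, 𝔩 ^ n < 𝔦
  generic :
    (𝔦 ^ 2 + 1 = bigPrime D ∧ UniformRootTorsion 𝔩 (Subfield.closure {res 𝔩})) ∨
    (AlgebraicIndependent ℤ ![res 𝔩, res 𝔦] ∧
      UniformRootTorsion 𝔩 (Subfield.closure {res 𝔩, res 𝔦}))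

/-! ## Places and internal sums -/

/-- A place of the field `K` with values in `L ∪ {∞}`: it sends `1` to `1` and respects sums and
products whenever these are defined in `L ∪ {∞}`, where `∞ + ∞` and `0 · ∞` are undefined. -/
structure IsPlace {K L : Type*} [Field K] [Field L] (f : K → OnePoint L) : Prop where
  map_one : f 1 = ((1 : L) : OnePoint L)
  map_add : ∀ (x y : K) (a b : L), f x = (a : OnePoint L) → f y = (b : OnePoint L) →
    f (x + y) = ((a + b : L) : OnePoint L)
  map_mul : ∀ (x y : K) (a b : L), f x = (a : OnePoint L) → f y = (b : OnePoint L) →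
    f (x * y) = ((a * b : L) : OnePoint L)
  map_add_infty : ∀ (x y : K) (b : L), f x = OnePoint.infty → f y = (b : OnePoint L) →
    f (x + y) = OnePoint.infty
  map_mul_infty : ∀ x y : K, f x = OnePoint.infty → f y ≠ ((0 : L) : OnePoint L) →
    f (x * y) = OnePoint.infty

/-- A map of an additive group to `L ∪ {∞}` that sends `0` to `0` and respects sums whenever these
are defined in `L ∪ {∞}`, where `∞ + ∞` is undefined. -/
structure IsAddPlace {A L : Type*} [AddGroup A] [AddGroup L] (f : A → OnePoint L) : Prop where
  map_zero : f 0 = ((0 : L) : OnePoint L)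
  map_add : ∀ (x y : A) (a b : L), f x = (a : OnePoint L) → f y = (b : OnePoint L) →
    f (x + y) = ((a + b : L) : OnePoint L)
  map_add_infty : ∀ (x y : A) (b : L), f x = OnePoint.infty → f y = (b : OnePoint L) →
    f (x + y) = OnePoint.infty

/-- `S` is the internal sum of `G n` over the non-standard integers `n` with `A ≤ n < B`: the
function `G` is internal, given by a family `g p : ℤ → ℤ/p`, and `S` is the class of the sequence
of the finite sums of `g p n` over `a p ≤ n < b p`. -/
def IsInternalSum {D : Ultrafilter Nat.Primes} (G : StarZ D → PF D) (A B : StarQ D) (S : PF D) :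
    Prop :=
  ∃ (g : ∀ p : Nat.Primes, ℤ → ZMod p) (a b : Nat.Primes → ℚ),
    A = (a : StarQ D) ∧ B = (b : StarQ D) ∧
    (∀ n : Nat.Primes → ℤ, G (n : StarZ D) = PF.mk fun p => g p (n p)) ∧
    S = PF.mk fun p => ∑ n ∈ Finset.Ico ⌈a p⌉ ⌈b p⌉, g p n

/-- The internal sum is unique. -/
theorem IsInternalSum.unique {D : Ultrafilter Nat.Primes} {G : StarZ D → PF D} {A B : StarQ D}
    {S T : PF D} (hS : IsInternalSum G A B S) (hT : IsInternalSum G A B T) : S = T := by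
  classical
  obtain ⟨g, a, b, rfl, rfl, hg, rfl⟩ := hS
  obtain ⟨g', a', b', ha, hb, hg', rfl⟩ := hT
  have key : ∀ᶠ p in D, ∀ n, g p n = g' p n := by
    let n : Nat.Primes → ℤ := fun p => if h : ∃ k, g p k ≠ g' p k then h.choose else 0
    filter_upwards [PF.mk_eq_mk.1 ((hg n).symm.trans (hg' n))] with p hp
    by_contra! h
    have e : n p = h.choose := dif_pos h
    rw [e] at hp
    exact h.choose_spec hp
  refine PF.mk_eq_mk.2 ?_
  filter_upwards [key, Germ.coe_eq.1 ha, Germ.coe_eq.1 hb] with p hp h1 h2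
  rw [h1, h2]
  exact Finset.sum_congr rfl fun n _ => hp n

end PseudoFinite

end

open PseudoFinite

/-!
A scale is built from factorials. By Dirichlet's theorem there is an ultrafilter for which `𝔭 - 1` is
divisible by all standard numbers (`exists_ultrafilter_forall_dvd`). Uniform torsion over `ℚ(𝔩, 𝔦)`
holds for standard `𝔩` by Mann's theorem on linear relations between roots of unity, over the field
`ℚ(𝔦)` (`pow_factorial_eq_one_of_nondegenerate`), and a diagonal argument makes it hold for an
infinite `𝔩`; algebraic independence is a matter of size (`exists_isScale`).

The place is found by extending homomorphisms from subrings of `F_𝔭` to `ℂ`. Such a homomorphism is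
encoded as its graph, a subring of `F_𝔭 × ℂ` that contains `(0, w)` only for `w = 0`, and every
such graph extends to a place (`exists_valuationSubring_extension`). It remains to produce a graph
with the prescribed values.

* *Roots of unity.* The homomorphism sends `1/μ` to `0`, `ι` to `exp(-πi/4)`, and the internal `𝔩`-th
  roots of unity to the limits of the corresponding complex numbers. It is well defined because
  a minimal relation between `𝔩`-th roots of unity over `ℤ[1/𝔩, 𝔦]` involves, up to a common
  factor, roots of standard order only, where the relations are those of the cyclotomic
  polynomials, and because the coefficients are algebraically independent
  (`exists_isGraph_transfer`, `IsScale.exists_place_roots`). If `𝔦² + 1 = 𝔭`, then `ι` is itself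
  a root of unity of order `8`, and the generator is adapted to it; otherwise `𝔦` is first sent to an
  indeterminate `s²`. A change of the primitive root of order `M𝔩`, for an infinite `M`, then
  takes care of the roots of unity of order `m𝔩` for all standard `m` (`SendsRoots.exists_lift`).
* *The small unit.* There are `ι` candidates for the generator `ε` that induce the same root of unity of
  order `M𝔩`, and fewer than `ι` zeros of the internal polynomials of bounded complexity with
  coefficients in the ring above. Hence `ε` can be chosen such that the powers of
  `y = ε ^ ((𝔭 - 1) / (M𝔦𝔩))` with exponents `κ` bounded by standard multiples of `M𝔩` are linearly
  independent over that ring (`exists_generic_generator`, `eq_zero_of_sum_mul_ipow_eq_zero`). So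
  they can be sent to arbitrary values of a character, in particular to the limits of
  `exp(-2πκ / (M𝔩))` (`IsScale.exists_isExpPlace`).

The additive map reads off the coordinates of an element with respect to the two units; they are unique
because `𝔦` exceeds all standard powers of `𝔩` (`HasCoordinates.unique`). The quadratic sums are
Gauss sums whose modulus is a square, for which an elementary evaluation is available
(`sum_Ico_zpow_sq`): the sum is an eighth root of unity times the square root of the modulus, and
the factor `ι` in the first case is compensated by its value under the place.
-/

namespace PseudoFinite

/-! ### Extension of places -/

section PlaceExtension

variable {K Ω : Type*} [Field K] [Field Ω]

/-- A subring of `K × Ω` that is the graph of a homomorphism from a subring of `K` to `Ω`. -/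
def IsGraph (T : Subring (K × Ω)) : Prop := ∀ w : Ω, ((0 : K), w) ∈ T → w = 0

theorem exists_maximal_isGraph {T₀ : Subring (K × Ω)} (h₀ : IsGraph T₀) :
    ∃ T, T₀ ≤ T ∧ Maximal IsGraph T := by
  refine zorn_le_nonempty₀ {T | IsGraph T} (fun c hc hch T hT => ?_) T₀ h₀
  refine ⟨sSup c, fun w hw => ?_, fun S hS => le_sSup hS⟩
  obtain ⟨S, hS, hw⟩ := (Subring.mem_sSup_of_directedOn ⟨T, hT⟩ hch.directedOn).1 hw
  exact hc hS w hw

/-- In a maximal graph, the elements with a nonzero second component are invertible. -/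
theorem isLocalHom_snd_of_maximal {T : Subring (K × Ω)} (hT : Maximal IsGraph T) :
    IsLocalHom ((RingHom.snd K Ω).comp T.subtype) := by
  refine ⟨fun t ht => ?_⟩
  have hw : (t : K × Ω).2 ≠ 0 := ht.ne_zero
  have hx : (t : K × Ω).1 ≠ 0 := fun h => hw (hT.1 _ (h ▸ t.2))
  set u : K × Ω := ((t : K × Ω).1⁻¹, (t : K × Ω).2⁻¹) with hu
  have htu : (t : K × Ω) * u = 1 := by
    ext <;> simp [hu, hx, hw]
  -- the localisation of the graph at `t` is again a graph
  let T' : Subring (K × Ω) :=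
    (Polynomial.eval₂RingHom T.subtype u).range
  have key : ∀ P : Polynomial T, ∃ (n : ℕ) (s : T),
      (t : K × Ω) ^ n * Polynomial.eval₂ T.subtype u P = s := by
    intro P
    induction P using Polynomial.induction_on' with
    | add P Q hP hQ =>
      obtain ⟨n, s, hs⟩ := hP
      obtain ⟨m, r, hr⟩ := hQ
      refine ⟨n + m, t ^ m * s + t ^ n * r, ?_⟩
      rw [Polynomial.eval₂_add]
      push_cast
      rw [← hs, ← hr]
      ring
    | monomial n a =>
      refine ⟨n, a, ?_⟩
      rw [Polynomial.eval₂_monomial, mul_left_comm, ← mul_pow, htu]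
      simp
  have hT' : IsGraph T' := by
    rintro w ⟨P, hP⟩
    obtain ⟨n, s, hs⟩ := key P
    have hP' : Polynomial.eval₂ T.subtype u P = (0, w) := hP
    rw [hP'] at hs
    have h1 : (t : K × Ω).2 ^ n * w = 0 := by
      apply hT.1
      have : (t : K × Ω) ^ n * ((0 : K), w) = (0, (t : K × Ω).2 ^ n * w) := by
        ext <;> simp
      rw [← this, hs]
      exact s.2
    simpa [hw] using h1
  have hle : T ≤ T' := fun x hx => ⟨Polynomial.C ⟨x, hx⟩, by simp⟩
  have hu' : u ∈ T := hT.2 hT' hle ⟨Polynomial.X, by simp⟩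
  exact IsUnit.of_mul_eq_one ⟨u, hu'⟩ (Subtype.ext htu)

/-- The element `x` of the valuation ring `V` is mapped to `a`. -/
def SendsTo (V : ValuationSubring K) (g : V →+* Ω) (x : K) (a : Ω) : Prop :=
  ∃ h : x ∈ V, g ⟨x, h⟩ = a

/-- A homomorphism from a subring of a field `K` to an algebraically closed field extends to a
valuation subring of `K`, in such a way that its kernel is the maximal ideal. -/
theorem exists_valuationSubring_extension [IsAlgClosed Ω] {T₀ : Subring (K × Ω)}
    (h₀ : IsGraph T₀) :
    ∃ (V : ValuationSubring K) (g : V →+* Ω), IsLocalHom g ∧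
      ∀ (x : K) (a : Ω), (x, a) ∈ T₀ → SendsTo V g x a := by
  obtain ⟨T, hT₀, hT⟩ := exists_maximal_isGraph h₀
  let ψ : T →+* Ω := (RingHom.snd K Ω).comp T.subtype
  let φ₀ : T →+* K := (RingHom.fst K Ω).comp T.subtype
  have : IsLocalHom ψ := isLocalHom_snd_of_maximal hT
  have : IsLocalRing T := RingHom.domain_isLocalRing ψ
  obtain ⟨B, hB, hloc⟩ := IsLocalRing.exists_factor_valuationRing φ₀
  let φ : T →+* B := φ₀.codRestrict B.toSubring hB
  have : IsLocalHom φ := hloc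
  let _ : Algebra (IsLocalRing.ResidueField T) (IsLocalRing.ResidueField B) :=
    (IsLocalRing.ResidueField.map φ).toAlgebra
  let _ : Algebra (IsLocalRing.ResidueField T) Ω := (IsLocalRing.ResidueField.lift ψ).toAlgebra
  have : Algebra.IsAlgebraic (IsLocalRing.ResidueField T) (IsLocalRing.ResidueField B) := by
    refine ⟨fun z => ?_⟩
    by_contra hz
    obtain ⟨b, rfl⟩ := IsLocalRing.residue_surjective z
    -- the graph could be enlarged by sending `b` to `0`
    let T' : Subring (K × Ω) := (Polynomial.eval₂RingHom T.subtype ((b : K), (0 : Ω))).range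
    have hT' : IsGraph T' := by
      rintro w ⟨P, hP⟩
      have h1 : Polynomial.eval₂ φ₀ (b : K) P = 0 := by
        have := congrArg (RingHom.fst K Ω) hP
        rwa [Polynomial.coe_eval₂RingHom, Polynomial.hom_eval₂] at this
      have h2 : ψ (P.coeff 0) = w := by
        have := congrArg (RingHom.snd K Ω) hP
        rw [Polynomial.coe_eval₂RingHom, Polynomial.hom_eval₂] at this
        simpa [ψ] using this
      have h3 : Polynomial.eval₂ φ b P = 0 := by
        have h : B.subtype (Polynomial.eval₂ φ b P) = 0 := by
          rw [Polynomial.hom_eval₂]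
          exact h1
        exact Subtype.ext h
      have h4 : Polynomial.aeval (IsLocalRing.residue B b)
          (P.map (IsLocalRing.residue T)) = 0 := by
        have h := congrArg (IsLocalRing.residue B) h3
        rw [Polynomial.hom_eval₂, map_zero] at h
        rw [Polynomial.aeval_def, Polynomial.eval₂_map]
        exact h
      have h5 : P.map (IsLocalRing.residue T) = 0 := by
        by_contra hne
        exact hz ⟨_, hne, h4⟩
      have h6 : IsLocalRing.residue T (P.coeff 0) = 0 := by
        rw [← Polynomial.coeff_map, h5, Polynomial.coeff_zero]
      rw [IsLocalRing.residue_eq_zero_iff, IsLocalRing.mem_maximalIdeal, mem_nonunits_iff] at h6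
      by_contra hw
      rw [← h2] at hw
      exact h6 (isUnit_of_map_unit ψ _ (isUnit_iff_ne_zero.2 hw))
    have hle : T ≤ T' := fun x hx => ⟨Polynomial.C ⟨x, hx⟩, by simp⟩
    have hb : ((b : K), (0 : Ω)) ∈ T := hT.2 hT' hle ⟨Polynomial.X, by simp⟩
    have hb' : φ ⟨_, hb⟩ = b := Subtype.ext rfl
    apply hz
    rw [← hb']
    exact isAlgebraic_algebraMap (R := IsLocalRing.ResidueField T)
      (A := IsLocalRing.ResidueField B) (IsLocalRing.residue T ⟨_, hb⟩)
  let j : IsLocalRing.ResidueField B →ₐ[IsLocalRing.ResidueField T] Ω := IsAlgClosed.lift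
  refine ⟨B, (j : IsLocalRing.ResidueField B →+* Ω).comp (IsLocalRing.residue B),
    inferInstance, fun x a hxa => ?_⟩
  have hx : (x, a) ∈ T := hT₀ hxa
  refine ⟨hB ⟨_, hx⟩, ?_⟩
  have h := j.commutes (IsLocalRing.residue T ⟨_, hx⟩)
  exact h

section SendsTo

variable {V : ValuationSubring K} {g : V →+* Ω} {x y : K} {a b : Ω}

theorem SendsTo.unique (hx : SendsTo V g x a) (hy : SendsTo V g x b) : a = b := by
  obtain ⟨_, rfl⟩ := hx
  obtain ⟨_, rfl⟩ := hy
  rfl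

theorem SendsTo.add (hx : SendsTo V g x a) (hy : SendsTo V g y b) :
    SendsTo V g (x + y) (a + b) := by
  obtain ⟨hx, rfl⟩ := hx
  obtain ⟨hy, rfl⟩ := hy
  exact ⟨V.add_mem _ _ hx hy, map_add g ⟨x, hx⟩ ⟨y, hy⟩⟩

theorem SendsTo.mul (hx : SendsTo V g x a) (hy : SendsTo V g y b) :
    SendsTo V g (x * y) (a * b) := by
  obtain ⟨hx, rfl⟩ := hx
  obtain ⟨hy, rfl⟩ := hy
  exact ⟨V.mul_mem _ _ hx hy, map_mul g ⟨x, hx⟩ ⟨y, hy⟩⟩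

theorem SendsTo.neg (hx : SendsTo V g x a) : SendsTo V g (-x) (-a) := by
  obtain ⟨hx, rfl⟩ := hx
  exact ⟨V.neg_mem _ hx, map_neg g ⟨x, hx⟩⟩

theorem sendsTo_zero : SendsTo V g 0 0 := ⟨V.zero_mem, map_zero g⟩

theorem sendsTo_one : SendsTo V g 1 1 := ⟨V.one_mem, map_one g⟩

theorem sendsTo_natCast (n : ℕ) : SendsTo V g n n := ⟨natCast_mem V.toSubring n, map_natCast g n⟩

theorem SendsTo.pow (hx : SendsTo V g x a) (n : ℕ) : SendsTo V g (x ^ n) (a ^ n) := by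
  obtain ⟨hx, rfl⟩ := hx
  exact ⟨V.toSubring.pow_mem hx n, map_pow g ⟨x, hx⟩ n⟩

theorem SendsTo.inv (hg : IsLocalHom g) (hx : SendsTo V g x a) (ha : a ≠ 0) :
    SendsTo V g x⁻¹ a⁻¹ := by
  obtain ⟨hx, rfl⟩ := hx
  obtain ⟨z, hz⟩ := isUnit_iff_exists_inv.1 (hg.map_nonunit _ (isUnit_iff_ne_zero.2 ha))
  have hz' : x * (z : K) = 1 := congrArg Subtype.val hz
  have hz2 : g ⟨x, hx⟩ * g z = 1 := by rw [← map_mul, hz, map_one]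
  rw [inv_eq_of_mul_eq_one_right hz', inv_eq_of_mul_eq_one_right hz2]
  exact ⟨z.2, rfl⟩

/-- Roots of elements of the valuation ring lie in the valuation ring. -/
theorem SendsTo.exists_of_pow {n : ℕ} (hn : 0 < n) (hx : SendsTo V g (x ^ n) b) :
    ∃ a, SendsTo V g x a ∧ a ^ n = b := by
  have hxV : x ∈ V := by
    rcases V.mem_or_inv_mem x with h | h
    · exact h
    · by_cases hx0 : x = 0
      · rw [hx0]
        exact V.zero_mem
      obtain ⟨m, rfl⟩ : ∃ m, n = m + 1 := ⟨n - 1, by omega⟩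
      have h1 : x = x ^ (m + 1) * (x⁻¹) ^ m := by
        rw [pow_succ', mul_assoc, ← mul_pow, mul_inv_cancel₀ hx0, one_pow, mul_one]
      rw [h1]
      exact V.mul_mem _ _ hx.1 (V.toSubring.pow_mem h m)
  have h1 : SendsTo V g x (g ⟨x, hxV⟩) := ⟨hxV, rfl⟩
  exact ⟨_, h1, (h1.pow n).unique hx⟩

end SendsTo

/-- The place of `K` that is given by a homomorphism on a valuation subring. -/
noncomputable def placeOfValuationSubring (V : ValuationSubring K) (g : V →+* Ω) (x : K) :
    OnePoint Ω :=
  open Classical in if h : x ∈ V then (g ⟨x, h⟩ : Ω) else OnePoint.infty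

theorem placeOfValuationSubring_eq_infty {V : ValuationSubring K} {g : V →+* Ω} {x : K} :
    placeOfValuationSubring V g x = OnePoint.infty ↔ x ∉ V := by
  unfold placeOfValuationSubring
  split_ifs with h <;> simp [h]

theorem placeOfValuationSubring_eq_coe {V : ValuationSubring K} {g : V →+* Ω} {x : K} {a : Ω} :
    placeOfValuationSubring V g x = (a : OnePoint Ω) ↔ SendsTo V g x a := by
  unfold placeOfValuationSubring SendsTo
  split_ifs with h <;> simp [h]

theorem isPlace_placeOfValuationSubring {V : ValuationSubring K} {g : V →+* Ω}
    (hg : IsLocalHom g) : IsPlace (placeOfValuationSubring V g) where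
  map_one := placeOfValuationSubring_eq_coe.2 ⟨V.one_mem, map_one g⟩
  map_add := by
    intro x y a b hx hy
    rw [placeOfValuationSubring_eq_coe] at hx hy ⊢
    exact hx.add hy
  map_mul := by
    intro x y a b hx hy
    rw [placeOfValuationSubring_eq_coe] at hx hy ⊢
    exact hx.mul hy
  map_add_infty := by
    intro x y b hx hy
    rw [placeOfValuationSubring_eq_infty] at hx ⊢
    rw [placeOfValuationSubring_eq_coe] at hy
    obtain ⟨hy, -⟩ := hy
    intro h
    apply hx
    have := V.toSubring.sub_mem h hy
    simpa using this
  map_mul_infty := by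
    intro x y hx hy
    rw [placeOfValuationSubring_eq_infty] at hx ⊢
    intro h
    -- the inverse of `y` lies in the valuation ring
    have hy' : y⁻¹ ∈ V := by
      by_cases hyV : y ∈ V
      · have h0 : g ⟨y, hyV⟩ ≠ 0 := fun h0 =>
          hy (placeOfValuationSubring_eq_coe.2 ⟨hyV, h0⟩)
        exact (SendsTo.inv hg ⟨hyV, rfl⟩ h0).1
      · exact (V.mem_or_inv_mem y).resolve_left hyV
    by_cases hy0 : y = 0
    · subst hy0
      exact hy (placeOfValuationSubring_eq_coe.2 ⟨V.zero_mem, map_zero g⟩)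
    · apply hx
      have := V.mul_mem _ _ h hy'
      rwa [mul_assoc, mul_inv_cancel₀ hy0, mul_one] at this

end PlaceExtension

/-! ### Quadratic Gauss sums of square modulus -/

section GaussSum

variable {k : Type*} [Field k]

/-- The sum of the powers of a `2N`-th root of unity `ρ` over a period. -/
theorem sum_Ico_zpow_of_pow_eq_one {ρ : k} {N : ℕ} (hρ : ρ ^ (2 * N) = 1) (h1 : ρ ≠ 1) :
    ∑ y ∈ Finset.Ico (-(N : ℤ)) N, ρ ^ y = 0 := by
  rcases Nat.eq_zero_or_pos N with rfl | hN
  · simp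
  have hρ0 : ρ ≠ 0 := by
    rintro rfl
    rw [zero_pow (by omega)] at hρ
    exact zero_ne_one hρ
  have e : ∑ y ∈ Finset.Ico (-(N : ℤ)) N, ρ ^ y
      = ρ ^ (-(N : ℤ)) * ∑ j ∈ Finset.range (2 * N), ρ ^ j := by
    rw [Finset.mul_sum]
    refine (Finset.sum_nbij' (fun j : ℕ => (j : ℤ) - N) (fun y : ℤ => (y + N).toNat)
      ?_ ?_ ?_ ?_ ?_).symm
    · intro j hj
      simp only [Finset.mem_range, Finset.mem_Ico] at hj ⊢
      omega
    · intro y hy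
      simp only [Finset.mem_range, Finset.mem_Ico] at hy ⊢
      omega
    · intro j _
      simp
    · intro y hy
      simp only [Finset.mem_Ico] at hy ⊢
      omega
    · intro j _
      rw [← zpow_natCast ρ j, ← zpow_add₀ hρ0]
      congr 1
      ring
  have h2 : ∑ j ∈ Finset.range (2 * N), ρ ^ j = 0 := by
    have h := mul_geom_sum ρ (2 * N)
    rw [hρ, sub_self] at h
    exact (mul_eq_zero.1 h).resolve_left (sub_ne_zero.2 h1)
  rw [e, h2, mul_zero]

/-- The quadratic Gauss sum for the modulus `(2N)²`: writing `n = x + 2Ny`, the sum over `y`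
vanishes unless `x = N`. -/
theorem sum_Ico_zpow_sq {ζ : k} {N : ℕ} (hN : 0 < N) (hζ : IsPrimitiveRoot ζ (8 * N ^ 2)) :
    ∑ n ∈ Finset.Ico (-(2 * (N : ℤ) ^ 2)) (2 * (N : ℤ) ^ 2), ζ ^ (n ^ 2)
      = (2 * N : ℕ) * ζ ^ (N ^ 2) := by
  have hN' : (0 : ℤ) < N := by exact_mod_cast hN
  have hζ0 : ζ ≠ 0 := hζ.ne_zero (by positivity)
  have h8 : ζ ^ (8 * (N : ℤ) ^ 2) = 1 := by
    have := hζ.pow_eq_one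
    rw [← zpow_natCast] at this
    exact_mod_cast this
  have e1 : ∑ n ∈ Finset.Ico (-(2 * (N : ℤ) ^ 2)) (2 * (N : ℤ) ^ 2), ζ ^ (n ^ 2)
      = ∑ z ∈ Finset.Ico (0 : ℤ) (2 * N) ×ˢ Finset.Ico (-(N : ℤ)) N,
          ζ ^ ((z.1 + 2 * N * z.2) ^ 2) := by
    refine (Finset.sum_nbij' (fun z : ℤ × ℤ => z.1 + 2 * N * z.2)
      (fun n => (n % (2 * N), n / (2 * N))) ?_ ?_ ?_ ?_ ?_).symm
    · rintro ⟨x, y⟩ hz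
      simp only [Finset.mem_product, Finset.mem_Ico] at hz ⊢
      obtain ⟨⟨h1, h2⟩, h3, h4⟩ := hz
      constructor <;> nlinarith
    · intro n hn
      simp only [Finset.mem_product, Finset.mem_Ico] at hn ⊢
      refine ⟨⟨Int.emod_nonneg _ (by positivity), Int.emod_lt_of_pos _ (by positivity)⟩, ?_, ?_⟩
      · rw [Int.le_ediv_iff_mul_le (by positivity)]
        nlinarith
      · rw [Int.ediv_lt_iff_lt_mul (by positivity)]
        nlinarith
    · rintro ⟨x, y⟩ hz
      simp only [Finset.mem_product, Finset.mem_Ico] at hz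
      ext
      · simp [Int.emod_eq_of_lt hz.1.1 hz.1.2]
      · simp only
        rw [Int.add_mul_ediv_left _ _ (by positivity), Int.ediv_eq_zero_of_lt hz.1.1 hz.1.2,
          zero_add]
    · intro n _
      exact Int.emod_add_mul_ediv n (2 * N)
    · intro z _
      rfl
  have e2 : ∀ x y : ℤ, ζ ^ ((x + 2 * N * y) ^ 2)
      = ζ ^ (x ^ 2) * (ζ ^ (4 * N * x + 4 * (N : ℤ) ^ 2)) ^ y := by
    intro x y
    obtain ⟨c, hc⟩ : ∃ c, y * (y - 1) = c + c := Int.even_mul_pred_self y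
    have : (x + 2 * N * y) ^ 2
        = x ^ 2 + ((4 * N * x + 4 * (N : ℤ) ^ 2) * y + 8 * (N : ℤ) ^ 2 * c) := by
      have hc' : y ^ 2 = y + 2 * c := by linarith
      linear_combination 4 * (N : ℤ) ^ 2 * hc'
    rw [this, zpow_add₀ hζ0, zpow_add₀ hζ0, zpow_mul, zpow_mul ζ (8 * (N : ℤ) ^ 2), h8, one_zpow,
      mul_one]
  rw [e1, Finset.sum_product]
  simp only [e2]
  rw [Finset.sum_eq_single (N : ℤ)]
  · have h1 : ζ ^ (4 * N * N + 4 * (N : ℤ) ^ 2) = 1 := by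
      rw [← h8]
      congr 1
      ring
    have h2 : ζ ^ ((N : ℤ) ^ 2) = ζ ^ (N ^ 2) := by
      rw [← zpow_natCast ζ (N ^ 2)]
      push_cast
      rfl
    rw [h1, h2]
    have h3 : ((N : ℤ) - -N).toNat = 2 * N := by omega
    simp only [one_zpow, mul_one, Finset.sum_const, Int.card_Ico, h3, nsmul_eq_mul]
  · intro x hx hxN
    rw [← Finset.mul_sum, sum_Ico_zpow_of_pow_eq_one, mul_zero]
    · rw [← zpow_natCast, ← zpow_mul]
      have : (4 * N * x + 4 * (N : ℤ) ^ 2) * ((2 * N : ℕ) : ℤ)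
          = 8 * (N : ℤ) ^ 2 * (x + N) := by
        push_cast
        ring
      rw [this, zpow_mul, h8, one_zpow]
    · intro h
      have h2 := (hζ.zpow_eq_one_iff_dvd _).1 h
      have h3 : (2 * (N : ℤ)) ∣ x + N := by
        obtain ⟨c, hc⟩ := h2
        refine ⟨c, ?_⟩
        push_cast at hc
        have : (4 * (N : ℤ)) * (x + N) = 4 * N * (2 * N * c) := by linear_combination hc
        exact mul_left_cancel₀ (by positivity) this
      rw [Finset.mem_Ico] at hx
      obtain ⟨c, hc⟩ := h3
      have hc1 : 0 < c := by nlinarith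
      have hc2 : c < 2 := by nlinarith
      have : c = 1 := by omega
      subst this
      exact hxN (by linarith)
  · intro h
    exact absurd (Finset.mem_Ico.2 ⟨by positivity, by linarith⟩) h

end GaussSum

/-! ### Linear relations between roots of unity -/

section RootsOfUnity

variable {K L : Type*} [Field K] [CharZero K] [Field L] [CharZero L]

/-- Integral relations between the powers of a primitive root of unity are the same in all fields
of characteristic zero: they are the multiples of the cyclotomic polynomial. -/
theorem aeval_primitiveRoot_transfer {n : ℕ} (hn : 0 < n) {z : K} {w : L}
    (hz : IsPrimitiveRoot z n) (hw : IsPrimitiveRoot w n) {P : Polynomial ℤ}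
    (hP : Polynomial.aeval z P = 0) : Polynomial.aeval w P = 0 := by
  have h1 : minpoly ℤ z ∣ P := minpoly.isIntegrallyClosed_dvd (hz.isIntegral hn) hP
  rw [← Polynomial.cyclotomic_eq_minpoly hz hn] at h1
  obtain ⟨Q, rfl⟩ := h1
  have : NeZero (n : L) := ⟨by exact_mod_cast hn.ne'⟩
  have h2 : Polynomial.aeval w (Polynomial.cyclotomic n ℤ) = 0 := by
    rw [Polynomial.aeval_def, ← Polynomial.eval_map, Polynomial.map_cyclotomic]
    exact hw.isRoot_cyclotomic hn
  rw [map_mul, h2, zero_mul]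

/-- A polynomial relation with coefficients in `ℤ[X_σ]` between algebraically independent elements
and a root of unity holds coefficientwise. It therefore persists when the algebraically independent
elements are replaced by arbitrary elements and the root of unity by one of the same order. -/
theorem sum_aeval_mul_pow_transfer {σ ι : Type*} {x : σ → K} (hx : AlgebraicIndependent ℤ x)
    (y : σ → L) {n : ℕ} (hn : 0 < n) {z : K} {w : L} (hz : IsPrimitiveRoot z n)
    (hw : IsPrimitiveRoot w n) (s : Finset ι) (c : ι → MvPolynomial σ ℤ) (e : ι → ℕ)
    (h : ∑ j ∈ s, MvPolynomial.aeval x (c j) * z ^ e j = 0) :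
    ∑ j ∈ s, MvPolynomial.aeval y (c j) * w ^ e j = 0 := by
  let A := integralClosure ℤ K
  have hxA : AlgebraicIndependent A x := hx.integralClosure
  let zA : A := ⟨z, hz.isIntegral hn⟩
  let F : MvPolynomial σ A :=
    ∑ j ∈ s, MvPolynomial.map (algebraMap ℤ A) (c j) * MvPolynomial.C (zA ^ e j)
  have hF : F = 0 := by
    apply hxA
    rw [map_zero, map_sum, ← h]
    refine Finset.sum_congr rfl fun j _ => ?_
    rw [map_mul, MvPolynomial.aeval_map_algebraMap, ← MvPolynomial.algebraMap_eq,
      AlgHom.commutes, map_pow]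
    rfl
  let P : (σ →₀ ℕ) → Polynomial ℤ := fun m =>
    ∑ j ∈ s, Polynomial.C ((c j).coeff m) * Polynomial.X ^ e j
  have hP : ∀ m, Polynomial.aeval z (P m) = 0 := by
    intro m
    have h1 := congrArg (MvPolynomial.coeff m) hF
    rw [MvPolynomial.coeff_zero, MvPolynomial.coeff_sum] at h1
    have h2 := congrArg (algebraMap A K) h1
    rw [map_zero, map_sum] at h2
    rw [← h2, map_sum]
    refine Finset.sum_congr rfl fun j _ => ?_
    rw [mul_comm (MvPolynomial.map _ _), MvPolynomial.coeff_C_mul, MvPolynomial.coeff_map, mul_comm,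
      map_mul, map_mul, map_pow, map_pow,
      Polynomial.aeval_C, Polynomial.aeval_X]
    rfl
  have hQ : ∀ m, Polynomial.aeval w (P m) = 0 := fun m =>
    aeval_primitiveRoot_transfer hn hz hw (hP m)
  classical
  let S : Finset (σ →₀ ℕ) := s.biUnion fun j => (c j).support
  have e1 : ∀ j ∈ s, MvPolynomial.aeval y (c j)
      = ∑ m ∈ S, (algebraMap ℤ L ((c j).coeff m)) * ∏ i ∈ m.support, y i ^ m i := by
    intro j hj
    rw [MvPolynomial.aeval_def, MvPolynomial.eval₂_eq]
    refine Finset.sum_subset (Finset.subset_biUnion_of_mem (fun j => (c j).support) hj) ?_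
    intro m _ hm
    rw [MvPolynomial.notMem_support_iff.1 hm, map_zero, zero_mul]
  calc ∑ j ∈ s, MvPolynomial.aeval y (c j) * w ^ e j
      = ∑ m ∈ S, (∏ i ∈ m.support, y i ^ m i) * Polynomial.aeval w (P m) := by
        simp only [P, map_sum, map_mul, map_pow, Polynomial.aeval_C, Polynomial.aeval_X,
          Finset.mul_sum]
        rw [Finset.sum_comm]
        refine Finset.sum_congr rfl fun j hj => ?_
        rw [e1 j hj, Finset.sum_mul]
        refine Finset.sum_congr rfl fun m _ => ?_
        ring
    _ = 0 := by simp [hQ]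

theorem aeval_mem_subfield {F : Type*} [Field F] {σ : Type*} (k : Subfield F) {x : σ → F}
    (hx : ∀ i, x i ∈ k) (P : MvPolynomial σ ℤ) : MvPolynomial.aeval x P ∈ k := by
  have h1 : MvPolynomial.aeval x P ∈ Algebra.adjoin ℤ (Set.range x) := by
    rw [Algebra.adjoin_range_eq_range_aeval]
    exact ⟨P, rfl⟩
  have h2 : Algebra.adjoin ℤ (Set.range x) ≤ subalgebraOfSubring k.toSubring :=
    Algebra.adjoin_le (by rintro _ ⟨i, rfl⟩; exact hx i)
  exact h2 h1

theorem exists_eq_aeval_div_of_mem_closure {F : Type*} [Field F] {σ : Type*} {x : σ → F} {y : F}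
    (hy : y ∈ Subfield.closure (Set.range x)) :
    ∃ P Q : MvPolynomial σ ℤ, y = MvPolynomial.aeval x P / MvPolynomial.aeval x Q := by
  have hmem : ∀ u ∈ Subring.closure (Set.range x), ∃ P : MvPolynomial σ ℤ,
      MvPolynomial.aeval x P = u := by
    intro u hu
    have h1 : u ∈ Algebra.adjoin ℤ (Set.range x) := by
      rw [Algebra.adjoin_int]
      exact hu
    rw [Algebra.adjoin_range_eq_range_aeval] at h1
    exact h1
  obtain ⟨u, hu, v, hv, rfl⟩ := Subfield.mem_closure_iff.1 hy
  obtain ⟨P, rfl⟩ := hmem u hu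
  obtain ⟨Q, rfl⟩ := hmem v hv
  exact ⟨P, Q, rfl⟩

/-- Transfer of linear relations from `K` to `L`. The elements `a g` satisfy uniform torsion for
linear equations over a field `k` that contains the algebraically independent `x`. Then a relation
between the `a g` with coefficients in `ℤ[x]` remains true when `x` and `a` are replaced by `y` and
`b`: a minimal relation involves, up to a common factor, roots of unity of standard order only. -/
theorem sum_aeval_mul_transfer {σ ι G : Type*} [CommGroup G] {x : σ → K}
    (hx : AlgebraicIndependent ℤ x) (y : σ → L) (a : G →* K) (b : G →* L)
    (hab : ∀ g, a g = 1 → b g = 1)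
    (hroot : ∀ n : ℕ, 0 < n → ∃ h, IsPrimitiveRoot (a h) n ∧ IsPrimitiveRoot (b h) n)
    (k : Subfield K) (hk : ∀ i, x i ∈ k) (f : ℕ → ℕ) (hf : ∀ n, 0 < f n)
    (hT : ∀ (n : ℕ) (c : Fin n → K) (g : Fin n → G), (∀ i, c i ∈ k) →
      ∑ i, c i * a (g i) = 1 →
      (∀ J : Finset (Fin n), J ≠ Finset.univ → ∑ i ∈ J, c i * a (g i) ≠ 1) →
      ∀ i, a (g i) ^ f n = 1)
    (c : ι → MvPolynomial σ ℤ) (g : ι → G) (s : Finset ι)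
    (h : ∑ j ∈ s, MvPolynomial.aeval x (c j) * a (g j) = 0) :
    ∑ j ∈ s, MvPolynomial.aeval y (c j) * b (g j) = 0 := by
  classical
  induction hn : s.card using Nat.strong_induction_on generalizing s with
  | _ n ih => ?_
  by_cases hmin : ∃ t ⊆ s, t ≠ s ∧ t.Nonempty ∧
      ∑ j ∈ t, MvPolynomial.aeval x (c j) * a (g j) = 0
  · obtain ⟨t, hts, hne, hnon, ht⟩ := hmin
    have h1 := Finset.card_lt_card (Finset.ssubset_iff_subset_ne.2 ⟨hts, hne⟩)
    have h2 := Finset.card_sdiff_add_card_eq_card hts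
    have h3 := hnon.card_pos
    have h4 : ∑ j ∈ s \ t, MvPolynomial.aeval x (c j) * a (g j) = 0 := by
      rw [← Finset.sum_sdiff hts, ht, add_zero] at h
      exact h
    rw [← Finset.sum_sdiff hts, ih _ (by omega) t ht rfl, ih _ (by omega) _ h4 rfl, add_zero]
  rcases s.eq_empty_or_nonempty with rfl | ⟨j₀, hj₀⟩
  · simp
  have ha0 : ∀ g, a g ≠ 0 := fun g => ((Group.isUnit g).map a).ne_zero
  by_cases hc0 : MvPolynomial.aeval x (c j₀) = 0
  · have h1 : s = {j₀} := by
      by_contra hne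
      exact hmin ⟨{j₀}, by simpa using hj₀, fun h => hne h.symm, by simp, by simp [hc0]⟩
    have h2 : c j₀ = 0 := hx (by rw [hc0, map_zero])
    rw [h1]
    simp [h2]
  -- normalise the minimal relation to an equation with right hand side `1`
  set t := s.erase j₀ with ht
  have hs : s = insert j₀ t := (Finset.insert_erase hj₀).symm
  have hjt : j₀ ∉ t := Finset.notMem_erase _ _
  let e : Fin t.card ≃ t := t.equivFin.symm
  let c' : Fin t.card → K := fun i =>
    -MvPolynomial.aeval x (c (e i)) / MvPolynomial.aeval x (c j₀)
  let g' : Fin t.card → G := fun i => g (e i) * (g j₀)⁻¹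
  have hck : ∀ p : MvPolynomial σ ℤ, MvPolynomial.aeval x p ∈ k := aeval_mem_subfield k hk
  have hterm : ∀ i, c' i * a (g' i) = -(MvPolynomial.aeval x (c (e i)) * a (g (e i))) /
      (MvPolynomial.aeval x (c j₀) * a (g j₀)) := by
    intro i
    have h1 : a (g j₀)⁻¹ = (a (g j₀))⁻¹ := by
      rw [eq_comm, inv_eq_iff_eq_inv, eq_comm]
      apply inv_eq_of_mul_eq_one_left
      rw [← map_mul, mul_inv_cancel, map_one]
    have := ha0 (g j₀)
    simp only [c', g', map_mul, h1]
    field_simp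
  have hsub : ∀ J : Finset (Fin t.card), ∑ i ∈ J, c' i * a (g' i) = 1 ↔
      ∑ j ∈ insert j₀ (J.image fun i => (e i : ι)),
        MvPolynomial.aeval x (c j) * a (g j) = 0 := by
    intro J
    have h0 : j₀ ∉ J.image fun i => (e i : ι) := by
      intro h
      obtain ⟨i, _, hi⟩ := Finset.mem_image.1 h
      exact hjt (hi ▸ (e i).2)
    rw [Finset.sum_insert h0, Finset.sum_image (fun i _ j _ hij => e.injective (Subtype.ext hij))]
    simp only [hterm]
    rw [← Finset.sum_div, div_eq_one_iff_eq (mul_ne_zero hc0 (ha0 _)), Finset.sum_neg_distrib,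
      neg_eq_iff_add_eq_zero, add_comm]
  have himg : (Finset.univ.image fun i => (e i : ι)) = t := by
    ext j
    simp only [Finset.mem_image, Finset.mem_univ, true_and]
    exact ⟨fun ⟨i, hi⟩ => hi ▸ (e i).2, fun hj => ⟨e.symm ⟨j, hj⟩, by simp⟩⟩
  have htors := hT t.card c' g'
    (fun i => k.div_mem (k.neg_mem (hck _)) (hck _))
    ((hsub _).2 (by rw [himg, ← hs]; exact h))
    (by
      intro J hJ hJ1
      rw [hsub] at hJ1
      refine hmin ⟨_, ?_, ?_, Finset.insert_nonempty _ _, hJ1⟩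
      · rw [hs]
        exact Finset.insert_subset_insert _
          ((Finset.image_subset_image (Finset.subset_univ J)).trans himg.le)
      · intro heq
        apply hJ
        rw [Finset.eq_univ_iff_forall]
        intro i
        have h1 : (e i : ι) ∈ s := hs ▸ Finset.mem_insert_of_mem (e i).2
        rw [← heq, Finset.mem_insert] at h1
        rcases h1 with h1 | h1
        · exact absurd (h1 ▸ (e i).2) hjt
        · obtain ⟨i', hi', hii⟩ := Finset.mem_image.1 h1
          rwa [← e.injective (Subtype.ext hii)])
  obtain ⟨z, hz, hw⟩ := hroot _ (hf t.card)
  have hpow : ∀ j ∈ s, ∃ m : ℕ, a (g j * (g j₀)⁻¹) = a z ^ m := by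
    intro j hj
    rw [hs, Finset.mem_insert] at hj
    rcases hj with rfl | hj
    · exact ⟨0, by simp⟩
    · have h1 := htors (e.symm ⟨j, hj⟩)
      simp only [g', Equiv.apply_symm_apply] at h1
      have : NeZero (f t.card) := ⟨(hf _).ne'⟩
      obtain ⟨m, _, hm⟩ := hz.eq_pow_of_pow_eq_one h1
      exact ⟨m, hm.symm⟩
  choose! m hm using hpow
  have hfac : ∀ j ∈ s, a (g j) = a (g j₀) * a z ^ m j ∧ b (g j) = b (g j₀) * b z ^ m j := by
    intro j hj
    have h1 : a (g j * (g j₀)⁻¹ * (z ^ m j)⁻¹) = 1 := by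
      rw [map_mul, hm j hj, ← map_pow, ← map_mul, mul_inv_cancel, map_one]
    have h2 := hab _ h1
    have h3 : g j = g j₀ * z ^ m j * (g j * (g j₀)⁻¹ * (z ^ m j)⁻¹) := by
      rw [mul_comm (g j₀ * z ^ m j), mul_assoc (g j), ← mul_inv, inv_mul_cancel_right]
    constructor
    · conv_lhs => rw [h3]
      rw [map_mul, h1, mul_one, map_mul, map_pow]
    · conv_lhs => rw [h3]
      rw [map_mul, h2, mul_one, map_mul, map_pow]
  have hK : ∑ j ∈ s, MvPolynomial.aeval x (c j) * a z ^ m j = 0 := by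
    have h1 : a (g j₀) * ∑ j ∈ s, MvPolynomial.aeval x (c j) * a z ^ m j = 0 := by
      rw [← h, Finset.mul_sum]
      refine Finset.sum_congr rfl fun j hj => ?_
      rw [(hfac j hj).1]
      ring
    exact (mul_eq_zero.1 h1).resolve_left (ha0 _)
  have hL := sum_aeval_mul_pow_transfer hx y (hf t.card) hz hw s c m hK
  calc ∑ j ∈ s, MvPolynomial.aeval y (c j) * b (g j)
      = b (g j₀) * ∑ j ∈ s, MvPolynomial.aeval y (c j) * b z ^ m j := by
        rw [Finset.mul_sum]
        refine Finset.sum_congr rfl fun j hj => ?_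
        rw [(hfac j hj).2]
        ring
    _ = 0 := by rw [hL, mul_zero]

/-- The transfer of relations as a homomorphism from the ring generated by `x` and `a` to `L`. -/
theorem exists_isGraph_transfer {σ G : Type*} [CommGroup G] {x : σ → K}
    (hx : AlgebraicIndependent ℤ x) (y : σ → L) (a : G →* K) (b : G →* L)
    (hab : ∀ g, a g = 1 → b g = 1)
    (hroot : ∀ n : ℕ, 0 < n → ∃ h, IsPrimitiveRoot (a h) n ∧ IsPrimitiveRoot (b h) n)
    (k : Subfield K) (hk : ∀ i, x i ∈ k) (f : ℕ → ℕ) (hf : ∀ n, 0 < f n)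
    (hT : ∀ (n : ℕ) (c : Fin n → K) (g : Fin n → G), (∀ i, c i ∈ k) →
      ∑ i, c i * a (g i) = 1 →
      (∀ J : Finset (Fin n), J ≠ Finset.univ → ∑ i ∈ J, c i * a (g i) ≠ 1) →
      ∀ i, a (g i) ^ f n = 1) :
    ∃ T : Subring (K × L), IsGraph T ∧ (∀ i, (x i, y i) ∈ T) ∧ ∀ g, (a g, b g) ∈ T := by
  let α : MvPolynomial σ ℤ →+* K × L :=
    (MvPolynomial.aeval x).toRingHom.prod (MvPolynomial.aeval y).toRingHom
  let Φ : MonoidAlgebra (MvPolynomial σ ℤ) G →+* K × L :=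
    MonoidAlgebra.liftNCRingHom α (a.prod b) fun _ _ => Commute.all _ _
  have hΦ : ∀ F : MonoidAlgebra (MvPolynomial σ ℤ) G,
      Φ F = ∑ g ∈ F.coeff.support, α (F.coeff g) * (a g, b g) := fun F => rfl
  refine ⟨Φ.range, ?_, fun i => ?_, fun g => ?_⟩
  · rintro w ⟨F, hF⟩
    rw [hΦ] at hF
    have h1 := congrArg (RingHom.fst K L) hF
    have h2 := congrArg (RingHom.snd K L) hF
    rw [map_sum] at h1 h2
    rw [show w = (RingHom.snd K L) (0, w) from rfl, ← h2]
    exact sum_aeval_mul_transfer hx y a b hab hroot k hk f hf hT F.coeff id _ h1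
  · refine ⟨MonoidAlgebra.single 1 (MvPolynomial.X i), ?_⟩
    have : Φ (MonoidAlgebra.single 1 (MvPolynomial.X i)) = α (MvPolynomial.X i) * (a.prod b) 1 :=
      MonoidAlgebra.liftNC_single _ _ _ _
    rw [this]
    simp [α]
  · refine ⟨MonoidAlgebra.single g 1, ?_⟩
    have : Φ (MonoidAlgebra.single g 1) = α 1 * (a.prod b) g :=
      MonoidAlgebra.liftNC_single _ _ _ _
    rw [this]
    simp

/-! ### Mann's theorem -/

theorem sum_range_pow_mul {F : Type*} [Field F] {ω : F} {p : ℕ} (hω : IsPrimitiveRoot ω p)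
    (m : ℕ) : ∑ s ∈ Finset.range p, ω ^ (s * m) = if p ∣ m then (p : F) else 0 := by
  have e : ∑ s ∈ Finset.range p, ω ^ (s * m) = ∑ s ∈ Finset.range p, (ω ^ m) ^ s :=
    Finset.sum_congr rfl fun s _ => by rw [mul_comm, pow_mul]
  rw [e]
  split_ifs with h
  · rw [(hω.pow_eq_one_iff_dvd m).2 h]
    simp
  · have h1 := mul_geom_sum (ω ^ m) p
    rw [← pow_mul, mul_comm m, pow_mul, hω.pow_eq_one, one_pow, sub_self] at h1
    exact (mul_eq_zero.1 h1).resolve_left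
      (sub_ne_zero.2 fun h2 => h ((hω.pow_eq_one_iff_dvd m).1 h2))

/-- The step of Mann's argument. If the equation `∑ cᵢ zᵉⁱ = 1` holds for all primitive `N`-th roots
of unity and has no proper subsum equal to `1`, then a prime `p` divides all `eᵢ` if `p²` divides
`N`, or if `p` divides `N` and exceeds the number of terms by at least two. -/
theorem prime_dvd_of_conjugate_solutions {n N p : ℕ} (hp : p.Prime) (hpN : p ∣ N) (hN : 0 < N)
    (hcase : p ^ 2 ∣ N ∨ n + 1 < p) {z : K} (hz : IsPrimitiveRoot z N) (c : Fin n → K)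
    (e : Fin n → ℕ) (hconj : ∀ w, IsPrimitiveRoot w N → ∑ i, c i * w ^ e i = 1)
    (hmin : ∀ J : Finset (Fin n), J ≠ Finset.univ → ∑ i ∈ J, c i * z ^ e i ≠ 1) (i : Fin n) :
    p ∣ e i := by
  obtain ⟨M, rfl⟩ := hpN
  have hM : 0 < M := Nat.pos_of_mul_pos_left hN
  set ω := z ^ M with hω
  have hωp : IsPrimitiveRoot ω p := hz.pow hN (mul_comm _ _)
  -- the defect of the equation at the root `z ^ (1 + M s)`, which is primitive unless `p` divides
  -- `1 + M s`
  let R : ℕ → K := fun s => ∑ i, c i * (z ^ (1 + M * s)) ^ e i - 1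
  have hR0 : ∀ s, ¬ p ∣ 1 + M * s → R s = 0 := by
    intro s hs
    have h1 : Nat.Coprime (1 + M * s) (p * M) :=
      Nat.Coprime.mul_right ((Nat.Prime.coprime_iff_not_dvd hp).2 hs).symm
        (by rw [Nat.coprime_add_mul_left_left]; exact Nat.coprime_one_left M)
    exact sub_eq_zero.2 (hconj _ (hz.pow_of_coprime _ h1))
  have hRexp : ∀ s, R s = ∑ i, c i * z ^ e i * ω ^ (s * e i) - 1 := by
    intro s
    simp only [R]
    congr 1
    refine Finset.sum_congr rfl fun i _ => ?_
    rw [hω, mul_assoc, ← pow_mul, ← pow_mul, ← pow_add]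
    congr 2
    ring
  have hsum : ∀ b, ∑ s ∈ Finset.range p, R s * ω ^ (s * b) =
      ∑ i, c i * z ^ e i * (if p ∣ e i + b then (p : K) else 0) -
        (if p ∣ b then (p : K) else 0) := by
    intro b
    simp only [← sum_range_pow_mul hωp, hRexp, sub_mul, one_mul, Finset.sum_sub_distrib]
    congr 1
    simp only [Finset.sum_mul, Finset.mul_sum]
    rw [Finset.sum_comm]
    refine Finset.sum_congr rfl fun i _ => Finset.sum_congr rfl fun s _ => ?_
    rw [mul_assoc, ← pow_add]
    congr 2
    ring
  -- at most one value of `s` is exceptional, and a weighted sum shows that its defect vanishes too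
  have htot : ∑ s ∈ Finset.range p, R s = 0 := by
    by_cases hs : ∃ s₀ < p, p ∣ 1 + M * s₀
    · obtain ⟨s₀, hs₀p, hs₀⟩ := hs
      have hpM : ¬ p ∣ M := by
        intro h
        have h1 := (Nat.dvd_add_left (h.mul_right s₀)).1 hs₀
        exact hp.one_lt.ne' (Nat.dvd_one.1 h1)
      have hnp : n + 1 < p := by
        refine hcase.resolve_left fun h => hpM ?_
        rw [pow_two] at h
        exact Nat.dvd_of_mul_dvd_mul_left hp.pos h
      have huniq : ∀ s < p, s ≠ s₀ → R s = 0 := by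
        intro s hsp hne
        refine hR0 s fun h => hne ?_
        have h1 : 1 + M * s ≡ 1 + M * s₀ [MOD p] :=
          ((Nat.modEq_zero_iff_dvd).2 h).trans ((Nat.modEq_zero_iff_dvd).2 hs₀).symm
        have h2 := Nat.ModEq.add_left_cancel' 1 h1
        have h3 := Nat.ModEq.cancel_left_of_coprime
          ((Nat.Prime.coprime_iff_not_dvd hp).2 hpM) h2
        exact Nat.ModEq.eq_of_lt_of_lt h3 hsp hs₀p
      -- a residue `b` that is not hit by the exponents, nor by the constant term
      obtain ⟨b, hb, hb'⟩ : ∃ b ∈ Finset.range p,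
          b ∉ insert 0 (Finset.univ.image fun i => e i % p) := by
        apply Finset.exists_mem_notMem_of_card_lt_card
        calc _ ≤ (Finset.univ.image fun i => e i % p).card + 1 := Finset.card_insert_le _ _
          _ ≤ n + 1 := by
            gcongr
            simpa using Finset.card_image_le (s := Finset.univ) (f := fun i : Fin n => e i % p)
          _ < _ := by simpa using hnp
      rw [Finset.mem_range] at hb
      rw [Finset.mem_insert, not_or] at hb'
      have hz0 : ∑ s ∈ Finset.range p, R s * ω ^ (s * (p - b)) = 0 := by
        rw [hsum, if_neg, sub_zero]
        · refine Finset.sum_eq_zero fun i _ => ?_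
          rw [if_neg, mul_zero]
          intro h
          apply hb'.2
          refine Finset.mem_image.2 ⟨i, Finset.mem_univ _, ?_⟩
          have h1 : e i + (p - b) + b ≡ 0 + b [MOD p] :=
            ((Nat.modEq_zero_iff_dvd).2 h).add_right b
          have h2 : e i + (p - b) + b = e i + p := by omega
          rw [h2, zero_add] at h1
          have h3 : (e i + p) % p = b % p := h1
          rwa [Nat.add_mod_right, Nat.mod_eq_of_lt hb] at h3
        · intro h
          have := Nat.le_of_dvd (by omega) h
          have := hb'.1
          omega
      have hR₀ : R s₀ * ω ^ (s₀ * (p - b)) = 0 := by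
        rw [← hz0]
        refine (Finset.sum_eq_single (f := fun s => R s * ω ^ (s * (p - b))) s₀
          (fun s hs hne => ?_) fun h => ?_).symm
        · simp only [huniq s (Finset.mem_range.1 hs) hne, zero_mul]
        · exact absurd (Finset.mem_range.2 hs₀p) h
      have hR₀' : R s₀ = 0 :=
        (mul_eq_zero.1 hR₀).resolve_right (pow_ne_zero _ (hωp.ne_zero hp.ne_zero))
      refine Finset.sum_eq_zero fun s hs => ?_
      by_cases hne : s = s₀
      · rw [hne, hR₀']
      · exact huniq s (Finset.mem_range.1 hs) hne
    · push Not at hs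
      exact Finset.sum_eq_zero fun s h => hR0 s (hs s (Finset.mem_range.1 h))
  have h0 := hsum 0
  simp only [mul_zero, pow_zero, mul_one, add_zero, dvd_zero, if_true] at h0
  rw [htot] at h0
  have hp0 : (p : K) ≠ 0 := by exact_mod_cast hp.ne_zero
  -- the average over all `s` retains just the terms with `p ∣ e i`
  have hJ : ∑ i ∈ Finset.univ.filter (fun i => p ∣ e i), c i * z ^ e i = 1 := by
    rw [Finset.sum_filter]
    have h1 : (p : K) * ∑ i, (if p ∣ e i then c i * z ^ e i else 0) = p * 1 := by
      refine Eq.trans ?_ ((sub_eq_zero.1 h0.symm).trans (mul_one _).symm)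
      rw [Finset.mul_sum]
      refine Finset.sum_congr rfl fun i _ => ?_
      split_ifs <;> ring
    exact mul_left_cancel₀ hp0 h1
  by_contra hi
  refine hmin _ (fun h => hi ?_) hJ
  have := Finset.mem_univ i
  rw [← h] at this
  exact (Finset.mem_filter.1 this).2

/-- Linear equations with coefficients in a purely transcendental field `ℚ(t)` do not
distinguish the primitive `N`-th roots of unity. -/
theorem conjugate_solution {t : K} (ht : Transcendental ℤ t) {n N : ℕ} (hN : 0 < N) {z w : K}
    (hz : IsPrimitiveRoot z N) (hw : IsPrimitiveRoot w N) (c : Fin n → K)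
    (hc : ∀ i, c i ∈ Subfield.closure {t}) (e : Fin n → ℕ) (h : ∑ i, c i * z ^ e i = 1) :
    ∑ i, c i * w ^ e i = 1 := by
  have hfrac : ∀ i, ∃ P Q : MvPolynomial Unit ℤ, MvPolynomial.aeval (fun _ => t) Q ≠ 0 ∧
      c i = MvPolynomial.aeval (fun _ => t) P / MvPolynomial.aeval (fun _ => t) Q := by
    intro i
    obtain ⟨P, Q, h1⟩ := exists_eq_aeval_div_of_mem_closure (x := fun _ : Unit => t)
      (by rw [Set.range_const]; exact hc i)
    by_cases hQ : MvPolynomial.aeval (fun _ => t) Q = 0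
    · refine ⟨0, 1, by simp, ?_⟩
      rw [h1, hQ]
      simp
    · exact ⟨P, Q, hQ, h1⟩
  choose P Q hQ hPQ using hfrac
  have hx : AlgebraicIndependent ℤ (fun _ : Unit => t) :=
    algebraicIndependent_unique_type_iff.2 ht
  -- clear denominators
  let q : MvPolynomial Unit ℤ := ∏ i, Q i
  have hq : MvPolynomial.aeval (fun _ => t) q ≠ 0 := by
    rw [map_prod]
    exact Finset.prod_ne_zero_iff.2 fun i _ => hQ i
  let d : Option (Fin n) → MvPolynomial Unit ℤ := fun o =>
    o.elim (-q) fun i => P i * ∏ j ∈ Finset.univ.erase i, Q j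
  let e' : Option (Fin n) → ℕ := fun o => o.elim 0 e
  have key : ∀ u : K, ∑ o, MvPolynomial.aeval (fun _ => t) (d o) * u ^ e' o =
      MvPolynomial.aeval (fun _ => t) q * (∑ i, c i * u ^ e i - 1) := by
    intro u
    rw [Fintype.sum_option, mul_sub, mul_one, Finset.mul_sum, add_comm, sub_eq_add_neg]
    congr 1
    · refine Finset.sum_congr rfl fun i _ => ?_
      simp only [d, e', Option.elim_some, q]
      rw [← Finset.mul_prod_erase Finset.univ Q (Finset.mem_univ i), hPQ i, map_mul, map_mul]
      have := hQ i
      field_simp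
    · simp [d, e']
  have h1 := sum_aeval_mul_pow_transfer hx (fun _ => t) hN hz hw Finset.univ d e'
    (by rw [key, h, sub_self, mul_zero])
  rw [key] at h1
  exact sub_eq_zero.1 ((mul_eq_zero.1 h1).resolve_left hq)

/-- **Mann's theorem** over `ℚ(t)`: a non-degenerate solution of a linear equation in `n` roots of
unity consists of roots of unity whose order divides `(n + 1)!`. -/
theorem pow_factorial_eq_one_of_nondegenerate {t : K} (ht : Transcendental ℤ t)
    (hroot : ∀ n : ℕ, 0 < n → ∃ z : K, IsPrimitiveRoot z n) {n L : ℕ} (hL : 0 < L)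
    (c x : Fin n → K) (hc : ∀ i, c i ∈ Subfield.closure {t}) (hx : ∀ i, x i ^ L = 1)
    (h1 : ∑ i, c i * x i = 1)
    (hmin : ∀ J : Finset (Fin n), J ≠ Finset.univ → ∑ i ∈ J, c i * x i ≠ 1) (i : Fin n) :
    x i ^ (n + 1).factorial = 1 := by
  classical
  -- for the exact common order `N` of the solution, no prime `p` as in the previous lemma exists
  have hex : ∃ N : ℕ, 0 < N ∧ ∀ i, x i ^ N = 1 := ⟨L, hL, hx⟩
  obtain ⟨hN, hxN⟩ := Nat.find_spec hex
  set N := Nat.find hex with hNdef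
  obtain ⟨z, hz⟩ := hroot N hN
  have : NeZero N := ⟨hN.ne'⟩
  have hpow : ∀ i, ∃ e : ℕ, x i = z ^ e := fun i => by
    obtain ⟨e, _, he⟩ := hz.eq_pow_of_pow_eq_one (hxN i)
    exact ⟨e, he.symm⟩
  choose e he using hpow
  simp only [he] at h1 hmin
  have hconj : ∀ w, IsPrimitiveRoot w N → ∑ i, c i * w ^ e i = 1 := fun w hw =>
    conjugate_solution ht hN hz hw c hc e h1
  have hno : ∀ p : ℕ, p.Prime → p ∣ N → ¬ (p ^ 2 ∣ N ∨ n + 1 < p) := by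
    intro p hp hpN hcase
    have h2 := prime_dvd_of_conjugate_solutions hp hpN hN hcase hz c e hconj hmin
    obtain ⟨M, hM⟩ := hpN
    have hM0 : 0 < M := by
      rcases Nat.eq_zero_or_pos M with rfl | h
      · simp at hM; omega
      · exact h
    refine Nat.find_min hex (m := M) ?_ ⟨hM0, fun i => ?_⟩
    · rw [← hNdef, hM]
      exact lt_mul_of_one_lt_left hM0 hp.one_lt
    · obtain ⟨d, hd⟩ := h2 i
      rw [he, hd, ← pow_mul, mul_right_comm, ← hM, pow_mul, hz.pow_eq_one, one_pow]
  have hdvd : N ∣ (n + 1).factorial := by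
    have hsq : Squarefree N := by
      rw [Nat.squarefree_iff_prime_squarefree]
      intro p hp h
      exact hno p hp (dvd_of_mul_left_dvd h) (Or.inl (by rwa [pow_two]))
    rw [← Nat.prod_primeFactors_of_squarefree hsq]
    refine Finset.prod_primes_dvd _ (fun p hp => (Nat.prime_of_mem_primeFactors hp).prime)
      fun p hp => ?_
    have hp' := Nat.prime_of_mem_primeFactors hp
    refine (hp'.dvd_factorial).2 ?_
    have := hno p hp' (Nat.dvd_of_mem_primeFactors hp)
    push Not at this
    exact this.2
  obtain ⟨d, hd⟩ := hdvd
  rw [hd, pow_mul, hxN, one_pow]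

end RootsOfUnity

/-! ### The Fresnel integral -/

section Fresnel

open Filter Topology

theorem norm_cexp_neg_mul_sq_le {b : ℂ} (hb : 0 ≤ b.re) (x : ℝ) :
    ‖Complex.exp (-b * x ^ 2)‖ ≤ 1 := by
  rw [Complex.norm_exp]
  have : (-b * (x : ℂ) ^ 2).re = -(b.re * x ^ 2) := by
    rw [← Complex.ofReal_pow, Complex.re_mul_ofReal, Complex.neg_re, neg_mul]
  rw [this, Real.exp_le_one_iff]
  have := mul_nonneg hb (sq_nonneg x)
  linarith

/-- Integration by parts bounds the tails of the Gaussian integrals uniformly up to the imaginary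
axis. -/
theorem norm_integral_cexp_neg_mul_sq_le {b : ℂ} (hb : 0 ≤ b.re) (hb0 : b ≠ 0) {R S : ℝ}
    (hR : 0 < R) (hRS : R ≤ S) :
    ‖∫ x in R..S, Complex.exp (-b * x ^ 2)‖ ≤ 1 / (‖b‖ * R) := by
  have hS : 0 < S := hR.trans_le hRS
  have hbn : 0 < ‖b‖ := norm_pos_iff.2 hb0
  have hpos : ∀ x ∈ Set.uIcc R S, 0 < x := fun x hx => by
    rw [Set.uIcc_of_le hRS] at hx
    exact hR.trans_le hx.1
  let G : ℝ → ℂ := fun x => -(Complex.exp (-b * x ^ 2) / (2 * b * x))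
  let H : ℝ → ℂ := fun x => Complex.exp (-b * x ^ 2) / (2 * b * x ^ 2)
  have hexp : ∀ x : ℝ, HasDerivAt (fun x : ℝ => Complex.exp (-b * x ^ 2))
      (Complex.exp (-b * x ^ 2) * (-b * (2 * x))) x := by
    intro x
    have h1 : HasDerivAt (fun z : ℂ => Complex.exp (-b * z ^ 2))
        (Complex.exp (-b * (x : ℂ) ^ 2) * (-b * (2 * x))) (x : ℂ) := by
      have h2 : HasDerivAt (fun z : ℂ => -b * z ^ 2) (-b * (2 * (x : ℂ))) (x : ℂ) := by
        simpa using (hasDerivAt_pow 2 (x : ℂ)).const_mul (-b)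
      exact h2.cexp
    exact h1.comp_ofReal
  have hG : ∀ x ∈ Set.uIcc R S, HasDerivAt G (Complex.exp (-b * x ^ 2) + H x) x := by
    intro x hx
    have hx0 : (x : ℂ) ≠ 0 := by exact_mod_cast (hpos x hx).ne'
    have h2 : HasDerivAt (fun x : ℝ => 2 * b * (x : ℂ)) (2 * b) x := by
      simpa using (Complex.ofRealCLM.hasDerivAt (x := x)).const_mul (2 * b)
    have h3 := ((hexp x).div h2 (by simp [hb0, hx0])).neg
    refine h3.congr_deriv ?_
    simp only [H]
    field_simp
    ring
  have hcexp : Continuous fun x : ℝ => Complex.exp (-b * x ^ 2) := by fun_prop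
  have hH : ContinuousOn H (Set.uIcc R S) := by
    refine hcexp.continuousOn.div (by fun_prop) fun x hx => ?_
    have hx0 : (x : ℂ) ≠ 0 := by exact_mod_cast (hpos x hx).ne'
    simp [hb0, hx0]
  have hint := intervalIntegral.integral_eq_sub_of_hasDerivAt hG
    ((hcexp.continuousOn.add hH).intervalIntegrable)
  rw [intervalIntegral.integral_add (hcexp.intervalIntegrable _ _) hH.intervalIntegrable] at hint
  have hHle : ‖∫ x in R..S, H x‖ ≤ 1 / (2 * ‖b‖) * (1 / R - 1 / S) := by
    have hder : ∀ x ∈ Set.uIcc R S,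
        HasDerivAt (fun x : ℝ => -(1 / (2 * ‖b‖) * x⁻¹)) (1 / (2 * ‖b‖) * (1 / x ^ 2)) x := by
      intro x hx
      have := ((hasDerivAt_inv (hpos x hx).ne').const_mul (1 / (2 * ‖b‖))).neg
      refine this.congr_deriv ?_
      ring
    have hcont : ContinuousOn (fun x : ℝ => 1 / (2 * ‖b‖) * (1 / x ^ 2)) (Set.uIcc R S) := by
      refine continuousOn_const.mul (continuousOn_const.div (by fun_prop) fun x hx => ?_)
      exact pow_ne_zero 2 (hpos x hx).ne'
    have h1 := intervalIntegral.norm_integral_le_of_norm_le (μ := MeasureTheory.volume) (f := H)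
      (g := fun x : ℝ => 1 / (2 * ‖b‖) * (1 / x ^ 2)) hRS
      (Eventually.of_forall fun x hx => ?_) hcont.intervalIntegrable
    · rw [intervalIntegral.integral_eq_sub_of_hasDerivAt hder hcont.intervalIntegrable] at h1
      refine h1.trans (le_of_eq ?_)
      ring
    · have hx0 : 0 < x := hR.trans hx.1
      simp only [H, norm_div, norm_mul, norm_pow, Complex.norm_real, Complex.norm_ofNat,
        Real.norm_eq_abs, abs_of_pos hx0]
      calc _ ≤ 1 / (2 * ‖b‖ * x ^ 2) := by
            gcongr
            exact norm_cexp_neg_mul_sq_le hb x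
        _ = _ := by field_simp
  have hGle : ∀ x : ℝ, 0 < x → ‖G x‖ ≤ 1 / (2 * ‖b‖) * (1 / x) := by
    intro x hx0
    simp only [G, norm_neg, norm_div, norm_mul, Complex.norm_real, Complex.norm_ofNat,
      Real.norm_eq_abs, abs_of_pos hx0]
    calc _ ≤ 1 / (2 * ‖b‖ * x) := by
          gcongr
          exact norm_cexp_neg_mul_sq_le hb x
      _ = _ := by field_simp
  have e : ∫ x in R..S, Complex.exp (-b * x ^ 2) = G S - G R - ∫ x in R..S, H x :=
    eq_sub_of_add_eq hint
  rw [e]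
  calc ‖G S - G R - ∫ x in R..S, H x‖ ≤ ‖G S‖ + ‖G R‖ + ‖∫ x in R..S, H x‖ :=
        (norm_sub_le _ _).trans (by gcongr; exact norm_sub_le _ _)
    _ ≤ 1 / (2 * ‖b‖) * (1 / S) + 1 / (2 * ‖b‖) * (1 / R) +
        1 / (2 * ‖b‖) * (1 / R - 1 / S) := add_le_add (add_le_add (hGle S hS) (hGle R hR)) hHle
    _ = 1 / (‖b‖ * R) := by
      field_simp
      ring

theorem norm_symmetric_integral_sub_le {b : ℂ} (hb : 0 ≤ b.re) (hb0 : b ≠ 0) {R S : ℝ}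
    (hR : 0 < R) (hRS : R ≤ S) :
    ‖(∫ x in (-S)..S, Complex.exp (-b * x ^ 2)) - ∫ x in (-R)..R, Complex.exp (-b * x ^ 2)‖
      ≤ 2 / (‖b‖ * R) := by
  have hi : ∀ u v : ℝ, IntervalIntegrable (fun x : ℝ => Complex.exp (-b * x ^ 2))
      MeasureTheory.volume u v := fun u v =>
    Continuous.intervalIntegrable (by fun_prop) u v
  have h1 : ∫ x in (-S)..(-R), Complex.exp (-b * x ^ 2)
      = ∫ x in R..S, Complex.exp (-b * x ^ 2) := by
    rw [← intervalIntegral.integral_comp_neg]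
    simp
  have h2 : (∫ x in (-S)..S, Complex.exp (-b * x ^ 2)) - ∫ x in (-R)..R, Complex.exp (-b * x ^ 2)
      = 2 * ∫ x in R..S, Complex.exp (-b * x ^ 2) := by
    rw [← intervalIntegral.integral_add_adjacent_intervals (hi (-S) (-R)) (hi (-R) S),
      ← intervalIntegral.integral_add_adjacent_intervals (hi (-R) R) (hi R S), h1]
    ring
  rw [h2, norm_mul, Complex.norm_ofNat]
  calc _ ≤ 2 * (1 / (‖b‖ * R)) := by
        gcongr
        exact norm_integral_cexp_neg_mul_sq_le hb hb0 hR hRS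
    _ = _ := by ring

/-- The Fresnel integral, as the limit of the Gaussian integrals `∫ exp (-(δ - iπa) x²)` for
`δ → 0`. -/
theorem tendsto_fresnel_integral {a : ℝ} (ha : 0 < a) :
    Tendsto (fun R : ℝ => ∫ x in (-R)..R, Complex.exp (Complex.I * (a * Real.pi * x ^ 2))) atTop
      (𝓝 (Complex.exp (Complex.I * (Real.pi / 4)) / ((√a : ℝ) : ℂ))) := by
  have hpi := Real.pi_pos
  let b : ℝ → ℂ := fun δ => δ - Complex.I * (a * Real.pi : ℝ)
  have hbre : ∀ δ, (b δ).re = δ := fun δ => by simp [b]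
  have hbim : ∀ δ, (b δ).im = -(a * Real.pi) := fun δ => by simp [b]
  have hbnorm : ∀ δ, a * Real.pi ≤ ‖b δ‖ := fun δ => by
    calc a * Real.pi = |(b δ).im| := by
          rw [hbim, abs_neg, abs_of_pos (by positivity)]
      _ ≤ _ := Complex.abs_im_le_norm _
  have hb0 : ∀ δ, b δ ≠ 0 := fun δ => norm_pos_iff.1 (lt_of_lt_of_le (by positivity) (hbnorm δ))
  let F : ℝ → ℝ → ℂ := fun δ R => ∫ x in (-R)..R, Complex.exp (-(b δ) * x ^ 2)
  set L : ℂ := Complex.exp (Complex.I * (Real.pi / 4)) / ((√a : ℝ) : ℂ) with hL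
  have hbcont : Continuous b := by fun_prop
  have h1 : (Real.pi : ℂ) / b 0 = ((1 / a : ℝ) : ℂ) * Complex.I := by
    have ha' : (a : ℂ) ≠ 0 := by exact_mod_cast ha.ne'
    rw [div_eq_iff (hb0 0)]
    simp only [b]
    push_cast
    field_simp
    linear_combination ((Real.pi : ℂ) * a) * Complex.I_sq
  -- the branch of the square root
  have hroot : ((Real.pi : ℂ) / b 0) ^ (1 / 2 : ℂ) = L := by
    have h2 : ((1 / a : ℝ) : ℂ) * Complex.I
        = ((√a : ℝ) : ℂ)⁻¹ ^ 2 * Complex.exp (Complex.I * (Real.pi / 4)) ^ 2 := by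
      rw [← Complex.exp_nat_mul, ← Complex.ofReal_inv, ← Complex.ofReal_pow, inv_pow,
        Real.sq_sqrt ha.le, one_div]
      congr 1
      rw [show ((2 : ℕ) : ℂ) * (Complex.I * (Real.pi / 4)) = Real.pi / 2 * Complex.I by
        push_cast; ring, Complex.exp_pi_div_two_mul_I]
    rw [h1, h2, ← mul_pow]
    have h3 : ((√a : ℝ) : ℂ)⁻¹ * Complex.exp (Complex.I * (Real.pi / 4))
        = L := mul_comm _ _
    rw [h3]
    have h4 : L.arg = Real.pi / 4 := by
      have h5 : L = ((√a)⁻¹ : ℝ) * Complex.exp (((Real.pi / 4 : ℝ) : ℂ) * Complex.I) := by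
        rw [← h3]
        push_cast
        rw [mul_comm Complex.I]
      rw [h5, Complex.exp_mul_I, Complex.arg_mul_cos_add_sin_mul_I
        (by positivity) ⟨by linarith, by linarith⟩]
    rw [show (1 / 2 : ℂ) = ((2 : ℕ) : ℂ)⁻¹ by norm_num]
    refine Complex.pow_cpow_nat_inv two_ne_zero ?_ ?_ <;> rw [h4] <;> push_cast <;> linarith
  have hI : Tendsto (fun δ : ℝ => ((Real.pi : ℂ) / b δ) ^ (1 / 2 : ℂ)) (𝓝[>] 0) (𝓝 L) := by
    rw [← hroot]
    have h2 : ContinuousAt (fun δ : ℝ => ((Real.pi : ℂ) / b δ) ^ (1 / 2 : ℂ)) 0 := by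
      refine ContinuousAt.cpow (continuousAt_const.div hbcont.continuousAt (hb0 0))
        continuousAt_const (Or.inr ?_)
      rw [h1]
      simp [ha.ne']
    exact h2.tendsto.mono_left nhdsWithin_le_nhds
  have hbound : ∀ R : ℝ, 0 < R → ‖L - F 0 R‖ ≤ 2 / (a * Real.pi * R) := by
    intro R hR
    have hδ : ∀ δ : ℝ, 0 < δ →
        ‖((Real.pi : ℂ) / b δ) ^ (1 / 2 : ℂ) - F δ R‖ ≤ 2 / (a * Real.pi * R) := by
      intro δ hδ
      have hint : MeasureTheory.Integrable fun x : ℝ => Complex.exp (-(b δ) * x ^ 2) :=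
        integrable_cexp_neg_mul_sq (by rw [hbre]; exact hδ)
      have h1 := MeasureTheory.intervalIntegral_tendsto_integral hint
        tendsto_neg_atTop_atBot tendsto_id
      rw [integral_gaussian_complex (by rw [hbre]; exact hδ)] at h1
      refine le_of_tendsto ((h1.sub_const (F δ R)).norm) ?_
      filter_upwards [eventually_ge_atTop R] with S hS
      refine (norm_symmetric_integral_sub_le (by rw [hbre]; exact hδ.le) (hb0 δ) hR hS).trans ?_
      gcongr
      exact hbnorm δ
    have hF : Continuous fun δ => F δ R := by
      apply intervalIntegral.continuous_parametric_intervalIntegral_of_continuous'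
      fun_prop
    have h2 : Tendsto (fun δ => F δ R) (𝓝[>] 0) (𝓝 (F 0 R)) :=
      hF.continuousAt.tendsto.mono_left nhdsWithin_le_nhds
    refine le_of_tendsto ((hI.sub h2).norm) ?_
    filter_upwards [self_mem_nhdsWithin] with δ hδ' using hδ δ hδ'
  have hF0 : ∀ R, F 0 R = ∫ x in (-R)..R, Complex.exp (Complex.I * (a * Real.pi * x ^ 2)) := by
    intro R
    simp only [F]
    congr 1
    ext x
    congr 1
    simp only [b]
    push_cast
    ring
  rw [tendsto_iff_norm_sub_tendsto_zero]
  refine squeeze_zero' (Eventually.of_forall fun _ => norm_nonneg _) ?_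
    (g := fun R => 2 / (a * Real.pi * R)) ?_
  · filter_upwards [eventually_gt_atTop 0] with R hR
    rw [← hF0, norm_sub_rev]
    exact hbound R hR
  · exact Tendsto.div_atTop tendsto_const_nhds
      (tendsto_id.const_mul_atTop (by positivity : 0 < a * Real.pi))

theorem integral_exp_neg_mul_pi_mul_sq (a : ℝ) :
    ∫ x : ℝ, Real.exp (-(a * Real.pi * x ^ 2)) = 1 / √a := by
  have h := integral_gaussian (a * Real.pi)
  rw [show Real.pi / (a * Real.pi) = 1 / a by field_simp, Real.sqrt_div zero_le_one,
    Real.sqrt_one] at h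
  rw [← h]
  congr 1
  ext x
  congr 1
  ring

end Fresnel

/-! ### Ultraproducts -/

section Ultraproduct

open Filter Topology

variable {D : Ultrafilter Nat.Primes}

theorem eventually_natCast_le (hD : (D : Filter Nat.Primes) ≤ cofinite) (N : ℕ) :
    ∀ᶠ p : Nat.Primes in D, N ≤ (p : ℕ) := by
  refine hD ?_
  rw [Filter.mem_cofinite]
  refine Set.Finite.of_finite_image (f := ((↑) : Nat.Primes → ℕ)) ?_
    (Subtype.val_injective.injOn)
  refine (Set.finite_lt_nat N).subset ?_
  rintro _ ⟨p, hp, rfl⟩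
  exact not_le.1 (fun h : N ≤ (p : ℕ) => hp h)

/-- Countable saturation in the form of a diagonal argument: if every standard level of a family of
properties holds almost everywhere, then so does some infinite level. -/
theorem exists_infinite_level (hD : (D : Filter Nat.Primes) ≤ cofinite)
    {Q : ℕ → Nat.Primes → Prop} (hQ : ∀ N, ∀ᶠ p in D, Q N p) :
    ∃ k : Nat.Primes → ℕ, (∀ N, ∀ᶠ p in D, N ≤ k p) ∧ ∀ᶠ p in D, Q (k p) p := by
  classical
  refine ⟨fun p => Nat.findGreatest (fun N => Q N p) p, fun N => ?_, ?_⟩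
  · filter_upwards [hQ N, eventually_natCast_le hD N] with p hp hN
    exact Nat.le_findGreatest hN hp
  · filter_upwards [hQ 0] with p hp
    exact Nat.findGreatest_spec (P := fun N => Q N p) (Nat.zero_le _) hp

theorem coe_dvd_coe {f g : Nat.Primes → ℤ} :
    (f : StarZ D) ∣ (g : StarZ D) ↔ ∀ᶠ p in D, f p ∣ g p := by
  constructor
  · rintro ⟨t, ht⟩
    induction t using Germ.inductionOn with | h t => ?_
    have h : ∀ᶠ p in D, g p = f p * t p := Germ.coe_eq.1 ht
    filter_upwards [h] with p hp using ⟨t p, hp⟩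
  · intro h
    choose! t ht using fun (p : Nat.Primes) (h : f p ∣ g p) => h
    refine ⟨(t : StarZ D), ?_⟩
    exact Germ.coe_eq.2 (h.mono fun p hp => ht p hp)

/-- Reduction modulo `𝔭` as a homomorphism. -/
noncomputable def resHom (D : Ultrafilter Nat.Primes) : StarZ D →+* PF D where
  toFun := res
  map_one' := PF.mk_eq_mk.2 (Eventually.of_forall fun p => by simp)
  map_zero' := PF.mk_eq_mk.2 (Eventually.of_forall fun p => by simp)
  map_mul' := by
    intro x y
    induction x using Germ.inductionOn with | h x => ?_
    induction y using Germ.inductionOn with | h y => ?_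
    exact PF.mk_eq_mk.2 (Eventually.of_forall fun p => by simp)
  map_add' := by
    intro x y
    induction x using Germ.inductionOn with | h x => ?_
    induction y using Germ.inductionOn with | h y => ?_
    exact PF.mk_eq_mk.2 (Eventually.of_forall fun p => by simp)

theorem resHom_apply (n : StarZ D) : resHom D n = res n := rfl

theorem res_coe (f : Nat.Primes → ℤ) :
    res (f : StarZ D) = PF.mk fun p => (f p : ZMod p) := rfl

theorem resHom_eq_zero_iff {n : StarZ D} : resHom D n = 0 ↔ bigPrime D ∣ n := by
  induction n using Germ.inductionOn with | h n => ?_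
  rw [resHom_apply, res_coe, bigPrime, coe_dvd_coe, ← map_zero (Ideal.Quotient.mk (nullIdeal D))]
  rw [show (Ideal.Quotient.mk (nullIdeal D)) 0 = PF.mk 0 from rfl, PF.mk_eq_mk]
  refine eventually_congr (Eventually.of_forall fun p => ?_)
  exact ZMod.intCast_zmod_eq_zero_iff_dvd _ _

theorem PF.mk_ne_zero_iff {f : ∀ p : Nat.Primes, ZMod p} :
    (PF.mk f : PF D) ≠ 0 ↔ ∀ᶠ p in D, f p ≠ 0 := by
  rw [Ultrafilter.eventually_not]
  exact not_congr (Ideal.Quotient.eq_zero_iff_mem)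

theorem PF.mk_surjective (x : PF D) : ∃ f, PF.mk f = x := Ideal.Quotient.mk_surjective x

theorem PF.inv_mk (f : ∀ p : Nat.Primes, ZMod p) :
    (PF.mk f : PF D)⁻¹ = PF.mk fun p => (f p)⁻¹ := by
  by_cases h : (PF.mk f : PF D) = 0
  · rw [h, inv_zero]
    have h' : ∀ᶠ p in D, f p = 0 := Ideal.Quotient.eq_zero_iff_mem.1 h
    refine (Ideal.Quotient.eq_zero_iff_mem.2 ?_).symm
    exact h'.mono fun p hp => by simp [hp]
  · have h' := PF.mk_ne_zero_iff.1 h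
    refine inv_eq_of_mul_eq_one_right ?_
    rw [PF.mk, PF.mk, ← map_mul, ← map_one (Ideal.Quotient.mk (nullIdeal D))]
    exact PF.mk_eq_mk.2 (h'.mono fun p hp => mul_inv_cancel₀ hp)

theorem charZero_PF (hD : (D : Filter Nat.Primes) ≤ cofinite) : CharZero (PF D) := by
  refine charZero_of_inj_zero fun n hn => ?_
  by_contra h0
  have h1 : (PF.mk fun p => ((n : ℕ) : ZMod p) : PF D) = 0 := by
    rw [← hn]
    exact map_natCast (Ideal.Quotient.mk (nullIdeal D)) n
  have h2 : ∀ᶠ p : Nat.Primes in D, ((n : ℕ) : ZMod p) = 0 := Ideal.Quotient.eq_zero_iff_mem.1 h1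
  obtain ⟨p, hp, hp'⟩ := (h2.and (eventually_natCast_le hD (n + 1))).exists
  have := Nat.le_of_dvd (Nat.pos_of_ne_zero h0) ((ZMod.natCast_eq_zero_iff _ _).1 hp)
  omega

theorem StarZ.one_le_abs {x : StarZ D} (hx : x ≠ 0) : 1 ≤ |x| := by
  induction x using Germ.inductionOn with | h x => ?_
  have h : ∀ᶠ p in D, x p ≠ 0 := by
    rw [Ultrafilter.eventually_not]
    intro h
    exact hx (Germ.coe_eq.2 h)
  rw [Germ.abs_def, Germ.map_coe]
  exact Germ.coe_le.2 (h.mono fun p hp => Int.one_le_abs hp)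

theorem StarZ.eq_zero_of_dvd {a x : StarZ D} (h : a ∣ x) (hx : |x| < a) : x = 0 := by
  obtain ⟨t, rfl⟩ := h
  by_contra h0
  have ht : t ≠ 0 := right_ne_zero_of_mul h0
  have ha : 0 < a := (abs_nonneg _).trans_lt hx
  have h1 := StarZ.one_le_abs ht
  rw [abs_mul, abs_of_pos ha] at hx
  have := mul_le_mul_of_nonneg_left h1 ha.le
  rw [mul_one] at this
  exact absurd hx (not_lt.2 this)

/-! ### Growth and algebraic independence -/

/-- An injective homomorphism to the non-standard integers with values bounded by `b`. -/
structure IsBelow {S : Type*} [CommRing S] (φ : S →+* StarZ D) (b : StarZ D) : Prop where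
  injective : Function.Injective φ
  lt : ∀ s, |φ s| < b

theorem isBelow_int {a : StarZ D} (ha : ∀ n : ℕ, (n : StarZ D) < a) :
    IsBelow (Int.castRingHom (StarZ D)) a where
  injective := Int.cast_injective
  lt := fun s => by
    have := ha s.natAbs
    rw [Nat.cast_natAbs] at this
    simpa using this

/-- The powers of a non-standard integer are independent over a ring of integers that are smaller,
since they behave as the digits of an expansion. -/
theorem IsBelow.eval₂ {S : Type*} [CommRing S] {φ : S →+* StarZ D} {a b : StarZ D}
    (h : IsBelow φ a) (ha : ∀ n : ℕ, (n : StarZ D) < a) (hab : ∀ n : ℕ, a ^ n ≤ b) :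
    IsBelow (Polynomial.eval₂RingHom φ a) b := by
  have ha1 : 1 < a := by simpa using ha 1
  have ha0 : 0 < a := zero_lt_one.trans ha1
  constructor
  · rw [injective_iff_map_eq_zero]
    intro P hP
    by_contra hP0
    obtain ⟨n, Q, hPQ, hQ⟩ : ∃ (n : ℕ) (Q : Polynomial S), P = Polynomial.X ^ n * Q ∧
        Q.coeff 0 ≠ 0 := by
      obtain ⟨Q, hQ, h2⟩ := Polynomial.exists_eq_pow_rootMultiplicity_mul_and_not_dvd P hP0 0
      rw [map_zero, sub_zero] at hQ h2
      exact ⟨_, Q, hQ, fun h => h2 (Polynomial.X_dvd_iff.2 h)⟩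
    rw [hPQ, Polynomial.coe_eval₂RingHom, Polynomial.eval₂_mul, Polynomial.eval₂_X_pow] at hP
    have hQ0 := (mul_eq_zero.1 hP).resolve_left (pow_ne_zero _ ha0.ne')
    rw [← Polynomial.divX_mul_X_add Q, Polynomial.eval₂_add, Polynomial.eval₂_mul,
      Polynomial.eval₂_X, Polynomial.eval₂_C] at hQ0
    have hdvd : a ∣ φ (Q.coeff 0) := by
      refine ⟨-Polynomial.eval₂ φ a Q.divX, ?_⟩
      linear_combination hQ0
    have := StarZ.eq_zero_of_dvd hdvd (h.lt _)
    exact hQ (h.injective (by rw [this, map_zero]))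
  · intro P
    have h1 : |Polynomial.eval₂ φ a P| ≤ ∑ j ∈ Finset.range (P.natDegree + 1), a ^ (j + 1) := by
      rw [Polynomial.eval₂_eq_sum_range]
      refine (Finset.abs_sum_le_sum_abs _ _).trans (Finset.sum_le_sum fun j _ => ?_)
      rw [abs_mul, abs_of_pos (pow_pos ha0 j), pow_succ']
      exact mul_le_mul_of_nonneg_right (h.lt _).le (pow_pos ha0 j).le
    have h2 : ∑ j ∈ Finset.range (P.natDegree + 1), a ^ (j + 1)
        ≤ ((P.natDegree + 1 : ℕ) : StarZ D) * a ^ (P.natDegree + 1) := by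
      refine (Finset.sum_le_card_nsmul _ _ (a ^ (P.natDegree + 1)) fun j hj => ?_).trans_eq
        (by rw [Finset.card_range, nsmul_eq_mul])
      rw [Finset.mem_range] at hj
      exact pow_le_pow_right₀ ha1.le (by omega)
    refine (h1.trans h2).trans_lt ?_
    refine lt_of_lt_of_le (mul_lt_mul_of_pos_right (ha _) (pow_pos ha0 _)) ?_
    rw [← pow_succ']
    exact hab _

theorem IsBelow.injective_resHom {S : Type*} [CommRing S] {φ : S →+* StarZ D}
    (h : IsBelow φ (bigPrime D)) : Function.Injective ((resHom D).comp φ) := by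
  rw [injective_iff_map_eq_zero]
  intro s hs
  have := StarZ.eq_zero_of_dvd (resHom_eq_zero_iff.1 hs) (h.lt s)
  exact h.injective (by rw [this, map_zero])

theorem transcendental_res {a : StarZ D} (ha : ∀ n : ℕ, (n : StarZ D) < a)
    (hap : ∀ n : ℕ, a ^ n ≤ bigPrime D) : Transcendental ℤ (res a) := by
  have h := ((isBelow_int ha).eval₂ ha hap).injective_resHom
  rw [transcendental_iff_injective]
  intro P Q hPQ
  apply h
  have e : ∀ P : Polynomial ℤ, ((resHom D).comp (Polynomial.eval₂RingHom
      (Int.castRingHom (StarZ D)) a)) P = Polynomial.aeval (res a) P := by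
    intro P
    rw [RingHom.comp_apply, Polynomial.coe_eval₂RingHom, Polynomial.hom_eval₂,
      Polynomial.aeval_def]
    exact congrArg (fun ψ => Polynomial.eval₂ ψ (res a) P) (RingHom.ext_int _ _)
  rw [e, e]
  exact hPQ

/-- A polynomial in `a` and `b` is smaller than `𝔭`, so that it vanishes in `F_𝔭` only if it is
zero. -/
theorem algebraicIndependent_res {a b : StarZ D} (ha : ∀ n : ℕ, (n : StarZ D) < a)
    (hab : ∀ n : ℕ, a ^ n ≤ b) (hb : ∀ n : ℕ, (n : StarZ D) < b)
    (hbp : ∀ n : ℕ, b ^ n ≤ bigPrime D) :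
    AlgebraicIndependent ℤ ![res a, res b] := by
  have h := (((isBelow_int ha).eval₂ ha hab).eval₂ hb hbp).injective_resHom
  -- `ℤ[X, Y]` is embedded in `ℤ[X][Y]`
  let α : MvPolynomial (Fin 2) ℤ →ₐ[ℤ] Polynomial (Polynomial ℤ) :=
    MvPolynomial.aeval ![Polynomial.C Polynomial.X, Polynomial.X]
  let β : Polynomial (Polynomial ℤ) →+* MvPolynomial (Fin 2) ℤ :=
    Polynomial.eval₂RingHom (Polynomial.aeval (MvPolynomial.X 0)).toRingHom (MvPolynomial.X 1)
  have hα : Function.Injective α := by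
    have : β.comp α.toRingHom = RingHom.id _ := by
      refine MvPolynomial.ringHom_ext (fun r => ?_) (fun i => ?_)
      · simp
      · fin_cases i <;> simp [α, β]
    exact Function.LeftInverse.injective (g := β) (fun P => RingHom.congr_fun this P)
  rw [algebraicIndependent_iff_injective_aeval]
  have e : (MvPolynomial.aeval ![res a, res b] : MvPolynomial (Fin 2) ℤ →ₐ[ℤ] PF D).toRingHom
      = ((resHom D).comp (Polynomial.eval₂RingHom (Polynomial.eval₂RingHom
          (Int.castRingHom (StarZ D)) a) b)).comp α.toRingHom := by
    refine MvPolynomial.ringHom_ext (fun r => ?_) (fun i => ?_)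
    · simp
    · fin_cases i <;> simp [α, resHom_apply]
  intro P Q hPQ
  apply hα
  apply h
  have h1 := RingHom.congr_fun e P
  have h2 := RingHom.congr_fun e Q
  exact h1.symm.trans (Eq.trans hPQ h2)

/-! ### Limits along the ultrafilter -/

theorem exists_tendsto_of_norm_le {u : Nat.Primes → ℂ} {C : ℝ} (h : ∀ᶠ p in D, ‖u p‖ ≤ C) :
    ∃ z, Tendsto u D (𝓝 z) := by
  have hK : IsCompact (Metric.closedBall (0 : ℂ) C) := isCompact_closedBall 0 C
  obtain ⟨z, -, hz⟩ := hK.ultrafilter_le_nhds (D.map u) (by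
    rw [le_principal_iff]
    exact h.mono fun p hp => by simpa using hp)
  exact ⟨z, hz⟩

theorem exists_tendsto_real_of_abs_le {u : Nat.Primes → ℝ} {C : ℝ} (h : ∀ᶠ p in D, |u p| ≤ C) :
    ∃ z, Tendsto u D (𝓝 z) := by
  obtain ⟨z, -, hz⟩ := (isCompact_Icc (a := -C) (b := C)).ultrafilter_le_nhds (D.map u) (by
    rw [le_principal_iff]
    exact h.mono fun p hp => abs_le.1 hp)
  exact ⟨z, hz⟩

theorem StarQ.coe_const (r : ℚ) : ((fun _ => r : Nat.Primes → ℚ) : StarQ D) = (r : StarQ D) :=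
  eq_ratCast ((Germ.coeRingHom (D : Filter Nat.Primes)).comp (Pi.constRingHom Nat.Primes ℚ)) r

/-- The standard part of a finite non-standard rational is the limit along the ultrafilter. -/
theorem tendsto_stdPart {q : Nat.Primes → ℚ} {C : ℕ} (hq : ∀ᶠ p in D, |q p| ≤ C) :
    Tendsto (fun p => (q p : ℝ)) D (𝓝 (ArchimedeanClass.stdPart (q : StarQ D))) := by
  have hfin : ∀ x : StarQ D, (∃ n : ℕ, |x| ≤ n) → 0 ≤ ArchimedeanClass.mk x := by
    rintro x ⟨n, hn⟩
    rw [← ArchimedeanClass.mk_one, ArchimedeanClass.mk_le_mk]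
    exact ⟨n, by simpa using hn⟩
  have hqf : 0 ≤ ArchimedeanClass.mk (q : StarQ D) := by
    refine hfin _ ⟨C, ?_⟩
    rw [Germ.abs_def, Germ.map_coe]
    exact Germ.coe_le.2 hq
  have hrf : ∀ r : ℚ, 0 ≤ ArchimedeanClass.mk (r : StarQ D) := fun r => by
    obtain ⟨n, hn⟩ := exists_nat_ge |r|
    refine hfin _ ⟨n, ?_⟩
    rw [← Rat.cast_abs]
    exact_mod_cast hn
  refine tendsto_order.2 ⟨fun a ha => ?_, fun a ha => ?_⟩
  · obtain ⟨r, hr1, hr2⟩ := exists_rat_btwn ha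
    by_contra hcon
    rw [← Ultrafilter.eventually_not] at hcon
    have h1 : (q : StarQ D) ≤ (r : StarQ D) := by
      rw [← StarQ.coe_const]
      refine Germ.coe_le.2 (hcon.mono fun p hp => ?_)
      have := (not_lt.1 hp).trans hr1.le
      exact_mod_cast this
    have h2 := ArchimedeanClass.stdPart_monotoneOn hqf (hrf r) h1
    rw [ArchimedeanClass.stdPart_ratCast] at h2
    exact absurd hr2 (not_lt.2 h2)
  · obtain ⟨r, hr1, hr2⟩ := exists_rat_btwn ha
    by_contra hcon
    rw [← Ultrafilter.eventually_not] at hcon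
    have h1 : (r : StarQ D) ≤ (q : StarQ D) := by
      rw [← StarQ.coe_const]
      refine Germ.coe_le.2 (hcon.mono fun p hp => ?_)
      have := hr2.le.trans (not_lt.1 hp)
      exact_mod_cast this
    have h2 := ArchimedeanClass.stdPart_monotoneOn (hrf r) hqf h1
    rw [ArchimedeanClass.stdPart_ratCast] at h2
    exact absurd hr1 (not_lt.2 h2)

end Ultraproduct

/-! ### Existence of scales -/

section Existence

open Filter Topology

variable {D : Ultrafilter Nat.Primes}

/-- The ultrafilter is concentrated on a sequence of primes `q n` with `q n ≡ 1` modulo `n!`, which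
exists by Dirichlet's theorem. -/
theorem exists_ultrafilter_forall_dvd :
    ∃ D : Ultrafilter Nat.Primes, (D : Filter Nat.Primes) ≤ Filter.cofinite ∧
      ∀ m : ℕ, 0 < m → (m : StarZ D) ∣ bigPrime D - 1 := by
  have hex : ∀ n : ℕ, ∃ q : Nat.Primes, n < (q : ℕ) ∧ (q : ℕ) ≡ 1 [MOD n.factorial] := by
    intro n
    obtain ⟨q, hq, h1, h2⟩ := Nat.exists_prime_gt_modEq_one n n.factorial_ne_zero
    exact ⟨⟨q, hq⟩, h1, h2⟩
  choose q hq1 hq2 using hex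
  let D := Ultrafilter.of (map q atTop)
  have hle : (D : Filter Nat.Primes) ≤ map q atTop := Ultrafilter.of_le _
  refine ⟨D, hle.trans ?_, fun m hm => ?_⟩
  · have h1 : Tendsto (fun n => (q n : ℕ)) atTop atTop :=
      tendsto_atTop_mono (fun n => (hq1 n).le) tendsto_id
    rw [← Nat.cofinite_eq_atTop] at h1
    have h2 : Tendsto q atTop cofinite :=
      (tendsto_comap_iff.2 (by rw [← Nat.cofinite_eq_atTop]; exact h1)).mono_right
        (comap_cofinite_le _)
    exact h2
  · have h : ∀ᶠ p : Nat.Primes in D, (m : ℤ) ∣ ((p : ℕ) : ℤ) - 1 := by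
      refine hle ?_
      have : ∀ᶠ n in atTop, (m : ℤ) ∣ ((q n : ℕ) : ℤ) - 1 := by
        filter_upwards [eventually_ge_atTop m] with n hn
        have h1 := (hq2 n).of_dvd (Nat.dvd_factorial hm hn)
        exact (Nat.modEq_iff_dvd.1 h1.symm)
      exact this
    exact coe_dvd_coe.2 h

theorem PF.sum_mk {ι : Type*} (J : Finset ι) (f : ι → ∀ p : Nat.Primes, ZMod p) :
    ∑ j ∈ J, (PF.mk (f j) : PF D) = PF.mk fun p => ∑ j ∈ J, f j p := by
  rw [← map_sum]
  congr 1
  ext p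
  exact Finset.sum_apply p J f

theorem PF.mk_mul (f g : ∀ p : Nat.Primes, ZMod p) :
    (PF.mk f : PF D) * PF.mk g = PF.mk fun p => f p * g p := rfl

theorem PF.mk_pow (f : ∀ p : Nat.Primes, ZMod p) (n : ℕ) :
    (PF.mk f : PF D) ^ n = PF.mk fun p => f p ^ n := (map_pow _ f n).symm

theorem PF.mk_one : (PF.mk fun _ => 1 : PF D) = 1 := rfl

theorem PF.mk_natCast (f : ℕ) : (PF.mk fun p => (f : ZMod p) : PF D) = f :=
  map_natCast (Ideal.Quotient.mk (nullIdeal D)) f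

theorem PF.mk_div (f g : ∀ p : Nat.Primes, ZMod p) :
    (PF.mk f : PF D) / PF.mk g = PF.mk fun p => f p / g p := by
  rw [div_eq_mul_inv, PF.inv_mk, PF.mk_mul]
  simp only [div_eq_mul_inv]

theorem countable_mvPolynomial (n : ℕ) : Countable (MvPolynomial (Fin n) ℤ) := by
  rw [← Cardinal.mk_le_aleph0_iff]
  exact MvPolynomial.cardinalMk_le_max.trans (by simp)

theorem PF.aeval_mk {σ : Type*} (x : σ → ∀ p : Nat.Primes, ZMod p) (P : MvPolynomial σ ℤ) :
    MvPolynomial.aeval (fun i => (PF.mk (x i) : PF D)) P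
      = PF.mk fun p => MvPolynomial.aeval (fun i => x i p) P := by
  induction P using MvPolynomial.induction_on with
  | C a =>
    have h : (fun p : Nat.Primes => MvPolynomial.aeval (fun i => x i p) (MvPolynomial.C a))
        = fun p : Nat.Primes => (a : ZMod p) := by
      funext p
      rw [MvPolynomial.aeval_C, eq_intCast]
    rw [MvPolynomial.aeval_C, eq_intCast, h]
    exact (map_intCast (Ideal.Quotient.mk (nullIdeal D)) a).symm
  | add P Q hP hQ =>
    simp only [map_add, hP, hQ]
    rfl
  | mul_X P i hP =>
    simp only [map_mul, hP, MvPolynomial.aeval_X]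
    rfl

theorem PF.isPrimitiveRoot_mk {f : ∀ p : Nat.Primes, ZMod p} {n : ℕ}
    (h : ∀ᶠ p in D, IsPrimitiveRoot (f p) n) : IsPrimitiveRoot (PF.mk f : PF D) n where
  pow_eq_one := by
    rw [PF.mk_pow, ← PF.mk_one, PF.mk_eq_mk]
    exact h.mono fun p hp => hp.pow_eq_one
  dvd_of_pow_eq_one l hl := by
    rw [PF.mk_pow, ← PF.mk_one, PF.mk_eq_mk] at hl
    obtain ⟨p, h1, h2⟩ := (h.and hl).exists
    exact h1.dvd_of_pow_eq_one l h2

theorem exists_isPrimitiveRoot_zmod (p : Nat.Primes) :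
    ∃ g : ZMod p, IsPrimitiveRoot g ((p : ℕ) - 1) := by
  obtain ⟨g, hg⟩ := IsCyclic.exists_generator (α := (ZMod p)ˣ)
  have h1 : orderOf g = (p : ℕ) - 1 := by
    rw [orderOf_eq_card_of_forall_mem_zpowers hg, Nat.card_eq_fintype_card, ZMod.card_units]
  refine ⟨g, ?_⟩
  rw [IsPrimitiveRoot.coe_units_iff, ← h1]
  exact IsPrimitiveRoot.orderOf g

theorem exists_isPrimitiveRoot_PF {n : ℕ}
    (h : ∀ᶠ p : Nat.Primes in D, n ∣ (p : ℕ) - 1) :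
    ∃ z : PF D, IsPrimitiveRoot z n := by
  choose g hg using exists_isPrimitiveRoot_zmod
  refine ⟨PF.mk fun p => g p ^ (((p : ℕ) - 1) / n), PF.isPrimitiveRoot_mk ?_⟩
  filter_upwards [h] with p hp
  have := p.2.one_lt
  exact (hg p).pow (by omega) (Nat.div_mul_cancel hp).symm

/-- A solution of the linear equation `∑ cᵢ xᵢ = 1` no proper subsum of which is equal to `1`. -/
structure IsNondegenerate {F : Type*} [Field F] {n : ℕ} (c x : Fin n → F) : Prop where
  sum_eq : ∑ i, c i * x i = 1
  ne_one : ∀ J : Finset (Fin n), J ≠ Finset.univ → ∑ i ∈ J, c i * x i ≠ 1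

theorem isNondegenerate_mk_iff {n : ℕ} (c x : Fin n → ∀ p : Nat.Primes, ZMod p) :
    IsNondegenerate (fun i => (PF.mk (c i) : PF D)) (fun i => PF.mk (x i)) ↔
      ∀ᶠ p in D, IsNondegenerate (fun i => c i p) (fun i => x i p) := by
  have key : ∀ J : Finset (Fin n), ∑ i ∈ J, (PF.mk (c i) : PF D) * PF.mk (x i) = 1 ↔
      ∀ᶠ p in D, ∑ i ∈ J, c i p * x i p = 1 := by
    intro J
    simp only [PF.mk_mul]
    rw [PF.sum_mk, ← PF.mk_one, PF.mk_eq_mk]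
  constructor
  · rintro ⟨h1, h2⟩
    have h3 : ∀ J : Finset (Fin n), ∀ᶠ p in D, J ≠ Finset.univ → ∑ i ∈ J, c i p * x i p ≠ 1 := by
      intro J
      by_cases hJ : J = Finset.univ
      · exact Eventually.of_forall fun p h => absurd hJ h
      · have := h2 J hJ
        rw [ne_eq, key, ← Ultrafilter.eventually_not] at this
        exact this.mono fun p hp _ => hp
    filter_upwards [(key _).1 h1, eventually_all.2 h3] with p h4 h5 using ⟨h4, h5⟩
  · intro h
    refine ⟨(key _).2 (h.mono fun p hp => hp.sum_eq), fun J hJ hJ1 => ?_⟩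
    obtain ⟨p, h1, h2⟩ := (h.and ((key _).1 hJ1)).exists
    exact h1.ne_one J hJ h2

/-- Mann's conclusion in `ℤ/p` for the linear equation with the coefficients
`Pⱼ(l, i) / Qⱼ(l, i)` in `l`-th roots of unity. -/
def MannAt (t : Σ n : ℕ, Fin n → MvPolynomial (Fin 2) ℤ × MvPolynomial (Fin 2) ℤ) (i l : ℕ)
    (p : Nat.Primes) : Prop :=
  ∀ x : Fin t.1 → ZMod p, (∀ j, x j ^ l = 1) →
    IsNondegenerate (fun j => MvPolynomial.aeval ![(l : ZMod p), (i : ZMod p)] (t.2 j).1 /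
      MvPolynomial.aeval ![(l : ZMod p), (i : ZMod p)] (t.2 j).2) x →
    ∀ j, x j ^ (t.1 + 1).factorial = 1

theorem PF.coefficient_mk (l i : Nat.Primes → ℕ) (P Q : MvPolynomial (Fin 2) ℤ) :
    (MvPolynomial.aeval ![res (fun p => (l p : ℤ) : Nat.Primes → ℤ),
        res (fun p => (i p : ℤ) : Nat.Primes → ℤ)] P : PF D) /
      MvPolynomial.aeval ![res (fun p => (l p : ℤ) : Nat.Primes → ℤ),
        res (fun p => (i p : ℤ) : Nat.Primes → ℤ)] Q
      = PF.mk fun p => MvPolynomial.aeval ![(l p : ZMod p), (i p : ZMod p)] P /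
          MvPolynomial.aeval ![(l p : ZMod p), (i p : ZMod p)] Q := by
  let x : Fin 2 → ∀ p : Nat.Primes, ZMod p := fun j p => ![(l p : ZMod p), (i p : ZMod p)] j
  have h1 : ![(res (fun p => (l p : ℤ) : Nat.Primes → ℤ) : PF D),
      res (fun p => (i p : ℤ) : Nat.Primes → ℤ)] = fun j => PF.mk (x j) := by
    funext j
    fin_cases j
    · exact congrArg PF.mk (funext fun p => Int.cast_natCast _)
    · exact congrArg PF.mk (funext fun p => Int.cast_natCast _)
  rw [h1, PF.aeval_mk, PF.aeval_mk, PF.mk_div]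

/-- For standard `l`, Mann's theorem in the field `F_𝔭` descends to almost all of the fields `ℤ/p`. -/
theorem eventually_mannAt (hD : (D : Filter Nat.Primes) ≤ cofinite)
    (hdiv : ∀ m : ℕ, 0 < m → ∀ᶠ p : Nat.Primes in D, m ∣ (p : ℕ) - 1) {i : Nat.Primes → ℕ}
    (hi : Transcendental ℤ (res (fun p => (i p : ℤ) : Nat.Primes → ℤ) : PF D))
    (t : Σ n : ℕ, Fin n → MvPolynomial (Fin 2) ℤ × MvPolynomial (Fin 2) ℤ) {l : ℕ} (hl : 0 < l) :
    ∀ᶠ p in D, MannAt t (i p) l p := by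
  by_contra hcon
  rw [← Ultrafilter.eventually_not] at hcon
  have := charZero_PF hD
  have hchoose : ∀ p : Nat.Primes, ∃ x : Fin t.1 → ZMod p, ¬ MannAt t (i p) l p →
      (∀ j, x j ^ l = 1) ∧
      IsNondegenerate (fun j => MvPolynomial.aeval ![(l : ZMod p), (i p : ZMod p)] (t.2 j).1 /
        MvPolynomial.aeval ![(l : ZMod p), (i p : ZMod p)] (t.2 j).2) x ∧
      ∃ j, x j ^ (t.1 + 1).factorial ≠ 1 := by
    intro p
    by_cases h : MannAt t (i p) l p
    · exact ⟨0, fun h' => absurd h h'⟩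
    · unfold MannAt at h
      push Not at h
      obtain ⟨x, h1, h2, h3⟩ := h
      exact ⟨x, fun _ => ⟨h1, h2, h3⟩⟩
  choose x hx using hchoose
  set τ : PF D := res (fun p => (i p : ℤ) : Nat.Primes → ℤ) with hτ
  have hl' : (res (fun _ => (l : ℤ) : Nat.Primes → ℤ) : PF D) = l := by
    rw [res_coe, ← PF.mk_natCast]
    exact congrArg PF.mk (funext fun p => Int.cast_natCast _)
  have hnd : IsNondegenerate (fun j => MvPolynomial.aeval ![(l : PF D), τ] (t.2 j).1 /
      MvPolynomial.aeval ![(l : PF D), τ] (t.2 j).2) (fun j => PF.mk fun p => x p j) := by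
    simp only [← hl', hτ, PF.coefficient_mk (fun _ => l) i]
    rw [isNondegenerate_mk_iff]
    exact hcon.mono fun p hp => (hx p hp).2.1
  have hmem : ∀ P : MvPolynomial (Fin 2) ℤ,
      MvPolynomial.aeval ![(l : PF D), τ] P ∈ Subfield.closure {τ} := by
    refine aeval_mem_subfield _ fun j => ?_
    fin_cases j
    · exact natCast_mem _ l
    · exact Subfield.subset_closure rfl
  have hmann := pow_factorial_eq_one_of_nondegenerate hi
    (fun n hn => exists_isPrimitiveRoot_PF (hdiv n hn)) hl _ _
    (fun j => Subfield.div_mem _ (hmem (t.2 j).1) (hmem (t.2 j).2))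
    (fun j => by
      rw [PF.mk_pow, ← PF.mk_one, PF.mk_eq_mk]
      exact hcon.mono fun p hp => (hx p hp).1 j) hnd.sum_eq hnd.ne_one
  have hall : ∀ᶠ p in D, ∀ j, x p j ^ (t.1 + 1).factorial = 1 := by
    refine eventually_all.2 fun j => ?_
    have := hmann j
    rw [PF.mk_pow, ← PF.mk_one, PF.mk_eq_mk] at this
    exact this
  obtain ⟨p, h1, h2⟩ := (hall.and hcon).exists
  obtain ⟨j, hj⟩ := (hx p h2).2.2
  exact hj (h1 j)

/-- A scale with algebraically independent `𝔩` and `𝔦`. Uniform torsion holds for all standard `𝔩`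
and hence, by saturation, for some infinite one. -/
theorem exists_isScale (hD : (D : Filter Nat.Primes) ≤ cofinite)
    (hdiv : ∀ m : ℕ, 0 < m → (m : StarZ D) ∣ bigPrime D - 1) :
    ∃ 𝔩 μ 𝔦 ι : StarZ D, IsScale D 𝔩 μ 𝔦 ι := by
  have hdiv' : ∀ m : ℕ, 0 < m → ∀ᶠ p : Nat.Primes in D, m ∣ (p : ℕ) - 1 := by
    intro m hm
    have h : ∀ᶠ p : Nat.Primes in D, (m : ℤ) ∣ ((p : ℕ) : ℤ) - 1 := coe_dvd_coe.1 (hdiv m hm)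
    filter_upwards [h] with p hp
    have h1 : (((p : ℕ) - 1 : ℕ) : ℤ) = ((p : ℕ) : ℤ) - 1 := by
      have := p.2.one_lt
      omega
    rw [← h1] at hp
    exact_mod_cast hp
  -- `ι = h!` divides `𝔭 - 1` and all its standard powers are below `𝔭`
  obtain ⟨h, hinf, hh⟩ := exists_infinite_level hD
    (Q := fun h p => h.factorial ^ 4 ∣ (p : ℕ) - 1 ∧ (h.factorial ^ 2) ^ h ≤ (p : ℕ))
    (fun N => (hdiv' _ (pow_pos N.factorial_pos 4)).and (eventually_natCast_le hD _))
  let i : Nat.Primes → ℕ := fun p => (h p).factorial ^ 2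
  let 𝔦 : StarZ D := (fun p => (i p : ℤ) : Nat.Primes → ℤ)
  have hi_inf : ∀ n : ℕ, (n : StarZ D) < 𝔦 := by
    intro n
    have : ∀ᶠ p in D, (n : ℤ) < (i p : ℤ) := by
      filter_upwards [hinf (n + 1)] with p hp
      have h1 := Nat.self_le_factorial (h p)
      have h2 : (h p).factorial ≤ i p := Nat.le_self_pow two_ne_zero _
      omega
    exact Germ.coe_lt.2 this
  have hi_pow : ∀ n : ℕ, 𝔦 ^ n ≤ bigPrime D := by
    intro n
    have : ∀ᶠ p : Nat.Primes in D, (i p : ℤ) ^ n ≤ ((p : ℕ) : ℤ) := by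
      filter_upwards [hinf n, hh] with p hp hp2
      have : i p ^ n ≤ (p : ℕ) :=
        (Nat.pow_le_pow_right (pow_pos (Nat.factorial_pos _) _) hp).trans hp2.2
      exact_mod_cast this
    exact Germ.coe_le.2 this
  have hi_tr : Transcendental ℤ (res 𝔦) := transcendental_res hi_inf hi_pow
  -- `μ = k!` is much smaller, and Mann's theorem holds for `𝔩`-th roots of unity
  have := countable_mvPolynomial 2
  obtain ⟨code, hcode⟩ := exists_surjective_nat
    (Σ n : ℕ, Fin n → MvPolynomial (Fin 2) ℤ × MvPolynomial (Fin 2) ℤ)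
  obtain ⟨k, kinf, hk⟩ := exists_infinite_level hD
    (Q := fun k p => (k.factorial ^ 2) ^ (k + 1) ≤ h p ∧
      ∀ N ∈ Finset.range k, MannAt (code N) (i p) (k.factorial ^ 2) p)
    (fun N => (hinf _).and ((Filter.eventually_all_finset _).2 fun M _ =>
      eventually_mannAt hD hdiv' hi_tr (code M) (pow_pos N.factorial_pos 2)))
  let l : Nat.Primes → ℕ := fun p => (k p).factorial ^ 2
  let 𝔩 : StarZ D := (fun p => (l p : ℤ) : Nat.Primes → ℤ)
  have hl_inf : ∀ n : ℕ, (n : StarZ D) < 𝔩 := by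
    intro n
    have : ∀ᶠ p in D, (n : ℤ) < (l p : ℤ) := by
      filter_upwards [kinf (n + 1)] with p hp
      have h1 := Nat.self_le_factorial (k p)
      have h2 : (k p).factorial ≤ l p := Nat.le_self_pow two_ne_zero _
      omega
    exact Germ.coe_lt.2 this
  have hl_pow : ∀ n : ℕ, 𝔩 ^ n < 𝔦 := by
    intro n
    have : ∀ᶠ p : Nat.Primes in D, (l p : ℤ) ^ n < (i p : ℤ) := by
      filter_upwards [kinf n, hk, hinf 2] with p hp hp2 hp3
      have h1 : l p ^ n ≤ h p :=
        (Nat.pow_le_pow_right (pow_pos (Nat.factorial_pos _) _) (by omega)).trans hp2.1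
      have h2 := Nat.self_le_factorial (h p)
      have h3 : l p ^ n < i p := by
        calc l p ^ n ≤ (h p).factorial := h1.trans h2
          _ < (h p).factorial ^ 2 := lt_self_pow₀ (by omega) one_lt_two
      exact_mod_cast h3
    exact Germ.coe_lt.2 this
  refine ⟨𝔩, (fun p => ((k p).factorial : ℤ) : Nat.Primes → ℤ), 𝔦,
    (fun p => ((h p).factorial : ℤ) : Nat.Primes → ℤ), ?_, ?_, ?_, ?_, ?_, ?_, hl_pow,
    Or.inr ⟨?_, ?_⟩⟩
  · exact Germ.coe_pos.2 (Eventually.of_forall fun p => by exact_mod_cast Nat.factorial_pos _)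
  · exact Germ.coe_pos.2 (Eventually.of_forall fun p => by exact_mod_cast Nat.factorial_pos _)
  · exact Germ.coe_eq.2 (Eventually.of_forall fun p => by simp [l])
  · exact Germ.coe_eq.2 (Eventually.of_forall fun p => by simp [i])
  · intro m hm
    have : ∀ᶠ p in D, (m : ℤ) ∣ (l p : ℤ) := by
      filter_upwards [kinf m] with p hp
      exact_mod_cast (Nat.dvd_factorial hm hp).trans (dvd_pow_self _ two_ne_zero)
    exact coe_dvd_coe.2 this
  · intro m hm
    have : ∀ᶠ p : Nat.Primes in D, (m : ℤ) * ((i p : ℤ) * (l p : ℤ)) ∣ ((p : ℕ) : ℤ) - 1 := by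
      filter_upwards [hinf m, hh, hk] with p hp hp2 hp3
      have h1 : ((p : ℕ) : ℤ) - 1 = (((p : ℕ) - 1 : ℕ) : ℤ) := by
        have := p.2.one_lt
        omega
      rw [h1]
      have h2 : l p ∣ (h p).factorial := by
        refine Nat.dvd_factorial (pow_pos (Nat.factorial_pos _) _) (le_trans ?_ hp3.1)
        exact Nat.le_self_pow (by omega) _
      have h3 : m * (i p * l p) ∣ (h p).factorial ^ 4 := by
        have : (h p).factorial ^ 4 = (h p).factorial * (i p * (h p).factorial) := by
          simp only [i]
          ring
        rw [this]
        exact mul_dvd_mul (Nat.dvd_factorial hm hp) (mul_dvd_mul dvd_rfl h2)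
      exact_mod_cast h3.trans hp2.1
    exact coe_dvd_coe.2 this
  · exact algebraicIndependent_res hl_inf (fun n => (hl_pow n).le) hi_inf hi_pow
  · refine ⟨fun n => (n + 1).factorial, fun n => Nat.factorial_pos _, ?_⟩
    intro n c x hc hx hsum hne j
    choose X hX using fun j => PF.mk_surjective (x j)
    have hrange : ({res 𝔩, res 𝔦} : Set (PF D)) = Set.range ![res 𝔩, res 𝔦] := by
      rw [Matrix.range_cons, Matrix.range_cons, Matrix.range_empty]
      simp [Set.pair_comm]
    choose P Q hPQ using fun j => exists_eq_aeval_div_of_mem_closure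
      (x := ![res 𝔩, res 𝔦]) (by rw [← hrange]; exact hc j)
    obtain ⟨N, hN⟩ := hcode ⟨n, fun j => (P j, Q j)⟩
    have hnd : IsNondegenerate c x := ⟨hsum, hne⟩
    have hnd' : ∀ᶠ p : Nat.Primes in D, IsNondegenerate (fun j =>
        MvPolynomial.aeval ![(l p : ZMod p), (i p : ZMod p)] (P j) /
          MvPolynomial.aeval ![(l p : ZMod p), (i p : ZMod p)] (Q j)) (fun j => X j p) := by
      rw [← isNondegenerate_mk_iff (D := D) (fun j (p : Nat.Primes) =>
        MvPolynomial.aeval ![(l p : ZMod p), (i p : ZMod p)] (P j) /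
          MvPolynomial.aeval ![(l p : ZMod p), (i p : ZMod p)] (Q j)) X]
      simp only [hX, ← PF.coefficient_mk]
      convert hnd using 2 with j
      exact (hPQ j).symm
    have hx' : ∀ᶠ p in D, ∀ j, X j p ^ l p = 1 := by
      refine eventually_all.2 fun j => ?_
      have h1 := hx j
      rw [← hX j, ipow_mk, ← PF.mk_one, PF.mk_eq_mk] at h1
      exact h1.mono fun p hp => by simpa using hp
    rw [← hX j, PF.mk_pow, ← PF.mk_one, PF.mk_eq_mk]
    filter_upwards [hnd', hx', hk, kinf (N + 1)] with p h1 h2 h3 h4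
    have h5 := h3.2 N (Finset.mem_range.2 h4)
    rw [hN] at h5
    exact h5 (fun j => X j p) h2 h1 j

end Existence

open Filter Topology

/-! ### The sequences that represent a scale -/

section Scale

variable {D : Ultrafilter Nat.Primes}

/-- The sequences of natural numbers `μ` and `ι` represent the square roots of the two scales
`𝔩 = μ²` and `𝔦 = ι²`. -/
structure ScaleSeq (D : Ultrafilter Nat.Primes) (μ ι : Nat.Primes → ℕ) : Prop where
  mu_pos : ∀ p, 0 < μ p
  iota_pos : ∀ p, 0 < ι p
  dvd_l : ∀ m : ℕ, 0 < m → ∀ᶠ p in D, m ∣ μ p ^ 2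
  dvd_sub_one : ∀ m : ℕ, 0 < m → ∀ᶠ p : Nat.Primes in D, m * (ι p ^ 2 * μ p ^ 2) ∣ (p : ℕ) - 1
  pow_lt : ∀ n : ℕ, ∀ᶠ p in D, (μ p ^ 2) ^ n < ι p ^ 2

theorem natCast_primes_sub_one (p : Nat.Primes) :
    (((p : ℕ) - 1 : ℕ) : ℤ) = ((p : ℕ) : ℤ) - 1 := by
  have := p.2.one_lt
  omega

theorem StarZ.exists_natCast_of_pos {x : StarZ D} (hx : 0 < x) :
    ∃ m : Nat.Primes → ℕ, (∀ p, 0 < m p) ∧ x = (fun p => (m p : ℤ) : Nat.Primes → ℤ) := by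
  induction x using Germ.inductionOn with | h x => ?_
  have hx' : ∀ᶠ p in D, 0 < x p := Germ.coe_lt.1 hx
  refine ⟨fun p => max 1 (x p).toNat, fun p => by positivity, Germ.coe_eq.2 ?_⟩
  filter_upwards [hx'] with p hp
  show x p = ((max 1 (x p).toNat : ℕ) : ℤ)
  omega

theorem IsScale.exists_scaleSeq {𝔩 μ 𝔦 ι : StarZ D} (h : IsScale D 𝔩 μ 𝔦 ι) :
    ∃ m i : Nat.Primes → ℕ, ScaleSeq D m i ∧ μ = (fun p => (m p : ℤ) : Nat.Primes → ℤ) ∧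
      ι = (fun p => (i p : ℤ) : Nat.Primes → ℤ) := by
  obtain ⟨m, hm, rfl⟩ := StarZ.exists_natCast_of_pos h.mu_pos
  obtain ⟨i, hi, rfl⟩ := StarZ.exists_natCast_of_pos h.iota_pos
  obtain rfl := h.l_eq
  obtain rfl := h.i_eq
  refine ⟨m, i, ⟨hm, hi, fun n hn => ?_, fun n hn => ?_, fun n => ?_⟩, rfl, rfl⟩
  · have h1 : ∀ᶠ p in D, (n : ℤ) ∣ (m p : ℤ) ^ 2 := coe_dvd_coe.1 (h.highly_divisible n hn)
    filter_upwards [h1] with p hp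
    exact_mod_cast hp
  · have h1 : ∀ᶠ p : Nat.Primes in D,
        (n : ℤ) * ((i p : ℤ) ^ 2 * (m p : ℤ) ^ 2) ∣ ((p : ℕ) : ℤ) - 1 :=
      coe_dvd_coe.1 (h.dvd_sub_one n hn)
    filter_upwards [h1] with p hp
    rw [← natCast_primes_sub_one] at hp
    exact_mod_cast hp
  · have h1 : ∀ᶠ p : Nat.Primes in D, ((m p : ℤ) ^ 2) ^ n < (i p : ℤ) ^ 2 :=
      Germ.coe_lt.1 (h.pow_lt n)
    filter_upwards [h1] with p hp
    exact_mod_cast hp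

variable {μ ι : Nat.Primes → ℕ}

theorem ScaleSeq.l_dvd (hs : ScaleSeq D μ ι) :
    ∀ᶠ p : Nat.Primes in D, μ p ^ 2 ∣ (p : ℕ) - 1 := by
  filter_upwards [hs.dvd_sub_one 1 one_pos] with p hp
  rw [one_mul] at hp
  exact (Dvd.intro_left _ rfl).trans hp

theorem ScaleSeq.dvd_mu (hs : ScaleSeq D μ ι) (m : ℕ) (hm : 0 < m) : ∀ᶠ p in D, m ∣ μ p := by
  filter_upwards [hs.dvd_l (m ^ 2) (pow_pos hm 2)] with p hp
  exact (Nat.pow_dvd_pow_iff two_ne_zero).1 hp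

theorem ScaleSeq.le_l (hs : ScaleSeq D μ ι) (n : ℕ) : ∀ᶠ p in D, n ≤ μ p ^ 2 := by
  filter_upwards [hs.dvd_l (n + 1) n.succ_pos] with p hp
  have := Nat.le_of_dvd (pow_pos (hs.mu_pos p) 2) hp
  omega

end Scale

/-! ### Roots of unity and non-standard exponents -/

section Roots

variable {D : Ultrafilter Nat.Primes}

/-- Every residue class modulo `d` that is prime to `d` contains a number prime to a given
multiple `n` of `d`. -/
theorem exists_coprime_modEq {d n j : ℕ} (hd : d ∣ n) (hn : 0 < n) (hj : j.Coprime d) :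
    ∃ k : ℕ, k.Coprime n ∧ k ≡ j [MOD d] := by
  have : NeZero n := ⟨hn.ne'⟩
  obtain ⟨u, hu⟩ := ZMod.unitsMap_surjective hd (ZMod.unitOfCoprime j hj)
  refine ⟨(u : ZMod n).val, ZMod.val_coe_unit_coprime u, ?_⟩
  have h1 := congrArg Units.val hu
  rw [ZMod.unitsMap_val, ZMod.coe_unitOfCoprime] at h1
  rw [← ZMod.natCast_eq_natCast_iff, ZMod.natCast_val, h1]

/-- In a finite prime field every primitive root of unity is a power, of the expected form, of a
primitive root of any larger admissible order. -/
theorem exists_isPrimitiveRoot_pow_eq (p : Nat.Primes) {d n : ℕ} (hn : n ∣ (p : ℕ) - 1)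
    (hd : d ∣ n) {ξ : ZMod p} (hξ : IsPrimitiveRoot ξ d) :
    ∃ ω : ZMod p, IsPrimitiveRoot ω n ∧ ω ^ (n / d) = ξ := by
  have hp1 : 0 < (p : ℕ) - 1 := by
    have := p.2.one_lt
    omega
  have hn0 : 0 < n := Nat.pos_of_dvd_of_pos hn hp1
  have hd0 : 0 < d := Nat.pos_of_dvd_of_pos hd hn0
  obtain ⟨g, hg⟩ := exists_isPrimitiveRoot_zmod p
  obtain ⟨g₁, hg1⟩ : ∃ g₁ : ZMod p, IsPrimitiveRoot g₁ n :=
    ⟨_, hg.pow hp1 (Nat.div_mul_cancel hn).symm⟩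
  have hg2 : IsPrimitiveRoot (g₁ ^ (n / d)) d := hg1.pow hn0 (Nat.div_mul_cancel hd).symm
  have : NeZero d := ⟨hd0.ne'⟩
  obtain ⟨j, -, hj, hjξ⟩ := hg2.isPrimitiveRoot_iff.1 hξ
  obtain ⟨k, hk, hkj⟩ := exists_coprime_modEq hd hn0 hj
  refine ⟨g₁ ^ k, hg1.pow_of_coprime _ hk, ?_⟩
  rw [← hjξ, ← pow_mul, mul_comm k, pow_mul]
  have h1 : orderOf (g₁ ^ (n / d)) = d := hg2.eq_orderOf.symm
  have h2 := fun i => pow_mod_orderOf (g₁ ^ (n / d)) i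
  rw [h1] at h2
  rw [← h2 k, ← h2 j, show k % d = j % d from hkj]

theorem ipow_add {x : PF D} (hx : x ≠ 0) (m n : StarZ D) :
    ipow x (m + n) = ipow x m * ipow x n := by
  obtain ⟨f, rfl⟩ := PF.mk_surjective x
  induction m using Germ.inductionOn with | h m => ?_
  induction n using Germ.inductionOn with | h n => ?_
  refine PF.mk_eq_mk.2 ?_
  filter_upwards [PF.mk_ne_zero_iff.1 hx] with p hp
  exact zpow_add₀ hp _ _

theorem ipow_zero (x : PF D) : ipow x 0 = 1 := by
  obtain ⟨f, rfl⟩ := PF.mk_surjective x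
  exact PF.mk_eq_mk.2 (Eventually.of_forall fun p => zpow_zero _)

/-- Internal powers of a nonzero element, as a homomorphism. -/
def ipowHom {x : PF D} (hx : x ≠ 0) : Multiplicative (StarZ D) →* PF D where
  toFun n := ipow x n.toAdd
  map_one' := ipow_zero x
  map_mul' _ _ := ipow_add hx _ _

/-- The limit of the values of an internal function along the ultrafilter, where it exists. -/
noncomputable def germLim (u : Nat.Primes → ℤ → ℂ) (K : StarZ D) : ℂ :=
  limUnder (D : Filter Nat.Primes) fun p => u p ((Quotient.out K : Nat.Primes → ℤ) p)

theorem germLim_coe {u : Nat.Primes → ℤ → ℂ} {K : Nat.Primes → ℤ} {z : ℂ}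
    (h : Tendsto (fun p => u p (K p)) D (𝓝 z)) : germLim u (K : StarZ D) = z := by
  refine Tendsto.limUnder_eq (h.congr' ?_)
  have h1 : ((Quotient.out (K : StarZ D) : Nat.Primes → ℤ) : StarZ D) = (K : StarZ D) :=
    Quotient.out_eq _
  filter_upwards [Germ.coe_eq.1 h1] with p hp
  rw [hp]

/-- The character of the non-standard integers that sends `K` to the limit of `exp(2πi K / l)`. -/
noncomputable def limChar (D : Ultrafilter Nat.Primes) (l : Nat.Primes → ℕ) :
    Multiplicative (StarZ D) →* ℂ where
  toFun K := germLim (fun p k => Complex.exp (2 * Real.pi * Complex.I * (k / l p))) K.toAdd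
  map_one' := by
    refine germLim_coe (K := fun _ => 0) ?_
    simp
  map_mul' := by
    intro K K'
    obtain ⟨K, rfl⟩ := Multiplicative.ofAdd.surjective K
    obtain ⟨K', rfl⟩ := Multiplicative.ofAdd.surjective K'
    induction K using Germ.inductionOn with | h K => ?_
    induction K' using Germ.inductionOn with | h K' => ?_
    have hb : ∀ K : Nat.Primes → ℤ, ∃ z, Tendsto (fun p => Complex.exp
        (2 * Real.pi * Complex.I * ((K p : ℂ) / l p))) D (𝓝 z) := fun K => by
      refine exists_tendsto_of_norm_le (C := 1) (Eventually.of_forall fun p => ?_)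
      have : (2 * Real.pi * Complex.I * ((K p : ℂ) / l p))
          = ((2 * Real.pi * (K p / l p) : ℝ) : ℂ) * Complex.I := by
        push_cast
        ring
      rw [this, Complex.norm_exp_ofReal_mul_I]
    obtain ⟨z, hz⟩ := hb K
    obtain ⟨z', hz'⟩ := hb K'
    rw [toAdd_mul, toAdd_ofAdd, toAdd_ofAdd, germLim_coe hz, germLim_coe hz', ← Germ.coe_add]
    refine germLim_coe ((hz.mul hz').congr fun p => ?_)
    rw [← Complex.exp_add]
    congr 1
    rw [Pi.add_apply]
    push_cast
    ring

theorem limChar_coe {l : Nat.Primes → ℕ} {K : Nat.Primes → ℤ} {z : ℂ}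
    (h : Tendsto (fun p => Complex.exp (2 * Real.pi * Complex.I * ((K p : ℂ) / l p))) D (𝓝 z)) :
    limChar D l (Multiplicative.ofAdd (K : StarZ D)) = z :=
  germLim_coe (u := fun p k => Complex.exp (2 * Real.pi * Complex.I * (k / l p))) h

/-- Uniform torsion allows to specialise algebraically independent elements arbitrarily while the
internal `𝔩`-th roots of unity are sent to the limits of the corresponding complex ones. -/
theorem exists_isGraph_of_uniformRootTorsion (hD : (D : Filter Nat.Primes) ≤ cofinite)
    {l : Nat.Primes → ℕ} (hl0 : ∀ p, 0 < l p)
    (hldvd : ∀ m : ℕ, 0 < m → ∀ᶠ p in D, m ∣ l p) {ω : ∀ p : Nat.Primes, ZMod p}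
    (hω : ∀ᶠ p in D, IsPrimitiveRoot (ω p) (l p)) {k : Subfield (PF D)}
    (hk : UniformRootTorsion (fun p => (l p : ℤ) : Nat.Primes → ℤ) k)
    {Ω : Type*} [Field Ω] [Algebra ℂ Ω] {σ : Type*} {x : σ → PF D}
    (hx : AlgebraicIndependent ℤ x) (hxk : ∀ i, x i ∈ k) (y : σ → Ω) :
    ∃ T : Subring (PF D × Ω), IsGraph T ∧ (∀ i, (x i, y i) ∈ T) ∧
      ∀ (K : Nat.Primes → ℤ) (z : ℂ),
        Tendsto (fun p => Complex.exp (2 * Real.pi * Complex.I * ((K p : ℂ) / l p))) D (𝓝 z) →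
        (PF.mk fun p => ω p ^ K p, algebraMap ℂ Ω z) ∈ T := by
  have := charZero_PF hD
  have : CharZero Ω := charZero_of_injective_algebraMap (algebraMap ℂ Ω).injective
  have hω0 : (PF.mk ω : PF D) ≠ 0 := PF.mk_ne_zero_iff.2
    (hω.mono fun p hp => hp.ne_zero (hl0 p).ne')
  obtain ⟨f, hf0, hf⟩ := hk
  suffices h : ∃ T : Subring (PF D × Ω), IsGraph T ∧ (∀ i, (x i, y i) ∈ T) ∧
      ∀ g, (ipowHom hω0 g, ((algebraMap ℂ Ω).toMonoidHom.comp (limChar D l)) g) ∈ T by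
    obtain ⟨T, hT, hT1, hT2⟩ := h
    refine ⟨T, hT, hT1, fun K z hz => ?_⟩
    have := hT2 (Multiplicative.ofAdd (K : StarZ D))
    rwa [MonoidHom.comp_apply, limChar_coe hz] at this
  refine exists_isGraph_transfer hx y _ _ ?_ ?_ k hxk f hf0 ?_
  · intro g hg
    obtain ⟨K, rfl⟩ := Multiplicative.ofAdd.surjective g
    induction K using Germ.inductionOn with | h K => ?_
    have h1 : ∀ᶠ p in D, ω p ^ K p = 1 := PF.mk_eq_mk.1 (hg.trans PF.mk_one.symm)
    rw [MonoidHom.comp_apply, limChar_coe (z := 1) ?_]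
    · exact map_one (algebraMap ℂ Ω)
    refine tendsto_const_nhds.congr' ?_
    filter_upwards [h1, hω] with p hp hpω
    obtain ⟨t, ht⟩ := (hpω.zpow_eq_one_iff_dvd _).1 hp
    have hl : (l p : ℂ) ≠ 0 := by exact_mod_cast (hl0 p).ne'
    rw [ht, eq_comm, Complex.exp_eq_one_iff]
    refine ⟨t, ?_⟩
    push_cast
    field_simp
  · intro n hn
    refine ⟨Multiplicative.ofAdd ((fun p => ((l p / n : ℕ) : ℤ) : Nat.Primes → ℤ) : StarZ D),
      ?_, ?_⟩
    · refine PF.isPrimitiveRoot_mk ?_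
      filter_upwards [hω, hldvd n hn] with p hp hd
      rw [zpow_natCast]
      exact hp.pow (hl0 p) (Nat.div_mul_cancel hd).symm
    · rw [MonoidHom.comp_apply, limChar_coe (z := Complex.exp (2 * Real.pi * Complex.I / n)) ?_]
      · exact (Complex.isPrimitiveRoot_exp n hn.ne').map_of_injective (algebraMap ℂ Ω).injective
      refine tendsto_const_nhds.congr' ?_
      filter_upwards [hldvd n hn] with p hd
      obtain ⟨t, ht⟩ := hd
      have hl : 0 < l p := hl0 p
      have ht0 : t ≠ 0 := by
        rintro rfl
        omega
      have ht1 : (t : ℂ) ≠ 0 := by exact_mod_cast ht0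
      have hn1 : (n : ℂ) ≠ 0 := by exact_mod_cast hn.ne'
      rw [ht, Nat.mul_div_cancel_left _ hn]
      push_cast
      congr 1
      field_simp
  · intro n c g hc h1 h2
    refine hf n c (fun i => ipowHom hω0 (g i)) hc (fun i => ?_) h1 h2
    obtain ⟨K, hK⟩ := Multiplicative.ofAdd.surjective (g i)
    rw [← hK]
    clear hK
    induction K using Germ.inductionOn with | h K => ?_
    refine PF.mk_eq_mk.2 ?_
    filter_upwards [hω] with p hp
    show (ω p ^ K p) ^ (l p : ℤ) = 1
    rw [zpow_comm, zpow_natCast, hp.pow_eq_one, one_zpow]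

/-- Inverting one member of an algebraically independent pair. -/
theorem algebraicIndependent_inv_left {K : Type*} [Field K] {x y : K}
    (h : AlgebraicIndependent ℤ ![x, y]) : AlgebraicIndependent ℤ ![x⁻¹, y] := by
  rw [AlgebraicIndependent.iff_transcendental_adjoin_image 0] at h ⊢
  have h2 : ∀ x : K, ![x, y] '' {0}ᶜ = {y} := by
    intro x
    ext z
    simp [Fin.exists_fin_two, eq_comm]
  rw [h2] at h ⊢
  refine ⟨?_, ?_⟩
  · convert h.1 using 2 with i
    obtain ⟨i, hi⟩ := i
    fin_cases i
    · exact absurd rfl hi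
    · rfl
  · have := h.2
    simp only [Matrix.cons_val_zero] at this ⊢
    exact fun h' => this (IsAlgebraic.inv_iff.1 h')

end Roots

/-! ### The place on the roots of unity of order `𝔩` -/

section FirstPlace

variable {D : Ultrafilter Nat.Primes}

/-- The non-standard integer that is represented by a sequence of natural numbers. -/
abbrev natGerm (D : Ultrafilter Nat.Primes) (m : Nat.Primes → ℕ) : StarZ D :=
  ((fun p => (m p : ℤ)) : Nat.Primes → ℤ)

theorem natGerm_sq (m : Nat.Primes → ℕ) : natGerm D m ^ 2 = natGerm D (fun p => m p ^ 2) := by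
  rw [natGerm, ← Germ.coe_pow]
  refine congrArg _ (funext fun p => ?_)
  simp

/-- The value of the place at `ι`. -/
noncomputable abbrev iotaLim : ℂ := Complex.exp (-(Complex.I * (Real.pi / 4)))

/-- The place sends the internal powers `ω ^ K` of the root of unity `ω` of order `l` to the limits of
the complex numbers `exp(2πi K / l)`. -/
def SendsRoots (D : Ultrafilter Nat.Primes) (V : ValuationSubring (PF D)) (f : V →+* ℂ)
    (l : Nat.Primes → ℕ) (ω : ∀ p : Nat.Primes, ZMod p) : Prop :=
  ∀ (K : Nat.Primes → ℤ) (z : ℂ),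
    Tendsto (fun p => Complex.exp (2 * Real.pi * Complex.I * ((K p : ℂ) / l p))) D (𝓝 z) →
    SendsTo V f (PF.mk fun p => ω p ^ K p) z

theorem isPrimitiveRoot_eight {F : Type*} [Field F] {x : F} (h2 : (2 : F) ≠ 0)
    (hx : x ^ 4 = -1) : IsPrimitiveRoot x 8 := by
  have h := orderOf_eq_prime_pow (x := x) (p := 2) (n := 2)
    (by
      intro h
      norm_num [hx] at h
      apply h2
      linear_combination -h)
    (by
      norm_num
      linear_combination (x ^ 4 - 1) * hx)
  have h' := IsPrimitiveRoot.orderOf x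
  rw [h] at h'
  exact h'

/-- If `𝔦² + 1 = 𝔭`, then `ι` is itself a root of unity, of order `8`, and it suffices to choose the
primitive root accordingly. -/
theorem exists_place_of_sq_add_one_eq (hD : (D : Filter Nat.Primes) ≤ cofinite)
    {μ ι : Nat.Primes → ℕ} (hs : ScaleSeq D μ ι)
    (hp : ∀ᶠ p : Nat.Primes in D, (ι p ^ 2) ^ 2 + 1 = (p : ℕ))
    (hT : UniformRootTorsion (natGerm D fun p => μ p ^ 2)
      (Subfield.closure {res (natGerm D fun p => μ p ^ 2)})) :
    ∃ (ω : ∀ p : Nat.Primes, ZMod p) (V : ValuationSubring (PF D)) (f : V →+* ℂ), IsLocalHom f ∧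
      (∀ᶠ p in D, IsPrimitiveRoot (ω p) (μ p ^ 2)) ∧
      SendsTo V f (res (natGerm D fun p => μ p ^ 2))⁻¹ 0 ∧
      SendsTo V f (res (natGerm D ι)) iotaLim ∧ SendsRoots D V f (fun p => μ p ^ 2) ω := by
  have hex : ∀ p : Nat.Primes, ∃ ω : ZMod p, (ι p ^ 2) ^ 2 + 1 = (p : ℕ) → 3 ≤ (p : ℕ) →
      8 ∣ μ p ^ 2 → μ p ^ 2 ∣ (p : ℕ) - 1 →
      IsPrimitiveRoot ω (μ p ^ 2) ∧ ω ^ (μ p ^ 2 / 8) = (ι p : ZMod p)⁻¹ := by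
    intro p
    by_cases h : (ι p ^ 2) ^ 2 + 1 = (p : ℕ) ∧ 3 ≤ (p : ℕ) ∧ 8 ∣ μ p ^ 2 ∧ μ p ^ 2 ∣ (p : ℕ) - 1
    · obtain ⟨h1, h2, h3, h4⟩ := h
      have h5 : (ι p : ZMod p) ^ 4 = -1 := by
        have : ((((ι p ^ 2) ^ 2 + 1 : ℕ)) : ZMod p) = 0 := by
          rw [h1]
          exact ZMod.natCast_self _
        push_cast at this
        linear_combination this
      have h6 : (2 : ZMod p) ≠ 0 := by
        intro h
        have h' : ((2 : ℕ) : ZMod p) = 0 := by exact_mod_cast h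
        have := Nat.le_of_dvd two_pos ((ZMod.natCast_eq_zero_iff _ _).1 h')
        omega
      obtain ⟨ω, h7, h8⟩ := exists_isPrimitiveRoot_pow_eq p h4 h3 (isPrimitiveRoot_eight h6 h5).inv
      exact ⟨ω, fun _ _ _ _ => ⟨h7, h8⟩⟩
    · exact ⟨1, fun h1 h2 h3 h4 => absurd ⟨h1, h2, h3, h4⟩ h⟩
  choose ω hω using hex
  have hω' : ∀ᶠ p in D, IsPrimitiveRoot (ω p) (μ p ^ 2) ∧
      ω p ^ (μ p ^ 2 / 8) = (ι p : ZMod p)⁻¹ := by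
    filter_upwards [hp, eventually_natCast_le hD 3, hs.dvd_l 8 (by norm_num), hs.l_dvd]
      with p h1 h2 h3 h4 using hω p h1 h2 h3 h4
  have hl0 : ∀ p, 0 < μ p ^ 2 := fun p => pow_pos (hs.mu_pos p) 2
  have htr : Transcendental ℤ (res (natGerm D fun p => μ p ^ 2)) := by
    refine transcendental_res (fun n => ?_) (fun n => ?_)
    · refine Germ.coe_lt.2 ?_
      filter_upwards [hs.le_l (n + 1)] with p hn
      show (n : ℤ) < ((μ p ^ 2 : ℕ) : ℤ)
      exact_mod_cast hn
    · rw [natGerm, ← Germ.coe_pow, bigPrime]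
      refine Germ.coe_le.2 ?_
      filter_upwards [hs.pow_lt n, hp] with p h1 h2
      show ((μ p ^ 2 : ℕ) : ℤ) ^ n ≤ ((p : ℕ) : ℤ)
      have h3 : (μ p ^ 2) ^ n ≤ (p : ℕ) := by nlinarith
      exact_mod_cast h3
  have hx : AlgebraicIndependent ℤ fun _ : Unit => (res (natGerm D fun p => μ p ^ 2))⁻¹ := by
    rw [algebraicIndependent_unique_type_iff]
    exact fun h => htr (IsAlgebraic.inv_iff.1 h)
  obtain ⟨T, hTg, hT1, hT2⟩ := exists_isGraph_of_uniformRootTorsion hD hl0 hs.dvd_l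
    (hω'.mono fun p h => h.1) hT hx
    (fun _ => Subfield.inv_mem _ (Subfield.subset_closure (Set.mem_singleton _))) fun _ => (0 : ℂ)
  obtain ⟨V, f, hf, hV⟩ := exists_valuationSubring_extension hTg
  have hroots : SendsRoots D V f (fun p => μ p ^ 2) ω := fun K z hz => hV _ _ (hT2 K z hz)
  refine ⟨ω, V, f, hf, hω'.mono fun p h => h.1, hV _ _ (hT1 ()), ?_, hroots⟩
  have h := hroots (fun p => -((μ p ^ 2 / 8 : ℕ) : ℤ)) iotaLim ?_
  · convert h using 1
    refine PF.mk_eq_mk.2 (hω'.mono fun p h => ?_)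
    rw [zpow_neg, zpow_natCast, h.2, inv_inv]
    exact Int.cast_natCast _
  · refine tendsto_const_nhds.congr' ?_
    filter_upwards [hs.dvd_l 8 (by norm_num)] with p h8
    obtain ⟨t, ht⟩ := h8
    have ht0 : (t : ℂ) ≠ 0 := by
      rintro h
      have := hl0 p
      rw [ht, Nat.cast_eq_zero.1 h] at this
      omega
    rw [ht, Nat.mul_div_cancel_left _ (by norm_num)]
    push_cast
    unfold iotaLim
    congr 1
    field_simp
    norm_num

/-- If `𝔩` and `𝔦` are algebraically independent, then `𝔦` is first sent to an indeterminate `s²`,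
and its square root `s` is specialised afterwards. -/
theorem exists_place_of_algebraicIndependent (hD : (D : Filter Nat.Primes) ≤ cofinite)
    {μ ι : Nat.Primes → ℕ} (hs : ScaleSeq D μ ι)
    (hind : AlgebraicIndependent ℤ ![res (natGerm D fun p => μ p ^ 2), res (natGerm D ι ^ 2)])
    (hT : UniformRootTorsion (natGerm D fun p => μ p ^ 2)
      (Subfield.closure {res (natGerm D fun p => μ p ^ 2), res (natGerm D ι ^ 2)})) :
    ∃ (ω : ∀ p : Nat.Primes, ZMod p) (V : ValuationSubring (PF D)) (f : V →+* ℂ), IsLocalHom f ∧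
      (∀ᶠ p in D, IsPrimitiveRoot (ω p) (μ p ^ 2)) ∧
      SendsTo V f (res (natGerm D fun p => μ p ^ 2))⁻¹ 0 ∧
      SendsTo V f (res (natGerm D ι)) iotaLim ∧ SendsRoots D V f (fun p => μ p ^ 2) ω := by
  choose g hg using exists_isPrimitiveRoot_zmod
  obtain ⟨ω, hω⟩ : ∃ ω : ∀ p : Nat.Primes, ZMod p,
      ∀ᶠ p in D, IsPrimitiveRoot (ω p) (μ p ^ 2) := by
    refine ⟨fun p => g p ^ (((p : ℕ) - 1) / μ p ^ 2), ?_⟩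
    filter_upwards [hs.l_dvd] with p hp
    have := p.2.one_lt
    exact (hg p).pow (by omega) (Nat.div_mul_cancel hp).symm
  have hl0 : ∀ p, 0 < μ p ^ 2 := fun p => pow_pos (hs.mu_pos p) 2
  let Ω := AlgebraicClosure (RatFunc ℂ)
  let t : Ω := algebraMap (RatFunc ℂ) Ω RatFunc.X
  have ht : Transcendental ℂ t :=
    (transcendental_algebraMap_iff (algebraMap (RatFunc ℂ) Ω).injective).2 RatFunc.transcendental_X
  obtain ⟨T, hTg, hT1, hT2⟩ := exists_isGraph_of_uniformRootTorsion hD hl0 hs.dvd_l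
    hω hT (algebraicIndependent_inv_left hind)
    (fun i => by
      fin_cases i
      · exact Subfield.inv_mem _ (Subfield.subset_closure (by simp))
      · exact Subfield.subset_closure (by simp)) ![(0 : Ω), t]
  obtain ⟨V, f, -, hV⟩ := exists_valuationSubring_extension hTg
  have h1 : SendsTo V f (res (natGerm D ι) ^ 2) t := by
    have h := hV _ _ (hT1 1)
    rwa [Matrix.cons_val_one, Matrix.cons_val_one, Matrix.cons_val_fin_one,
      Matrix.cons_val_fin_one, ← resHom_apply, map_pow, resHom_apply] at h
  obtain ⟨s, hs1, hst⟩ := h1.exists_of_pow two_pos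
  have hstr : Transcendental ℂ s := by
    rw [← hst] at ht
    exact fun h => ht (h.pow 2)
  -- the specialisation of `s` in the part of the place that is polynomial in `s`
  let T₁ : Subring (PF D × ℂ) :=
    { carrier := {w | ∃ P : Polynomial ℂ, SendsTo V f w.1 (Polynomial.aeval s P) ∧
        P.eval iotaLim = w.2}
      zero_mem' := ⟨0, by simpa using sendsTo_zero, by simp⟩
      one_mem' := ⟨1, by simpa using sendsTo_one, by simp⟩
      add_mem' := by
        rintro _ _ ⟨P, hP, hP'⟩ ⟨Q, hQ, hQ'⟩
        exact ⟨P + Q, by simpa using hP.add hQ, by simp [hP', hQ']⟩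
      mul_mem' := by
        rintro _ _ ⟨P, hP, hP'⟩ ⟨Q, hQ, hQ'⟩
        exact ⟨P * Q, by simpa using hP.mul hQ, by simp [hP', hQ']⟩
      neg_mem' := by
        rintro _ ⟨P, hP, hP'⟩
        exact ⟨-P, by simpa using hP.neg, by simp [hP']⟩ }
  have hT₁ : IsGraph T₁ := by
    rintro w ⟨P, hP, hP'⟩
    have h0 : Polynomial.aeval s P = 0 := hP.unique sendsTo_zero
    have hP0 : P = 0 := (transcendental_iff.1 hstr) P h0
    simpa [hP0] using hP'.symm
  obtain ⟨V₁, f₁, hf₁, hV₁⟩ := exists_valuationSubring_extension hT₁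
  refine ⟨ω, V₁, f₁, hf₁, hω, hV₁ _ _ ⟨0, ?_, by simp⟩, hV₁ _ _ ⟨Polynomial.X, ?_, by simp⟩,
    fun K z hz => hV₁ _ _ ⟨Polynomial.C z, ?_, by simp⟩⟩
  · have h := hV _ _ (hT1 0)
    simpa using h
  · simpa using hs1
  · rw [Polynomial.aeval_C]
    exact hV _ _ (hT2 K z hz)

/-- On the ring generated by `1/μ`, `ι` and the internal `𝔩`-th roots of unity a place with the
required values exists. -/
theorem IsScale.exists_place_roots (hD : (D : Filter Nat.Primes) ≤ cofinite)
    {μ ι : Nat.Primes → ℕ} {𝔩 𝔦 : StarZ D} (hs : ScaleSeq D μ ι)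
    (h : IsScale D 𝔩 (natGerm D μ) 𝔦 (natGerm D ι)) :
    ∃ (ω : ∀ p : Nat.Primes, ZMod p) (V : ValuationSubring (PF D)) (f : V →+* ℂ), IsLocalHom f ∧
      (∀ᶠ p in D, IsPrimitiveRoot (ω p) (μ p ^ 2)) ∧
      SendsTo V f (res (natGerm D μ))⁻¹ 0 ∧
      SendsTo V f (res (natGerm D ι)) iotaLim ∧ SendsRoots D V f (fun p => μ p ^ 2) ω := by
  have hl : 𝔩 = natGerm D fun p => μ p ^ 2 := by rw [h.l_eq, natGerm_sq]
  suffices ∃ (ω : ∀ p : Nat.Primes, ZMod p) (V : ValuationSubring (PF D)) (f : V →+* ℂ),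
      IsLocalHom f ∧ (∀ᶠ p in D, IsPrimitiveRoot (ω p) (μ p ^ 2)) ∧
      SendsTo V f (res (natGerm D fun p => μ p ^ 2))⁻¹ 0 ∧
      SendsTo V f (res (natGerm D ι)) iotaLim ∧ SendsRoots D V f (fun p => μ p ^ 2) ω by
    obtain ⟨ω, V, f, hf, h1, h2, h3⟩ := this
    refine ⟨ω, V, f, hf, h1, ?_, h3⟩
    rw [← natGerm_sq, ← resHom_apply, map_pow, resHom_apply, ← inv_pow] at h2
    obtain ⟨a, ha, ha2⟩ := h2.exists_of_pow two_pos
    rwa [pow_eq_zero_iff two_ne_zero |>.1 ha2] at ha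
  obtain ⟨h1, h2⟩ | ⟨h1, h2⟩ := h.generic
  · rw [hl] at h2
    refine exists_place_of_sq_add_one_eq hD hs ?_ h2
    rw [h.i_eq] at h1
    have h3 : ∀ᶠ p : Nat.Primes in D, (((ι p : ℤ) ^ 2) ^ 2 + 1) = ((p : ℕ) : ℤ) := Germ.coe_eq.1 h1
    filter_upwards [h3] with p hp
    exact_mod_cast hp
  · rw [hl, h.i_eq] at h1 h2
    exact exists_place_of_algebraicIndependent hD hs h1 h2

end FirstPlace

/-! ### Roots of unity of order `m𝔩` -/

section LargerRoots

variable {D : Ultrafilter Nat.Primes}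

/-- An ultrafilter decides the value of a function with finitely many values. -/
theorem exists_eventually_eq_of_lt {r : Nat.Primes → ℕ} {m : ℕ} (h : ∀ p, r p < m) :
    ∃ r₀ < m, ∀ᶠ p in D, r p = r₀ := by
  have h1 : ∀ᶠ p in D, ∃ i ∈ Set.Iio m, r p = i := Eventually.of_forall fun p => ⟨r p, h p, rfl⟩
  obtain ⟨i, hi, h2⟩ := (Ultrafilter.eventually_exists_mem_iff (Set.finite_Iio m)).1 h1
  exact ⟨i, hi, h2⟩

theorem tendsto_exp_const_div {l : Nat.Primes → ℕ} (hl : ∀ n : ℕ, ∀ᶠ p in D, n ≤ l p) (r : ℂ) :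
    Tendsto (fun p => Complex.exp (2 * Real.pi * Complex.I * (r / l p))) D (𝓝 1) := by
  have h1 : Tendsto l D atTop := tendsto_atTop.2 hl
  have h2 : Tendsto (fun p => r / (l p : ℂ)) D (𝓝 0) :=
    (tendsto_const_div_atTop_nhds_zero_nat r).comp h1
  have h3 := (h2.const_mul (2 * Real.pi * Complex.I)).cexp
  simpa using h3

/-- A place that is determined on the internal `𝔩`-th roots of unity takes the expected values on
the roots of unity of order `m𝔩`, for all standard `m`, with respect to a suitable primitive root of
unity of order `M𝔩`; here `M` is a non-standard number divisible by all standard ones. -/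
theorem SendsRoots.exists_lift {V : ValuationSubring (PF D)} {f : V →+* ℂ}
    {l M : Nat.Primes → ℕ} {ω : ∀ p : Nat.Primes, ZMod p} (h : SendsRoots D V f l ω)
    (hl : ∀ n : ℕ, ∀ᶠ p in D, n ≤ l p) (hω : ∀ᶠ p in D, IsPrimitiveRoot (ω p) (l p))
    (hM : ∀ m : ℕ, 0 < m → ∀ᶠ p in D, m ∣ M p) (hM0 : ∀ p, 0 < M p)
    (hMl : ∀ᶠ p in D, M p ∣ l p)
    (hMlp : ∀ᶠ p : Nat.Primes in D, M p * l p ∣ (p : ℕ) - 1) :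
    ∃ ξ : ∀ p : Nat.Primes, ZMod p, (∀ᶠ p in D, IsPrimitiveRoot (ξ p) (M p * l p)) ∧
      ∀ m : ℕ, 0 < m →
        SendsRoots D V f (fun p => m * l p) (fun p => ξ p ^ (M p / m)) := by
  have hl0 : ∀ᶠ p in D, 0 < l p := hl 1
  have hex : ∀ p : Nat.Primes, ∃ ω' : ZMod p, 0 < l p → M p * l p ∣ (p : ℕ) - 1 →
      IsPrimitiveRoot (ω p) (l p) → IsPrimitiveRoot ω' (M p * l p) ∧ ω' ^ M p = ω p := by
    intro p
    by_cases hp : 0 < l p ∧ M p * l p ∣ (p : ℕ) - 1 ∧ IsPrimitiveRoot (ω p) (l p)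
    · obtain ⟨ω', h1, h2⟩ := exists_isPrimitiveRoot_pow_eq p hp.2.1 (Dvd.intro_left _ rfl) hp.2.2
      rw [Nat.mul_div_cancel _ hp.1] at h2
      exact ⟨ω', fun _ _ _ => ⟨h1, h2⟩⟩
    · exact ⟨1, fun h1 h2 h3 => absurd ⟨h1, h2, h3⟩ hp⟩
  choose ω' hω' using hex
  have hω1 : ∀ᶠ p in D, IsPrimitiveRoot (ω' p) (M p * l p) ∧ ω' p ^ M p = ω p := by
    filter_upwards [hl0, hMlp, hω] with p h1 h2 h3 using hω' p h1 h2 h3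
  have hone : SendsTo V f (PF.mk ω) 1 := by
    have := h (fun _ => 1) 1 (by simpa using tendsto_exp_const_div hl 1)
    simpa using this
  have hexp : ∀ m : ℕ, 0 < m → IsPrimitiveRoot (Complex.exp (2 * Real.pi * Complex.I / m)) m :=
    fun m hm => Complex.isPrimitiveRoot_exp m hm.ne'
  -- the place sends `ω' ^ (M / m)` to an `m`-th root of unity
  have hval : ∀ m : ℕ, ∃ a : ℂ, 0 < m → SendsTo V f (PF.mk fun p => ω' p ^ (M p / m)) a ∧
      a ^ m = 1 := by
    intro m
    by_cases hm : 0 < m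
    · obtain ⟨a, ha, ha1⟩ := SendsTo.exists_of_pow (V := V) (g := f) hm
        (x := PF.mk fun p => ω' p ^ (M p / m)) (b := 1) (by
          convert hone using 1
          rw [PF.mk_pow, PF.mk_eq_mk]
          filter_upwards [hM m hm, hω1] with p h1 h2
          rw [← pow_mul, Nat.div_mul_cancel h1, h2.2])
      exact ⟨a, fun _ => ⟨ha, ha1⟩⟩
    · exact ⟨0, fun h => absurd h hm⟩
  choose a ha using hval
  have ht : ∀ m : ℕ, ∃ t : ℕ, 0 < m →
      a m * Complex.exp (2 * Real.pi * Complex.I / m) ^ t = 1 := by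
    intro m
    by_cases hm : 0 < m
    · have : NeZero m := ⟨hm.ne'⟩
      have ha0 : a m ≠ 0 := fun h0 => by
        have := (ha m hm).2
        rw [h0, zero_pow hm.ne'] at this
        exact zero_ne_one this
      obtain ⟨t, -, ht⟩ := (hexp m hm).eq_pow_of_pow_eq_one (ξ := (a m)⁻¹)
        (by rw [inv_pow, (ha m hm).2, inv_one])
      exact ⟨t, fun _ => by rw [ht, mul_inv_cancel₀ ha0]⟩
    · exact ⟨0, fun h => absurd h hm⟩
  choose t ht using ht
  -- the exponents `t m` are compatible
  have hcomp : ∀ m n : ℕ, 0 < m → 0 < n → m ∣ n →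
      a m * Complex.exp (2 * Real.pi * Complex.I / m) ^ t n = 1 := by
    rintro m n hm hn ⟨s, rfl⟩
    have hs : 0 < s := Nat.pos_of_mul_pos_left hn
    have h1 : a (m * s) ^ s = a m := by
      refine ((ha _ hn).1.pow s).unique (b := a m) ?_
      convert (ha m hm).1 using 1
      rw [PF.mk_pow, PF.mk_eq_mk]
      filter_upwards [hM _ hn] with p hp
      obtain ⟨u, hu⟩ := hp
      rw [hu, Nat.mul_div_cancel_left _ hn, mul_assoc, Nat.mul_div_cancel_left _ hm, ← pow_mul,
        mul_comm]
    have h2 : Complex.exp (2 * Real.pi * Complex.I / (m * s : ℕ)) ^ s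
        = Complex.exp (2 * Real.pi * Complex.I / m) := by
      rw [← Complex.exp_nat_mul]
      have : (s : ℂ) ≠ 0 := by exact_mod_cast hs.ne'
      have : (m : ℂ) ≠ 0 := by exact_mod_cast hm.ne'
      congr 1
      push_cast
      field_simp
    have h3 := congrArg (· ^ s) (ht _ hn)
    simp only [one_pow] at h3
    rwa [mul_pow, h1, ← pow_mul, mul_comm (t _) s, pow_mul, h2] at h3
  -- the infinite exponent `t M` corrects all the values `a m` at once
  let ξ : ∀ p : Nat.Primes, ZMod p := fun p => ω' p ^ (1 + t (M p) * l p)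
  have hξM : ∀ᶠ p in D, ξ p ^ M p = ω p := by
    filter_upwards [hω1, hω] with p h1 h2
    rw [← pow_mul, mul_comm, pow_mul, h1.2, pow_add, pow_one, mul_comm (t _), pow_mul,
      h2.pow_eq_one, one_pow, mul_one]
  have hξm : ∀ m : ℕ, 0 < m → SendsTo V f (PF.mk fun p => ξ p ^ (M p / m)) 1 := by
    intro m hm
    have h1 := h (fun p => ((l p / m * t (M p) : ℕ) : ℤ)) (a m)⁻¹ (by
      refine tendsto_const_nhds.congr' ?_
      filter_upwards [hM m hm, hMl, hl0] with p h1 h2 h3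
      rw [inv_eq_of_mul_eq_one_right (hcomp m _ hm (hM0 p) h1), ← Complex.exp_nat_mul]
      obtain ⟨u, hu⟩ := h1.trans h2
      have : (u : ℂ) ≠ 0 := by
        rintro h0
        rw [Nat.cast_eq_zero.1 h0] at hu
        omega
      have : (m : ℂ) ≠ 0 := by exact_mod_cast hm.ne'
      rw [hu, Nat.mul_div_cancel_left _ hm]
      push_cast
      congr 1
      field_simp)
    have ha0 : a m ≠ 0 := left_ne_zero_of_mul_eq_one (ht m hm)
    have h2 := (ha m hm).1.mul h1
    rw [mul_inv_cancel₀ ha0, PF.mk_mul] at h2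
    convert h2 using 1
    rw [PF.mk_eq_mk]
    filter_upwards [hM m hm, hMl, hω1] with p h1 h2 h3
    rw [zpow_natCast, ← h3.2, ← pow_mul, ← pow_mul, ← pow_add]
    congr 1
    obtain ⟨u, hu⟩ := h1
    obtain ⟨v, hv⟩ := h2
    rw [hv, hu, mul_assoc m u v, Nat.mul_div_cancel_left _ hm, Nat.mul_div_cancel_left _ hm]
    ring
  refine ⟨ξ, ?_, fun m hm K z hz => ?_⟩
  · filter_upwards [hω1, hMl] with p h1 h2
    refine h1.1.pow_of_coprime _ ?_
    have h3 : (1 + t (M p) * l p).Coprime (l p) := by simp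
    exact Nat.Coprime.mul_right (h3.coprime_dvd_right h2) h3
  · have hm' : (0 : ℤ) < m := by exact_mod_cast hm
    obtain ⟨r, hr, hrK⟩ := exists_eventually_eq_of_lt (D := D) (m := m)
      (r := fun p => (K p % m).toNat) (fun p => by
        have := Int.emod_nonneg (K p) hm'.ne'
        have := Int.emod_lt_of_pos (K p) hm'
        omega)
    have hdiv : ∀ᶠ p in D, K p = m * (K p / m) + r := by
      filter_upwards [hrK] with p hp
      have h1 := Int.emod_nonneg (K p) hm'.ne'
      have h2 := Int.mul_ediv_add_emod (K p) m
      omega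
    -- `ξ ^ (M / m)` is sent to `1`, so that the remainder `r` of `K` does not matter
    have h1 := h (fun p => K p / m) z (by
      have h2 := hz.div (tendsto_exp_const_div hl ((r : ℂ) / m)) one_ne_zero
      rw [div_one] at h2
      refine h2.congr' ?_
      filter_upwards [hdiv, hl0] with p hp hlp
      rw [Pi.div_apply, ← Complex.exp_sub]
      congr 1
      have h3 : (K p : ℂ) = m * ((K p / m : ℤ) : ℂ) + r := by exact_mod_cast congrArg Int.cast hp
      have : (m : ℂ) ≠ 0 := by exact_mod_cast hm.ne'
      have : (l p : ℂ) ≠ 0 := by exact_mod_cast hlp.ne'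
      rw [h3]
      push_cast
      field_simp
      ring)
    have h2 := h1.mul ((hξm m hm).pow r)
    rw [one_pow, mul_one, PF.mk_pow, PF.mk_mul] at h2
    convert h2 using 1
    rw [PF.mk_eq_mk]
    filter_upwards [hdiv, hξM, hM m hm, hω, hl0] with p h3 h4 h5 h6 h7
    have hξ0 : ξ p ≠ 0 := by
      intro h0
      rw [h0, zero_pow (hM0 p).ne'] at h4
      exact h6.ne_zero h7.ne' h4.symm
    conv_lhs => rw [h3]
    rw [zpow_add₀ (pow_ne_zero _ hξ0), zpow_mul, zpow_natCast, ← pow_mul, Nat.div_mul_cancel h5,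
      h4, zpow_natCast]

end LargerRoots

/-! ### Generic generators -/

section GenericGenerator

/-- A generator of the multiplicative group of a prime field may be chosen so that its power of
order `s² d` is a prescribed primitive root of order `d` after raising to the power `s²`, and avoids
the roots of a small number of polynomials of small degree. -/
theorem exists_generator_eval_ne_zero (p : Nat.Primes) {d s b : ℕ}
    (hsd : s ^ 2 * d ∣ (p : ℕ) - 1) {ξ : ZMod p} (hξ : IsPrimitiveRoot ξ d)
    (F : Finset (Polynomial (ZMod p))) (hF : ∀ P ∈ F, P.natDegree ≤ b) (hFs : F.card * b < s) :
    ∃ ε : ZMod p, IsPrimitiveRoot ε ((p : ℕ) - 1) ∧ ε ^ (((p : ℕ) - 1) / d) = ξ ∧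
      ∀ P ∈ F, P ≠ 0 → P.eval (ε ^ (((p : ℕ) - 1) / (s ^ 2 * d))) ≠ 0 := by
  classical
  have hp1 : 0 < (p : ℕ) - 1 := by
    have := p.2.one_lt
    omega
  have hn0 : 0 < s ^ 2 * d := Nat.pos_of_dvd_of_pos hsd hp1
  have hd0 : 0 < d := Nat.pos_of_mul_pos_left hn0
  obtain ⟨y₀, hy, hy2⟩ := exists_isPrimitiveRoot_pow_eq p hsd (Dvd.intro_left _ rfl) hξ
  rw [Nat.mul_div_cancel _ hd0] at hy2
  have hy0 : y₀ ≠ 0 := hy.ne_zero hn0.ne'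
  -- the candidates are `y₀ ^ (1 + s d j)` for `j < s`
  have hw : IsPrimitiveRoot (y₀ ^ (s * d)) s := hy.pow hn0 (by ring)
  let c : ℕ → ZMod p := fun j => y₀ ^ (1 + s * d * j)
  have hinj : Set.InjOn c (Finset.range s) := by
    intro i hi j hj hij
    simp only [c, pow_add, pow_mul _ (s * d)] at hij
    exact hw.pow_inj (Finset.mem_range.1 hi) (Finset.mem_range.1 hj)
      (mul_left_cancel₀ (pow_ne_zero 1 hy0) hij)
  have hcard : (F.biUnion fun P => P.roots.toFinset).card < ((Finset.range s).image c).card := by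
    rw [Finset.card_image_of_injOn hinj, Finset.card_range]
    refine lt_of_le_of_lt (Finset.card_biUnion_le_card_mul _ _ b fun P hP => ?_) hFs
    exact (Multiset.toFinset_card_le _).trans ((P.card_roots').trans (hF P hP))
  obtain ⟨y, hyc, hyF⟩ := Finset.exists_mem_notMem_of_card_lt_card hcard
  obtain ⟨j, -, rfl⟩ := Finset.mem_image.1 hyc
  have hcop : (1 + s * d * j).Coprime (s ^ 2 * d) := by
    have h1 : (1 + s * d * j).Coprime (s * d) := by simp
    have h2 : (1 + s * d * j).Coprime s := h1.coprime_dvd_right (Dvd.intro _ rfl)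
    rw [show s ^ 2 * d = s * (s * d) by ring]
    exact Nat.Coprime.mul_right h2 h1
  have hyj : IsPrimitiveRoot (c j) (s ^ 2 * d) := hy.pow_of_coprime _ hcop
  obtain ⟨ε, hε, hεy⟩ := exists_isPrimitiveRoot_pow_eq p dvd_rfl hsd hyj
  refine ⟨ε, hε, ?_, fun P hP hP0 h0 => hyF ?_⟩
  · have h1 : ((p : ℕ) - 1) / d = ((p : ℕ) - 1) / (s ^ 2 * d) * s ^ 2 := by
      obtain ⟨t, ht⟩ := hsd
      rw [ht, Nat.mul_div_cancel_left _ hn0, mul_comm (s ^ 2), mul_assoc,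
        Nat.mul_div_cancel_left _ hd0, mul_comm]
    have h2 : (1 + s * d * j) * s ^ 2 = s ^ 2 + s ^ 2 * d * (s * j) := by ring
    rw [h1, pow_mul, hεy, ← pow_mul, h2, pow_add, hy2, pow_mul, hy.pow_eq_one, one_pow, mul_one]
  · rw [hεy] at h0
    exact Finset.mem_biUnion.2 ⟨P, hP, Multiset.mem_toFinset.2 ((Polynomial.mem_roots hP0).2 h0)⟩

open scoped Pointwise

theorem sum_mem_card_nsmul {I A : Type*} [AddCommMonoid A] [DecidableEq A] {S : Finset A}
    {t : Finset I} {g : I → A} (h : ∀ i ∈ t, g i ∈ S) : ∑ i ∈ t, g i ∈ t.card • S := by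
  classical
  induction t using Finset.induction_on with
  | empty => simp
  | insert i t hi ih =>
    rw [Finset.sum_insert hi, Finset.card_insert_of_notMem hi, succ_nsmul']
    exact Finset.add_mem_add (h i (Finset.mem_insert_self _ _))
      (ih fun j hj => h j (Finset.mem_insert_of_mem hj))

/-- The monomials `q(x) ξ^e X^k` with one of the first `N` coefficients `q`, and `0`. -/
noncomputable def monomialSet {R : Type*} [CommRing R] [DecidableEq R]
    (code : ℕ → MvPolynomial (Fin 2) ℤ) (x : Fin 2 → R) (ξ : R) (d N : ℕ) :
    Finset (Polynomial R) :=
  insert 0 ((Finset.range N ×ˢ Finset.range d ×ˢ Finset.range (2 * N * d + 1)).image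
    fun w => Polynomial.C (MvPolynomial.aeval x (code w.1) * ξ ^ w.2.1) * Polynomial.X ^ w.2.2)

variable {R : Type*} [CommRing R] [DecidableEq R] {code : ℕ → MvPolynomial (Fin 2) ℤ}
  {x : Fin 2 → R} {ξ : R} {d N : ℕ}

theorem card_monomialSet_le :
    (monomialSet code x ξ d N).card ≤ N * (d * (2 * N * d + 1)) + 1 := by
  refine (Finset.card_insert_le _ _).trans (Nat.add_le_add_right ?_ 1)
  refine Finset.card_image_le.trans ?_
  rw [Finset.card_product, Finset.card_product, Finset.card_range, Finset.card_range,
    Finset.card_range]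

theorem natDegree_le_of_mem_nsmul {n : ℕ} {P : Polynomial R}
    (hP : P ∈ n • monomialSet code x ξ d N) : P.natDegree ≤ 2 * N * d := by
  induction n generalizing P with
  | zero =>
    rw [zero_nsmul, Finset.mem_zero] at hP
    simp [hP]
  | succ n ih =>
    rw [succ_nsmul, Finset.mem_add] at hP
    obtain ⟨Q, hQ, T, hT, rfl⟩ := hP
    refine Polynomial.natDegree_add_le_of_degree_le (ih hQ) ?_
    rcases Finset.mem_insert.1 hT with rfl | hT
    · simp
    · obtain ⟨w, hw, rfl⟩ := Finset.mem_image.1 hT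
      refine (Polynomial.natDegree_C_mul_X_pow_le _ _).trans ?_
      have := (Finset.mem_product.1 (Finset.mem_product.1 hw).2).2
      rw [Finset.mem_range] at this
      omega

variable {D : Ultrafilter Nat.Primes}

/-- There is a generator `ε` such that the element `y = ε ^ ((𝔭 - 1) / (s² d))` satisfies no
non-trivial internal polynomial relation with standardly many terms, of degree bounded by a standard
multiple of `d`, whose coefficients are standard polynomials in `x` times powers of `ξ`. -/
theorem exists_generic_generator (x : Fin 2 → ∀ p : Nat.Primes, ZMod p) {d s : Nat.Primes → ℕ}
    (hD : (D : Filter Nat.Primes) ≤ cofinite)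
    (hsd : ∀ᶠ p : Nat.Primes in D, s p ^ 2 * d p ∣ (p : ℕ) - 1) {ξ : ∀ p : Nat.Primes, ZMod p}
    (hξ : ∀ᶠ p in D, IsPrimitiveRoot (ξ p) (d p))
    (hbound : ∀ N : ℕ, ∀ᶠ p in D,
      (N * (d p * (2 * N * d p + 1)) + 1) ^ N * (2 * N * d p) < s p) :
    ∃ ε : ∀ p : Nat.Primes, ZMod p, (∀ p, IsPrimitiveRoot (ε p) ((p : ℕ) - 1)) ∧
      (∀ᶠ p : Nat.Primes in D, ε p ^ (((p : ℕ) - 1) / d p) = ξ p) ∧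
      ∀ {I : Type} (t : Finset I) (P : I → MvPolynomial (Fin 2) ℤ) (e : I → Nat.Primes → ℤ)
        (k : I → Nat.Primes → ℕ) (C : ℕ), (∀ᶠ p in D, ∀ i ∈ t, k i p ≤ C * d p) →
        (∀ᶠ p : Nat.Primes in D, ∑ i ∈ t, MvPolynomial.aeval (fun j => x j p) (P i) * ξ p ^ e i p *
          (ε p ^ (((p : ℕ) - 1) / (s p ^ 2 * d p))) ^ k i p = 0) →
        ∀ᶠ p : Nat.Primes in D, ∑ i ∈ t, Polynomial.C (MvPolynomial.aeval (fun j => x j p) (P i) *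
          ξ p ^ e i p) * Polynomial.X ^ k i p = 0 := by
  have := countable_mvPolynomial 2
  obtain ⟨code, hcode⟩ := exists_surjective_nat (MvPolynomial (Fin 2) ℤ)
  obtain ⟨N, hN, hNb⟩ := exists_infinite_level hD hbound
  have hex : ∀ p : Nat.Primes, ∃ ε : ZMod p, IsPrimitiveRoot ε ((p : ℕ) - 1) ∧
      (s p ^ 2 * d p ∣ (p : ℕ) - 1 → IsPrimitiveRoot (ξ p) (d p) →
      (N p * (d p * (2 * N p * d p + 1)) + 1) ^ N p * (2 * N p * d p) < s p →
      ε ^ (((p : ℕ) - 1) / d p) = ξ p ∧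
      ∀ P ∈ N p • monomialSet code (fun j => x j p) (ξ p) (d p) (N p),
        P ≠ 0 → P.eval (ε ^ (((p : ℕ) - 1) / (s p ^ 2 * d p))) ≠ 0) := by
    intro p
    by_cases h : s p ^ 2 * d p ∣ (p : ℕ) - 1 ∧ IsPrimitiveRoot (ξ p) (d p) ∧
      (N p * (d p * (2 * N p * d p + 1)) + 1) ^ N p * (2 * N p * d p) < s p
    · obtain ⟨ε, h1, h2⟩ := exists_generator_eval_ne_zero p h.1 h.2.1
        (N p • monomialSet code (fun j => x j p) (ξ p) (d p) (N p))
        (fun P hP => natDegree_le_of_mem_nsmul hP) (lt_of_le_of_lt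
          (Nat.mul_le_mul_right _ (Finset.card_nsmul_le.trans
            (Nat.pow_le_pow_left card_monomialSet_le _))) h.2.2)
      exact ⟨ε, h1, fun _ _ _ => h2⟩
    · obtain ⟨g, hg⟩ := exists_isPrimitiveRoot_zmod p
      exact ⟨g, hg, fun h1 h2 h3 => absurd ⟨h1, h2, h3⟩ h⟩
  choose ε hε hε2 using hex
  have hε3 := (hsd.and (hξ.and hNb)).mono fun p h => hε2 p h.1 h.2.1 h.2.2
  refine ⟨ε, hε, hε3.mono fun p h => h.1, ?_⟩
  intro I t P e k C hk hsum
  choose q hq using fun i => hcode (P i)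
  obtain ⟨N₀, hN₀⟩ : ∃ N₀ : ℕ, t.card ≤ N₀ ∧ C ≤ N₀ ∧ ∀ i ∈ t, q i < N₀ := by
    refine ⟨max (max t.card C) (t.sup q + 1), ?_, ?_, fun i hi => ?_⟩
    · omega
    · omega
    · have := Finset.le_sup (f := q) hi
      omega
  filter_upwards [hε3, hk, hsum, hN N₀, hsd, hξ] with p h1 h2 h3 h4 h5 h6
  by_contra hne
  refine h1.2 _ ?_ hne ?_
  · have hd0 : 0 < d p := by
      have h7 : 0 < (p : ℕ) - 1 := by
        have := p.2.one_lt
        omega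
      exact Nat.pos_of_mul_pos_left (Nat.pos_of_dvd_of_pos h5 h7)
    have hd0' : (0 : ℤ) < d p := by exact_mod_cast hd0
    refine Finset.nsmul_subset_nsmul_right (Finset.mem_insert_self _ _) (hN₀.1.trans h4) ?_
    refine sum_mem_card_nsmul fun i hi => ?_
    refine Finset.mem_insert_of_mem (Finset.mem_image.2
      ⟨(q i, (e i p % d p).toNat, k i p), ?_, ?_⟩)
    · have h7 := Int.emod_nonneg (e i p) hd0'.ne'
      have h8 := Int.emod_lt_of_pos (e i p) hd0'
      have h9 : k i p ≤ N p * d p := (h2 i hi).trans (Nat.mul_le_mul_right _ (hN₀.2.1.trans h4))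
      simp only [Finset.mem_product, Finset.mem_range]
      refine ⟨(hN₀.2.2 i hi).trans_le h4, by omega, ?_⟩
      nlinarith
    · have h7 := Int.emod_nonneg (e i p) hd0'.ne'
      have h8 : ξ p ^ (e i p % d p).toNat = ξ p ^ e i p := by
        rw [← zpow_natCast, Int.toNat_of_nonneg h7]
        conv_rhs => rw [← Int.mul_ediv_add_emod (e i p) (d p)]
        rw [zpow_add₀ (h6.ne_zero hd0.ne'), zpow_mul, zpow_natCast, h6.pow_eq_one, one_zpow,
          one_mul]
      rw [hq, h8]
  · rw [Polynomial.eval_finsetSum, ← h3]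
    refine Finset.sum_congr rfl fun i _ => ?_
    rw [Polynomial.eval_mul_X_pow, Polynomial.eval_C]

end GenericGenerator

/-! ### The place on the small unit -/

section SmallUnit

variable {D : Ultrafilter Nat.Primes}

theorem ipow_coe_out (ω : ∀ p : Nat.Primes, ZMod p) (κ : StarZ D) :
    ipow (PF.mk ω : PF D) κ = PF.mk fun p => ω p ^ (Quotient.out κ : Nat.Primes → ℤ) p := by
  conv_lhs => rw [← Quotient.out_eq κ]
  rfl

theorem eventually_out_eq (K : Nat.Primes → ℤ) :
    ∀ᶠ p in D, (Quotient.out (K : StarZ D) : Nat.Primes → ℤ) p = K p :=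
  Germ.coe_eq.1 (Quotient.out_eq (K : StarZ D))

/-- The ring generated by the two elements `x` and the internal powers of `ξ`. -/
noncomputable def powerRing (x : Fin 2 → PF D) {ξ : PF D} (hξ : ξ ≠ 0) : Subring (PF D) :=
  (MonoidAlgebra.liftNCRingHom (MvPolynomial.aeval x : MvPolynomial (Fin 2) ℤ →ₐ[ℤ] PF D).toRingHom
    (ipowHom hξ) fun _ _ => Commute.all _ _).range

theorem mem_powerRing {x : Fin 2 → PF D} {ξ : PF D} {hξ : ξ ≠ 0} {b : PF D} :
    b ∈ powerRing x hξ ↔ ∃ F : MonoidAlgebra (MvPolynomial (Fin 2) ℤ) (Multiplicative (StarZ D)),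
      ∑ g ∈ F.coeff.support, MvPolynomial.aeval x (F.coeff g) * ipow ξ g.toAdd = b := Iff.rfl

theorem mem_powerRing_left (x : Fin 2 → PF D) {ξ : PF D} (hξ : ξ ≠ 0) (i : Fin 2) :
    x i ∈ powerRing x hξ := by
  refine ⟨MonoidAlgebra.single 1 (MvPolynomial.X i), ?_⟩
  refine (MonoidAlgebra.liftNC_single _ _ _ _).trans ?_
  rw [map_one, mul_one]
  exact MvPolynomial.aeval_X x i

theorem mem_powerRing_right (x : Fin 2 → PF D) {ξ : PF D} (hξ : ξ ≠ 0) (κ : StarZ D) :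
    ipow ξ κ ∈ powerRing x hξ := by
  refine ⟨MonoidAlgebra.single (Multiplicative.ofAdd κ) 1, ?_⟩
  refine (MonoidAlgebra.liftNC_single _ _ _ _).trans ?_
  exact (congrArg (· * ipow ξ κ) (map_one (MvPolynomial.aeval x))).trans (one_mul _)

/-- The non-standard integers bounded by standard multiples of `d`. -/
def boundedSubgroup (D : Ultrafilter Nat.Primes) (d : Nat.Primes → ℕ) : AddSubgroup (StarZ D) where
  carrier := {κ | ∃ C : ℕ, ∀ᶠ p in D, |(Quotient.out κ : Nat.Primes → ℤ) p| ≤ C * d p}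
  zero_mem' := ⟨0, (eventually_out_eq fun _ => 0).mono fun p hp => by
    rw [show (0 : StarZ D) = ((fun _ => 0 : Nat.Primes → ℤ) : StarZ D) from rfl, hp]
    simp⟩
  add_mem' := by
    rintro κ κ' ⟨C, hC⟩ ⟨C', hC'⟩
    refine ⟨C + C', ?_⟩
    have h := eventually_out_eq (D := D)
      ((Quotient.out κ : Nat.Primes → ℤ) + (Quotient.out κ' : Nat.Primes → ℤ))
    rw [Germ.coe_add, show ((Quotient.out κ : Nat.Primes → ℤ) : StarZ D) = κ from Quotient.out_eq κ,
      show ((Quotient.out κ' : Nat.Primes → ℤ) : StarZ D) = κ' from Quotient.out_eq κ'] at h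
    filter_upwards [h, hC, hC'] with p h1 h2 h3
    rw [h1, Pi.add_apply]
    push_cast
    have := abs_add_le ((Quotient.out κ : Nat.Primes → ℤ) p) ((Quotient.out κ' : Nat.Primes → ℤ) p)
    linarith
  neg_mem' := by
    rintro κ ⟨C, hC⟩
    refine ⟨C, ?_⟩
    have h := eventually_out_eq (D := D) (-(Quotient.out κ : Nat.Primes → ℤ))
    rw [Germ.coe_neg, show ((Quotient.out κ : Nat.Primes → ℤ) : StarZ D) = κ
      from Quotient.out_eq κ] at h
    filter_upwards [h, hC] with p h1 h2
    rw [h1, Pi.neg_apply, abs_neg]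
    exact h2

theorem coe_mem_boundedSubgroup {d : Nat.Primes → ℕ} {K : Nat.Primes → ℤ} {C : ℕ}
    (h : ∀ᶠ p in D, |K p| ≤ C * d p) : (K : StarZ D) ∈ boundedSubgroup D d :=
  ⟨C, by filter_upwards [h, eventually_out_eq K] with p h1 h2; rwa [h2]⟩

theorem tendsto_limExp {d : Nat.Primes → ℕ} {κ : StarZ D} (h : κ ∈ boundedSubgroup D d) :
    ∃ z, Tendsto (fun p => Complex.exp
      (-(2 * Real.pi * ((Quotient.out κ : Nat.Primes → ℤ) p / d p)))) D (𝓝 z) := by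
  obtain ⟨C, hC⟩ := h
  refine exists_tendsto_of_norm_le (C := Real.exp (2 * Real.pi * C)) ?_
  filter_upwards [hC] with p hp
  generalize (Quotient.out κ : Nat.Primes → ℤ) p = K at hp
  rw [Complex.norm_exp]
  have h1 : (-(2 * Real.pi * ((K : ℂ) / d p))).re = -(2 * Real.pi * ((K : ℝ) / d p)) := by
    have : (-(2 * Real.pi * ((K : ℂ) / d p))) = ((-(2 * Real.pi * ((K : ℝ) / d p)) : ℝ) : ℂ) := by
      push_cast
      rfl
    rw [this, Complex.ofReal_re]
  rw [h1, Real.exp_le_exp, ← mul_neg]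
  refine mul_le_mul_of_nonneg_left ?_ (by positivity)
  refine (neg_le_abs _).trans ?_
  rw [abs_div, Nat.abs_cast]
  have h2 : |(K : ℝ)| ≤ C * d p := by exact_mod_cast hp
  exact div_le_of_le_mul₀ (Nat.cast_nonneg _) (Nat.cast_nonneg _) h2

/-- The character of the bounded non-standard integers that sends `κ` to the limit of
`exp(-2πκ / d)`. -/
noncomputable def limExp (D : Ultrafilter Nat.Primes) (d : Nat.Primes → ℕ) :
    Multiplicative (boundedSubgroup D d) →* ℂ where
  toFun κ := germLim (fun p k => Complex.exp (-(2 * Real.pi * (k / d p))))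
    (κ.toAdd : StarZ D)
  map_one' := by
    refine germLim_coe (K := fun _ => 0) ?_
    simp
  map_mul' := by
    intro κ κ'
    obtain ⟨⟨κ, h⟩, rfl⟩ := Multiplicative.ofAdd.surjective κ
    obtain ⟨⟨κ', h'⟩, rfl⟩ := Multiplicative.ofAdd.surjective κ'
    obtain ⟨z, hz⟩ := tendsto_limExp h
    obtain ⟨z', hz'⟩ := tendsto_limExp h'
    rw [toAdd_mul, toAdd_ofAdd, toAdd_ofAdd, AddSubgroup.coe_add]
    show germLim _ (κ + κ') = germLim _ κ * germLim _ κ'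
    rw [show κ = ((Quotient.out κ : Nat.Primes → ℤ) : StarZ D) from (Quotient.out_eq κ).symm,
      show κ' = ((Quotient.out κ' : Nat.Primes → ℤ) : StarZ D) from (Quotient.out_eq κ').symm,
      germLim_coe hz, germLim_coe hz', ← Germ.coe_add]
    refine germLim_coe ((hz.mul hz').congr fun p => ?_)
    rw [← Complex.exp_add]
    congr 1
    rw [Pi.add_apply]
    push_cast
    ring

theorem limExp_coe {d : Nat.Primes → ℕ} {K : Nat.Primes → ℤ} {z : ℂ}
    (hK : (K : StarZ D) ∈ boundedSubgroup D d)
    (h : Tendsto (fun p => Complex.exp (-(2 * Real.pi * ((K p : ℂ) / d p)))) D (𝓝 z)) :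
    limExp D d (Multiplicative.ofAdd ⟨(K : StarZ D), hK⟩) = z :=
  germLim_coe (u := fun p k => Complex.exp (-(2 * Real.pi * (k / d p)))) h

/-- The powers of `y` with bounded exponents are linearly independent over the ring generated by
`x` and the powers of `ξ`, provided `y` is generic. -/
theorem eq_zero_of_sum_mul_ipow_eq_zero {x : Fin 2 → ∀ p : Nat.Primes, ZMod p}
    {ξ y : ∀ p : Nat.Primes, ZMod p} {d : Nat.Primes → ℕ}
    (hξ : (PF.mk ξ : PF D) ≠ 0) (hy : (PF.mk y : PF D) ≠ 0)
    (hgen : ∀ {I : Type} (t : Finset I) (P : I → MvPolynomial (Fin 2) ℤ)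
      (e : I → Nat.Primes → ℤ) (k : I → Nat.Primes → ℕ) (C : ℕ),
      (∀ᶠ p in D, ∀ i ∈ t, k i p ≤ C * d p) →
      (∀ᶠ p : Nat.Primes in D, ∑ i ∈ t, MvPolynomial.aeval (fun j => x j p) (P i) * ξ p ^ e i p *
        y p ^ k i p = 0) →
      ∀ᶠ p : Nat.Primes in D, ∑ i ∈ t, Polynomial.C (MvPolynomial.aeval (fun j => x j p) (P i) *
        ξ p ^ e i p) * Polynomial.X ^ k i p = 0)
    (t : Finset (StarZ D)) (ht : ∀ κ ∈ t, κ ∈ boundedSubgroup D d) (b : StarZ D → PF D)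
    (hb : ∀ κ ∈ t, b κ ∈ powerRing (fun j => PF.mk (x j)) hξ)
    (hsum : ∑ κ ∈ t, b κ * ipow (PF.mk y) κ = 0) : ∀ κ ∈ t, b κ = 0 := by
  classical
  choose! F hF using fun κ hκ => mem_powerRing.1 (hb κ hκ)
  choose! C hC using ht
  let K : StarZ D → Nat.Primes → ℤ := fun κ => Quotient.out κ
  -- the representatives of the coefficients
  let B : StarZ D → ∀ p : Nat.Primes, ZMod p := fun κ p => ∑ g ∈ (F κ).coeff.support,
    MvPolynomial.aeval (fun j => x j p) ((F κ).coeff g) * ξ p ^ K g.toAdd p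
  have hB : ∀ κ ∈ t, b κ = PF.mk (B κ) := by
    intro κ hκ
    rw [← hF κ hκ]
    simp only [PF.aeval_mk, ipow_coe_out, PF.mk_mul]
    exact PF.sum_mk _ _
  obtain ⟨C₀, hC₀⟩ : ∃ C₀ : ℕ, ∀ κ ∈ t, C κ ≤ C₀ := ⟨t.sup C, fun κ hκ => Finset.le_sup hκ⟩
  have hCt : ∀ᶠ p in D, ∀ κ ∈ t, |K κ p| ≤ C₀ * d p := by
    rw [Filter.eventually_all_finset]
    intro κ hκ
    filter_upwards [hC κ hκ] with p hp
    refine hp.trans (mul_le_mul_of_nonneg_right ?_ (Nat.cast_nonneg _))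
    exact_mod_cast hC₀ κ hκ
  have hK : ∀ᶠ p in D, ∀ κ ∈ t, ∀ κ' ∈ t, K κ p = K κ' p → κ = κ' := by
    rw [Filter.eventually_all_finset]
    intro κ hκ
    rw [Filter.eventually_all_finset]
    intro κ' hκ'
    by_cases h : κ = κ'
    · exact Eventually.of_forall fun p _ => h
    · have h1 : ¬ ∀ᶠ p in D, K κ p = K κ' p := fun h1 => h (by
        rw [← Quotient.out_eq κ, ← Quotient.out_eq κ']
        exact Germ.coe_eq.2 h1)
      filter_upwards [Ultrafilter.eventually_not.2 h1] with p hp h2 using absurd h2 hp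
  -- multiplication by a power of `y` makes the exponents nonnegative
  let k : StarZ D → Nat.Primes → ℕ := fun κ p => (K κ p + C₀ * d p).toNat
  have hkK : ∀ᶠ p in D, ∀ κ ∈ t, (k κ p : ℤ) = K κ p + C₀ * d p := by
    filter_upwards [hCt] with p hp κ hκ
    have := (abs_le.1 (hp κ hκ)).1
    exact Int.toNat_of_nonneg (by linarith)
  have hrel : ∀ᶠ p in D, ∑ κ ∈ t, B κ p * y p ^ k κ p = 0 := by
    have h1 : ∀ᶠ p in D, ∑ κ ∈ t, B κ p * y p ^ K κ p = 0 := by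
      have h2 : (PF.mk fun p => ∑ κ ∈ t, B κ p * y p ^ K κ p : PF D) = PF.mk fun _ => 0 := by
        rw [← PF.sum_mk, ← Finset.sum_congr rfl fun κ hκ => ?_]
        · exact hsum.trans (map_zero (Ideal.Quotient.mk (nullIdeal D))).symm
        · rw [hB κ hκ, ipow_coe_out, PF.mk_mul]
      exact PF.mk_eq_mk.1 h2
    filter_upwards [h1, hkK, PF.mk_ne_zero_iff.1 hy] with p h3 h4 h5
    have h6 : ∑ κ ∈ t, B κ p * y p ^ k κ p
        = (∑ κ ∈ t, B κ p * y p ^ K κ p) * y p ^ ((C₀ : ℤ) * d p) := by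
      rw [Finset.sum_mul]
      refine Finset.sum_congr rfl fun κ hκ => ?_
      rw [mul_assoc, ← zpow_add₀ h5, ← h4 κ hκ, zpow_natCast]
    rw [h6, h3, zero_mul]
  have hpoly := hgen (t.sigma fun κ => (F κ).coeff.support) (fun i => (F i.1).coeff i.2)
    (fun i => K i.2.toAdd) (fun i => k i.1) (2 * C₀) (by
      filter_upwards [hkK, hCt] with p h1 h2 i hi
      have h3 := (Finset.mem_sigma.1 hi).1
      have h4 := (abs_le.1 (h2 _ h3)).2
      have h5 := h1 _ h3
      zify
      linarith) (by
      filter_upwards [hrel] with p hp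
      rw [Finset.sum_sigma, ← hp]
      exact Finset.sum_congr rfl fun κ _ => (Finset.sum_mul (F κ).coeff.support
        (fun g => MvPolynomial.aeval (fun j => x j p) ((F κ).coeff g) * ξ p ^ K g.toAdd p)
        (y p ^ k κ p)).symm)
  intro κ hκ
  rw [hB κ hκ, ← map_zero (Ideal.Quotient.mk (nullIdeal D))]
  refine PF.mk_eq_mk.2 ?_
  filter_upwards [hpoly, hkK, hK] with p h1 h2 h3
  have h4 : (∑ κ' ∈ t, Polynomial.C (B κ' p) * Polynomial.X ^ k κ' p).coeff (k κ p) = B κ p := by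
    rw [Polynomial.finsetSum_coeff, Finset.sum_eq_single κ]
    · simp
    · intro κ' hκ' hne
      rw [Polynomial.coeff_C_mul_X_pow, if_neg]
      intro h
      apply hne
      refine h3 κ' hκ' κ hκ ?_
      have h5 := h2 κ hκ
      have h6 := h2 κ' hκ'
      rw [← h] at h6
      linarith
    · exact fun h => absurd hκ h
  rw [← h4]
  rw [Finset.sum_sigma] at h1
  have h5 : ∑ κ' ∈ t, Polynomial.C (B κ' p) * Polynomial.X ^ k κ' p = 0 := by
    rw [← h1]
    refine Finset.sum_congr rfl fun κ _ => ?_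
    simp only [B, map_sum, Finset.sum_mul]
  rw [h5, Polynomial.coeff_zero]
  rfl

end SmallUnit

/-! ### The generator and the place -/

section CorePlace

variable {D : Ultrafilter Nat.Primes}

/-- A place may be modified in such a way that it keeps its values on the ring generated by `x` and
the powers of `ξ`, and sends the bounded powers of a generic `y` to the limits of real
exponentials. -/
theorem exists_place_limExp {x : Fin 2 → ∀ p : Nat.Primes, ZMod p}
    {ξ y : ∀ p : Nat.Primes, ZMod p} {d : Nat.Primes → ℕ}
    (hξ : (PF.mk ξ : PF D) ≠ 0) (hy : (PF.mk y : PF D) ≠ 0)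
    (hind : ∀ (t : Finset (StarZ D)) (_ : ∀ κ ∈ t, κ ∈ boundedSubgroup D d) (b : StarZ D → PF D)
      (_ : ∀ κ ∈ t, b κ ∈ powerRing (fun j => PF.mk (x j)) hξ)
      (_ : ∑ κ ∈ t, b κ * ipow (PF.mk y) κ = 0), ∀ κ ∈ t, b κ = 0)
    (V : ValuationSubring (PF D)) (f : V →+* ℂ) :
    ∃ (V' : ValuationSubring (PF D)) (f' : V' →+* ℂ), IsLocalHom f' ∧
      (∀ v a, v ∈ powerRing (fun j => PF.mk (x j)) hξ → SendsTo V f v a → SendsTo V' f' v a) ∧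
      ∀ (κ : StarZ D) (hκ : κ ∈ boundedSubgroup D d),
        SendsTo V' f' (ipow (PF.mk y) κ) (limExp D d (Multiplicative.ofAdd ⟨κ, hκ⟩)) := by
  classical
  let A : Subring (PF D) := V.toSubring ⊓ powerRing (fun j => PF.mk (x j)) hξ
  let fA : A →+* ℂ := f.comp (A.subtype.codRestrict V fun v => v.2.1)
  let α : A →+* PF D × ℂ := A.subtype.prod fA
  let β : Multiplicative (boundedSubgroup D d) →* PF D × ℂ :=
    ((ipowHom hy).comp (AddMonoidHom.toMultiplicative (boundedSubgroup D d).subtype)).prod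
      (limExp D d)
  let Φ : MonoidAlgebra A (Multiplicative (boundedSubgroup D d)) →+* PF D × ℂ :=
    MonoidAlgebra.liftNCRingHom α β fun _ _ => Commute.all _ _
  have hΦ : ∀ F, Φ F = ∑ g ∈ F.coeff.support, α (F.coeff g) * β g := fun F => rfl
  -- by linear independence, an element of the group algebra is determined by its value in `F_𝔭`
  have hgraph : IsGraph Φ.range := by
    rintro w ⟨F, hF⟩
    suffices h : F.coeff.support = ∅ by
      rw [hΦ, h, Finset.sum_empty] at hF
      exact (congrArg Prod.snd hF).symm
    rw [Finset.eq_empty_iff_forall_notMem]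
    intro g hg
    let j : Multiplicative (boundedSubgroup D d) ↪ StarZ D :=
      ⟨fun g => (g.toAdd : StarZ D), fun g g' h => Multiplicative.toAdd.injective (Subtype.ext h)⟩
    let b : StarZ D → PF D := fun κ =>
      if h : κ ∈ boundedSubgroup D d then (F.coeff (Multiplicative.ofAdd ⟨κ, h⟩) : PF D) else 0
    have hbj : ∀ g, b (j g) = (F.coeff g : PF D) := fun g => dif_pos g.toAdd.2
    have h0 := hind (F.coeff.support.map j) (fun κ hκ => by
      obtain ⟨g, -, rfl⟩ := Finset.mem_map.1 hκ
      exact g.toAdd.2) b (fun κ hκ => by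
      obtain ⟨g, -, rfl⟩ := Finset.mem_map.1 hκ
      rw [hbj]
      exact (F.coeff g).2.2) (by
      rw [Finset.sum_map]
      have h1 := congrArg Prod.fst hF
      rw [hΦ, Prod.fst_sum] at h1
      rw [← show _ = (0 : PF D) from h1]
      refine Finset.sum_congr rfl fun g _ => ?_
      rw [hbj]
      rfl) (j g) (Finset.mem_map_of_mem j hg)
    rw [hbj] at h0
    exact Finsupp.mem_support_iff.1 hg (Subtype.ext h0)
  obtain ⟨V', f', hf', hV'⟩ := exists_valuationSubring_extension hgraph
  refine ⟨V', f', hf', fun v a hv ⟨hvV, hva⟩ => hV' _ _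
    ⟨MonoidAlgebra.single 1 ⟨v, hvV, hv⟩, ?_⟩, fun κ hκ => hV' _ _
    ⟨MonoidAlgebra.single (Multiplicative.ofAdd ⟨κ, hκ⟩) 1, ?_⟩⟩
  · refine (MonoidAlgebra.liftNC_single _ _ _ _).trans ?_
    rw [map_one, mul_one]
    exact Prod.ext rfl hva
  · refine (MonoidAlgebra.liftNC_single _ _ _ _).trans ?_
    exact (congrArg (· * β _) (map_one α)).trans (one_mul _)

/-- Polynomial expressions of a fixed shape in the order `d ≤ 𝔩²` stay below `ι`. -/
theorem ScaleSeq.eventually_bound {μ ι : Nat.Primes → ℕ} (hs : ScaleSeq D μ ι)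
    {d : Nat.Primes → ℕ} (hd : ∀ᶠ p in D, d p ≤ (μ p ^ 2) ^ 2) (N : ℕ) :
    ∀ᶠ p in D, (N * (d p * (2 * N * d p + 1)) + 1) ^ N * (2 * N * d p) < ι p := by
  filter_upwards [hd, hs.le_l (2 * N + 2), hs.pow_lt (2 * (8 * N + 3))] with p h1 h2 h3
  generalize μ p ^ 2 = l at *
  have hl : 1 ≤ l := by omega
  have h4 : 2 * N * d p ≤ l ^ 3 := by
    calc 2 * N * d p ≤ l * l ^ 2 := Nat.mul_le_mul (by omega) h1
      _ = l ^ 3 := by ring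
  have h5 : 2 * N * d p + 1 ≤ l ^ 4 := by
    calc 2 * N * d p + 1 ≤ l ^ 3 + l ^ 3 := Nat.add_le_add h4 (Nat.one_le_pow _ _ hl)
      _ = 2 * l ^ 3 := by ring
      _ ≤ l * l ^ 3 := Nat.mul_le_mul_right _ (by omega)
      _ = l ^ 4 := by ring
  have h6 : N * (d p * (2 * N * d p + 1)) + 1 ≤ l ^ 8 := by
    calc N * (d p * (2 * N * d p + 1)) + 1 ≤ l * (l ^ 2 * l ^ 4) + l ^ 7 :=
          Nat.add_le_add (Nat.mul_le_mul (by omega) (Nat.mul_le_mul h1 h5))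
            (Nat.one_le_pow _ _ hl)
      _ = 2 * l ^ 7 := by ring
      _ ≤ l * l ^ 7 := Nat.mul_le_mul_right _ (by omega)
      _ = l ^ 8 := by ring
  refine lt_of_pow_lt_pow_left₀ 2 (Nat.zero_le _) (lt_of_le_of_lt ?_ h3)
  rw [mul_comm 2 (8 * N + 3), pow_mul]
  refine Nat.pow_le_pow_left ?_ 2
  calc _ ≤ (l ^ 8) ^ N * l ^ 3 := Nat.mul_le_mul (Nat.pow_le_pow_left h6 N) h4
    _ = l ^ (8 * N + 3) := by rw [← pow_mul, ← pow_add]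

theorem ne_zero_of_isPrimitiveRoot_sub_one {p : Nat.Primes} {ε : ZMod p}
    (h : IsPrimitiveRoot ε ((p : ℕ) - 1)) : ε ≠ 0 :=
  h.ne_zero (Nat.sub_ne_zero_of_lt p.2.one_lt)

/-- A generator of the multiplicative group together with a place that realises the complex
exponential function on both units. -/
structure IsExpPlace (D : Ultrafilter Nat.Primes) (μ ι : Nat.Primes → ℕ)
    (ε : ∀ p : Nat.Primes, ZMod p) (V : ValuationSubring (PF D)) (f : V →+* ℂ) : Prop where
  isLocalHom : IsLocalHom f
  isPrimitiveRoot : ∀ p, IsPrimitiveRoot (ε p) ((p : ℕ) - 1)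
  mu_inv : SendsTo V f (res (natGerm D μ))⁻¹ 0
  iota : SendsTo V f (res (natGerm D ι)) iotaLim
  unitV : ∀ m : ℕ, 0 < m → ∀ (K : Nat.Primes → ℤ) (z : ℂ),
    Tendsto (fun p => Complex.exp (2 * Real.pi * Complex.I * ((K p : ℂ) / (m * μ p ^ 2 : ℕ)))) D
      (𝓝 z) →
    SendsTo V f (PF.mk fun p => (ε p ^ (((p : ℕ) - 1) / (m * μ p ^ 2))) ^ K p) z
  unitU : ∀ m : ℕ, 0 < m → ∀ (K : Nat.Primes → ℤ) (z : ℝ),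
    Tendsto (fun p => (K p : ℝ) / (m * μ p ^ 2 : ℕ)) D (𝓝 z) →
    SendsTo V f (PF.mk fun p => (ε p ^ (((p : ℕ) - 1) / (m * (ι p ^ 2 * μ p ^ 2)))) ^ K p)
      (Complex.exp (-(2 * Real.pi * z)))

/-- The place on the roots of unity is extended to the small unit by means of a generic generator
whose power of order `M𝔩` is the root of unity `ξ` on which the place is already determined. -/
theorem IsScale.exists_isExpPlace (hD : (D : Filter Nat.Primes) ≤ cofinite)
    {μ ι : Nat.Primes → ℕ} {𝔩 𝔦 : StarZ D} (hs : ScaleSeq D μ ι)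
    (h : IsScale D 𝔩 (natGerm D μ) 𝔦 (natGerm D ι)) :
    ∃ (ε : ∀ p : Nat.Primes, ZMod p) (V : ValuationSubring (PF D)) (f : V →+* ℂ),
      IsExpPlace D μ ι ε V f := by
  obtain ⟨ω, V, f, -, hω, hμ, hι, hroots⟩ := h.exists_place_roots hD hs
  -- `M = k!` for an infinite `k` such that `M` divides `𝔩` and `M𝔦𝔩` divides `𝔭 - 1`
  obtain ⟨k, hk, hkd⟩ := exists_infinite_level hD
    (Q := fun N p => N.factorial ∣ μ p ^ 2 ∧ N.factorial * (ι p ^ 2 * μ p ^ 2) ∣ (p : ℕ) - 1)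
    fun N => (hs.dvd_l _ N.factorial_pos).and (hs.dvd_sub_one _ N.factorial_pos)
  obtain ⟨M, hM0, hM, hMl, hMp⟩ : ∃ M : Nat.Primes → ℕ, (∀ p, 0 < M p) ∧
      (∀ m : ℕ, 0 < m → ∀ᶠ p in D, m ∣ M p) ∧ (∀ᶠ p in D, M p ∣ μ p ^ 2) ∧
      ∀ᶠ p : Nat.Primes in D, M p * (ι p ^ 2 * μ p ^ 2) ∣ (p : ℕ) - 1 :=
    ⟨fun p => (k p).factorial, fun p => Nat.factorial_pos _,
      fun m hm => (hk m).mono fun p hp => Nat.dvd_factorial hm hp,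
      hkd.mono fun p hp => hp.1, hkd.mono fun p hp => hp.2⟩
  have hl0 : ∀ p, 0 < μ p ^ 2 := fun p => pow_pos (hs.mu_pos p) 2
  have hi0 : ∀ p, 0 < ι p ^ 2 := fun p => pow_pos (hs.iota_pos p) 2
  obtain ⟨ξ, hξ, hξroots⟩ := hroots.exists_lift hs.le_l hω hM hM0 hMl (by
    filter_upwards [hMp] with p hp
    exact Dvd.dvd.trans ⟨ι p ^ 2, by ring⟩ hp)
  let d : Nat.Primes → ℕ := fun p => M p * μ p ^ 2
  have hd0 : ∀ p, 0 < d p := fun p => Nat.mul_pos (hM0 p) (hl0 p)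
  let x : Fin 2 → ∀ p : Nat.Primes, ZMod p := ![fun p => (μ p : ZMod p)⁻¹, fun p => (ι p : ZMod p)]
  have hdp : ∀ᶠ p : Nat.Primes in D, ι p ^ 2 * d p ∣ (p : ℕ) - 1 := by
    filter_upwards [hMp] with p hp
    convert hp using 1
    simp only [d]
    ring
  obtain ⟨ε, hε, hεξ, hgen⟩ := exists_generic_generator x hD hdp hξ (hs.eventually_bound (by
    filter_upwards [hMl] with p hp
    rw [pow_two (μ p ^ 2)]
    exact Nat.mul_le_mul_right _ (Nat.le_of_dvd (hl0 p) hp)))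
  have hξ0 : (PF.mk ξ : PF D) ≠ 0 := PF.mk_ne_zero_iff.2
    (hξ.mono fun p hp => hp.ne_zero (hd0 p).ne')
  have hε0 : ∀ p, ε p ≠ 0 := fun p => ne_zero_of_isPrimitiveRoot_sub_one (hε p)
  have hy0 : (PF.mk fun p => ε p ^ (((p : ℕ) - 1) / (ι p ^ 2 * d p)) : PF D) ≠ 0 :=
    PF.mk_ne_zero_iff.2 (Eventually.of_forall fun p => pow_ne_zero _ (hε0 p))
  obtain ⟨V', f', hf', hV', hV2⟩ := exists_place_limExp hξ0 hy0
    (eq_zero_of_sum_mul_ipow_eq_zero hξ0 hy0 hgen) V f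
  refine ⟨ε, V', f', hf', hε, hV' _ _ ?_ hμ, hV' _ _ ?_ hι, fun m hm K z hz => ?_,
    fun m hm K z hz => ?_⟩
  · have h1 : (res (natGerm D μ))⁻¹ = (PF.mk (x 0) : PF D) := by
      rw [res_coe, PF.inv_mk]
      exact congrArg PF.mk (funext fun p => congrArg Inv.inv (Int.cast_natCast _))
    rw [h1]
    exact mem_powerRing_left (fun j => PF.mk (x j)) hξ0 0
  · have h1 : res (natGerm D ι) = (PF.mk (x 1) : PF D) := by
      rw [res_coe]
      exact congrArg PF.mk (funext fun p => Int.cast_natCast _)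
    rw [h1]
    exact mem_powerRing_left (fun j => PF.mk (x j)) hξ0 1
  · have h1 := hξroots m hm K z hz
    have h2 : (PF.mk fun p => (ξ p ^ (M p / m)) ^ K p : PF D)
        = ipow (PF.mk ξ) ((fun p => ((M p / m : ℕ) : ℤ) * K p : Nat.Primes → ℤ) : StarZ D) := by
      rw [ipow_mk]
      refine congrArg PF.mk (funext fun p => ?_)
      rw [zpow_mul, zpow_natCast]
    have h3 := hV' _ _ (h2 ▸ mem_powerRing_right _ hξ0 _) h1
    convert h3 using 1
    rw [PF.mk_eq_mk]
    filter_upwards [hM m hm, hεξ, hdp] with p h4 h5 h6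
    rw [← h5, ← pow_mul]
    congr 2
    obtain ⟨u, hu⟩ := h4
    obtain ⟨v, hv⟩ := h6
    have hu0 : 0 < u := Nat.pos_of_ne_zero (by
      rintro rfl
      have := hM0 p
      omega)
    have hd1 := hd0 p
    have hl1 := hl0 p
    rw [hv, hu, Nat.mul_div_cancel_left _ hm]
    have e1 : ι p ^ 2 * d p * v = (m * μ p ^ 2) * (u * ι p ^ 2 * v) := by
      simp only [d, hu]
      ring
    have e2 : ι p ^ 2 * d p * v = d p * (ι p ^ 2 * v) := by ring
    rw [e1, Nat.mul_div_cancel_left _ (Nat.mul_pos hm hl1), ← e1, e2,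
      Nat.mul_div_cancel_left _ hd1]
    ring
  · have hm' : (0 : ℝ) < m := by exact_mod_cast hm
    obtain ⟨C, hC⟩ := exists_nat_gt |z|
    have hb : ∀ᶠ p in D, |(K p : ℝ) / (m * μ p ^ 2 : ℕ)| < C := hz.abs.eventually_lt_const hC
    have hmem : ((fun p => ((M p / m : ℕ) : ℤ) * K p : Nat.Primes → ℤ) : StarZ D)
        ∈ boundedSubgroup D d := by
      refine coe_mem_boundedSubgroup (C := C) ?_
      filter_upwards [hb, hM m hm] with p h1 h2
      obtain ⟨u, hu⟩ := h2
      have h3 : (0 : ℝ) < (m * μ p ^ 2 : ℕ) := by exact_mod_cast Nat.mul_pos hm (hl0 p)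
      rw [abs_div, abs_of_pos h3, div_lt_iff₀ h3] at h1
      have h4 : |K p| ≤ C * (m * μ p ^ 2 : ℕ) := by exact_mod_cast h1.le
      simp only [d]
      rw [hu, Nat.mul_div_cancel_left _ hm, abs_mul, Nat.abs_cast]
      calc (u : ℤ) * |K p| ≤ u * (C * (m * μ p ^ 2 : ℕ)) :=
            mul_le_mul_of_nonneg_left h4 (Nat.cast_nonneg _)
        _ = _ := by
          push_cast
          ring
    have h1 := hV2 _ hmem
    rw [limExp_coe (z := Complex.exp (-(2 * Real.pi * z))) hmem, ipow_mk] at h1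
    · convert h1 using 1
      rw [PF.mk_eq_mk]
      filter_upwards [hM m hm, hdp] with p h4 h6
      rw [zpow_mul, zpow_natCast, ← pow_mul]
      congr 2
      obtain ⟨u, hu⟩ := h4
      obtain ⟨v, hv⟩ := h6
      have hl1 := hl0 p
      have hi1 := hi0 p
      rw [hv, hu, Nat.mul_div_cancel_left _ hm, Nat.mul_div_cancel_left _ (Nat.mul_pos hi1 (hd0 p))]
      have e1 : ι p ^ 2 * d p * v = (m * (ι p ^ 2 * μ p ^ 2)) * (v * u) := by
        simp only [d, hu]
        ring
      rw [e1, Nat.mul_div_cancel_left _ (Nat.mul_pos hm (Nat.mul_pos hi1 hl1))]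
    · have h2 : Tendsto (fun p => (((K p : ℝ) / (m * μ p ^ 2 : ℕ) : ℝ) : ℂ)) D (𝓝 (z : ℂ)) :=
        (Complex.continuous_ofReal.tendsto z).comp hz
      have h3 := (h2.const_mul (2 * Real.pi : ℂ)).neg.cexp
      refine h3.congr' ?_
      filter_upwards [hM m hm] with p h4
      congr 3
      obtain ⟨u, hu⟩ := h4
      have hu0 : (u : ℂ) ≠ 0 := by
        rintro h0
        have := hM0 p
        rw [hu, Nat.cast_eq_zero.1 h0] at this
        omega
      have hl1 : (μ p : ℂ) ≠ 0 := by exact_mod_cast (hs.mu_pos p).ne'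
      have hm1 : (m : ℂ) ≠ 0 := by exact_mod_cast hm.ne'
      simp only [d]
      rw [hu, Nat.mul_div_cancel_left _ hm]
      push_cast
      field_simp

end CorePlace

/-! ### The additive map on the cyclic group -/

section AdditiveMap

variable {D : Ultrafilter Nat.Primes} {μ ι : Nat.Primes → ℕ}

theorem scaled_coe (𝔩 : StarZ D) {q : Nat.Primes → ℚ} {w n : Nat.Primes → ℤ}
    (h : ∀ᶠ p in D, q p * w p = n p) :
    scaled 𝔩 (q : StarQ D) (w : StarZ D) = UGroup.mk 𝔩 (n : StarZ D) := by
  have h1 : (((q : StarQ D) * toQ (w : StarZ D)).map fun q : ℚ => ⌊q⌋) = (n : StarZ D) := by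
    refine Germ.coe_eq.2 (h.mono fun p hp => ?_)
    show ⌊q p * w p⌋ = n p
    rw [hp, Int.floor_intCast]
  rw [scaled, h1]

/-- The product of `K / (m𝔩)` and the large unit is `K` times this number. -/
def stepV (μ : Nat.Primes → ℕ) (m : ℕ) (p : Nat.Primes) : ℕ := ((p : ℕ) - 1) / (m * μ p ^ 2)

/-- The product of `K / (m𝔩)` and the small unit is `K` times this number. -/
def stepU (μ ι : Nat.Primes → ℕ) (m : ℕ) (p : Nat.Primes) : ℕ :=
  ((p : ℕ) - 1) / (m * (ι p ^ 2 * μ p ^ 2))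

theorem ScaleSeq.stepU_mul (hs : ScaleSeq D μ ι) {m : ℕ} (hm : 0 < m) :
    ∀ᶠ p : Nat.Primes in D, (stepU μ ι m p : ℤ) * (m * (ι p ^ 2 * μ p ^ 2)) = ((p : ℕ) : ℤ) - 1 := by
  filter_upwards [hs.dvd_sub_one m hm] with p hp
  rw [← natCast_primes_sub_one]
  exact_mod_cast Nat.div_mul_cancel hp

theorem ScaleSeq.stepV_eq (hs : ScaleSeq D μ ι) {m : ℕ} (hm : 0 < m) :
    ∀ᶠ p in D, stepV μ m p = ι p ^ 2 * stepU μ ι m p := by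
  filter_upwards [hs.dvd_sub_one m hm] with p hp
  obtain ⟨t, ht⟩ := hp
  have h1 : 0 < m * μ p ^ 2 := Nat.mul_pos hm (pow_pos (hs.mu_pos p) 2)
  have h2 : 0 < m * (ι p ^ 2 * μ p ^ 2) :=
    Nat.mul_pos hm (Nat.mul_pos (pow_pos (hs.iota_pos p) 2) (pow_pos (hs.mu_pos p) 2))
  rw [stepV, stepU, ht, Nat.mul_div_cancel_left _ h2,
    show m * (ι p ^ 2 * μ p ^ 2) * t = m * μ p ^ 2 * (ι p ^ 2 * t) by ring,
    Nat.mul_div_cancel_left _ h1]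

theorem ScaleSeq.stepU_eq (hs : ScaleSeq D μ ι) {m n : ℕ} (hm : 0 < m) (hn : 0 < n) :
    ∀ᶠ p in D, stepU μ ι m p = n * stepU μ ι (m * n) p := by
  filter_upwards [hs.dvd_sub_one _ (Nat.mul_pos hm hn)] with p hp
  obtain ⟨t, ht⟩ := hp
  have h0 : 0 < ι p ^ 2 * μ p ^ 2 :=
    Nat.mul_pos (pow_pos (hs.iota_pos p) 2) (pow_pos (hs.mu_pos p) 2)
  rw [stepU, stepU, ht, Nat.mul_div_cancel_left _ (Nat.mul_pos (Nat.mul_pos hm hn) h0),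
    show m * n * (ι p ^ 2 * μ p ^ 2) * t = m * (ι p ^ 2 * μ p ^ 2) * (n * t) by ring,
    Nat.mul_div_cancel_left _ (Nat.mul_pos hm h0)]

/-- The non-standard integer `n` represents an element `(K / (m𝔩))𝐮 + (K' / (m𝔩))𝐯` of the group, and
the coefficients have the standard parts `a` and `b`. -/
def HasCoordinates (D : Ultrafilter Nat.Primes) (μ ι : Nat.Primes → ℕ)
    (x : UGroup D (natGerm D fun p => μ p ^ 2)) (a b : ℝ) : Prop :=
  ∃ (m : ℕ) (K K' : Nat.Primes → ℤ), 0 < m ∧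
    Tendsto (fun p => (K p : ℝ) / (m * μ p ^ 2 : ℕ)) D (𝓝 a) ∧
    Tendsto (fun p => (K' p : ℝ) / (m * μ p ^ 2 : ℕ)) D (𝓝 b) ∧
    x = UGroup.mk _ ((fun p => K p * stepU μ ι m p + K' p * stepV μ m p : Nat.Primes → ℤ) : StarZ D)

theorem hasCoordinates_zero : HasCoordinates D μ ι 0 0 0 := by
  refine ⟨1, fun _ => 0, fun _ => 0, one_pos, by simp, by simp, ?_⟩
  rw [show ((fun p => 0 * (stepU μ ι 1 p : ℤ) + 0 * (stepV μ 1 p : ℤ) : Nat.Primes → ℤ) : StarZ D)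
    = 0 from Germ.coe_eq.2 (Eventually.of_forall fun p => by simp)]
  exact (map_zero (Ideal.Quotient.mk _)).symm

theorem HasCoordinates.neg {x : UGroup D (natGerm D fun p => μ p ^ 2)} {a b : ℝ}
    (hx : HasCoordinates D μ ι x a b) : HasCoordinates D μ ι (-x) (-a) (-b) := by
  obtain ⟨m, K, K', hm, hK, hK', rfl⟩ := hx
  refine ⟨m, fun p => -K p, fun p => -K' p, hm, ?_, ?_, ?_⟩
  · exact hK.neg.congr fun p => by push_cast; ring
  · exact hK'.neg.congr fun p => by push_cast; ring
  · rw [UGroup.mk, UGroup.mk, ← map_neg, ← Germ.coe_neg]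
    congr 3
    funext p
    simp only [Pi.neg_apply]
    ring

theorem HasCoordinates.add (hs : ScaleSeq D μ ι) {x y : UGroup D (natGerm D fun p => μ p ^ 2)}
    {a b a' b' : ℝ} (hx : HasCoordinates D μ ι x a b) (hy : HasCoordinates D μ ι y a' b') :
    HasCoordinates D μ ι (x + y) (a + a') (b + b') := by
  obtain ⟨m, K, K', hm, hK, hK', rfl⟩ := hx
  obtain ⟨n, L, L', hn, hL, hL', rfl⟩ := hy
  have hlim : ∀ {K L : Nat.Primes → ℤ} {a a' : ℝ},
      Tendsto (fun p => (K p : ℝ) / (m * μ p ^ 2 : ℕ)) D (𝓝 a) →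
      Tendsto (fun p => (L p : ℝ) / (n * μ p ^ 2 : ℕ)) D (𝓝 a') →
      Tendsto (fun p => ((n * K p + m * L p : ℤ) : ℝ) / (m * n * μ p ^ 2 : ℕ)) D
        (𝓝 (a + a')) := by
    intro K L a a' h h'
    refine (h.add h').congr fun p => ?_
    have h1 : (μ p : ℝ) ≠ 0 := by exact_mod_cast (hs.mu_pos p).ne'
    have h2 : (m : ℝ) ≠ 0 := by exact_mod_cast hm.ne'
    have h3 : (n : ℝ) ≠ 0 := by exact_mod_cast hn.ne'
    push_cast
    field_simp
  refine ⟨m * n, fun p => n * K p + m * L p, fun p => n * K' p + m * L' p, Nat.mul_pos hm hn,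
    hlim hK hL, hlim hK' hL', ?_⟩
  rw [UGroup.mk, UGroup.mk, UGroup.mk, ← map_add, ← Germ.coe_add]
  refine congrArg _ (Germ.coe_eq.2 ?_)
  filter_upwards [hs.stepU_eq hm hn, hs.stepU_eq hn hm, hs.stepV_eq hm, hs.stepV_eq hn,
    hs.stepV_eq (Nat.mul_pos hm hn)] with p h1 h2 h3 h4 h5
  rw [mul_comm n m] at h2
  simp only [Pi.add_apply]
  rw [h3, h4, h5, h1, h2]
  push_cast
  ring

/-- The coordinates of `0` vanish, because the two units are far apart. -/
theorem HasCoordinates.eq_zero (hs : ScaleSeq D μ ι) {a b : ℝ}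
    (h : HasCoordinates D μ ι 0 a b) : a = 0 ∧ b = 0 := by
  obtain ⟨m, K, K', hm, hK, hK', hx⟩ := h
  obtain ⟨C, hC⟩ := exists_nat_gt (max |a| |b|)
  have hdvd : ∀ᶠ p : Nat.Primes in D, (((p : ℕ) : ℤ) - 1) * (μ p ^ 2 : ℕ) ∣
      K p * stepU μ ι m p + K' p * stepV μ m p := by
    have h1 := Ideal.Quotient.eq_zero_iff_mem.1 hx.symm
    rw [Ideal.mem_span_singleton] at h1
    exact coe_dvd_coe.1 h1
  have hbound : ∀ {K : Nat.Primes → ℤ} {a : ℝ}, |a| < C →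
      Tendsto (fun p => (K p : ℝ) / (m * μ p ^ 2 : ℕ)) D (𝓝 a) →
      ∀ᶠ p in D, |K p| < C * (m * μ p ^ 2) := by
    intro K a ha h
    filter_upwards [h.abs.eventually_lt_const ha] with p hp
    have h3 : (0 : ℝ) < (m * μ p ^ 2 : ℕ) := by
      exact_mod_cast Nat.mul_pos hm (pow_pos (hs.mu_pos p) 2)
    rw [abs_div, abs_of_pos h3, div_lt_iff₀ h3] at hp
    exact_mod_cast hp
  have hzero : ∀ᶠ p in D, K p = 0 ∧ K' p = 0 := by
    filter_upwards [hdvd, hbound ((le_max_left _ _).trans_lt hC) hK,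
      hbound ((le_max_right _ _).trans_lt hC) hK', hs.stepU_mul hm, hs.stepV_eq hm,
      hs.le_l (C * m), hs.pow_lt 2, hs.le_l C] with p h1 h2 h3 h4 h5 h6 h7 h8
    have hl : (0 : ℤ) < μ p ^ 2 := by exact_mod_cast pow_pos (hs.mu_pos p) 2
    have hi : (0 : ℤ) < ι p ^ 2 := by exact_mod_cast pow_pos (hs.iota_pos p) 2
    have hm' : (0 : ℤ) < m := by exact_mod_cast hm
    have hU : (stepU μ ι m p : ℤ) ≠ 0 := by
      intro h0
      rw [h0, zero_mul] at h4
      have := p.2.one_lt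
      omega
    rw [← h4, h5] at h1
    obtain ⟨t, ht⟩ := h1
    push_cast at ht
    have e : K p + K' p * ι p ^ 2 = ι p ^ 2 * (m * (μ p ^ 2) ^ 2 * t) := by
      apply mul_left_cancel₀ hU
      linear_combination ht
    have h6' : (C : ℤ) * m ≤ μ p ^ 2 := by exact_mod_cast h6
    have h7' : ((μ p : ℤ) ^ 2) ^ 2 < ι p ^ 2 := by exact_mod_cast h7
    have h8' : (C : ℤ) ≤ μ p ^ 2 := by exact_mod_cast h8
    -- `|K|` is below `𝔦`, which divides it
    have hK0 : K p = 0 := by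
      refine Int.eq_zero_of_abs_lt_dvd (m := (ι p : ℤ) ^ 2)
        ⟨m * (μ p ^ 2) ^ 2 * t - K' p, by linear_combination e⟩ (h2.trans_le ?_)
      nlinarith
    refine ⟨hK0, ?_⟩
    rw [hK0] at e
    have e2 : K' p = m * (μ p ^ 2) ^ 2 * t := by
      apply mul_left_cancel₀ hi.ne'
      linear_combination e
    refine Int.eq_zero_of_abs_lt_dvd ⟨t, e2⟩ (h3.trans_le ?_)
    have : (C : ℤ) * (m * μ p ^ 2) = m * μ p ^ 2 * C := by ring
    rw [this]
    have : (m : ℤ) * (μ p ^ 2) ^ 2 = m * μ p ^ 2 * μ p ^ 2 := by ring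
    rw [this]
    exact mul_le_mul_of_nonneg_left h8' (by positivity)
  refine ⟨tendsto_nhds_unique hK (tendsto_const_nhds.congr' (hzero.mono fun p hp => ?_)),
    tendsto_nhds_unique hK' (tendsto_const_nhds.congr' (hzero.mono fun p hp => ?_))⟩
  · simp [hp.1]
  · simp [hp.2]

theorem HasCoordinates.unique (hs : ScaleSeq D μ ι) {x : UGroup D (natGerm D fun p => μ p ^ 2)}
    {a b a' b' : ℝ} (hx : HasCoordinates D μ ι x a b) (hx' : HasCoordinates D μ ι x a' b') :
    a = a' ∧ b = b' := by
  have h := hx.add hs hx'.neg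
  rw [add_neg_cancel] at h
  have := h.eq_zero hs
  exact ⟨by linarith, by linarith⟩

/-- The generator of the group has no coordinates: all elements with coordinates are even. -/
theorem not_hasCoordinates_one (hs : ScaleSeq D μ ι) {a b : ℝ} :
    ¬ HasCoordinates D μ ι (UGroup.mk _ 1) a b := by
  rintro ⟨m, K, K', hm, -, -, hx⟩
  rw [UGroup.mk, Ideal.Quotient.eq, Ideal.mem_span_singleton] at hx
  have hdvd : ∀ᶠ p : Nat.Primes in D, (((p : ℕ) : ℤ) - 1) * (μ p ^ 2 : ℕ) ∣
      1 - (K p * stepU μ ι m p + K' p * stepV μ m p) := coe_dvd_coe.1 hx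
  obtain ⟨p, h1, h2, h3, h4⟩ := (hdvd.and ((hs.stepU_eq hm two_pos).and
    ((hs.stepV_eq hm).and (hs.dvd_l 2 two_pos)))).exists
  obtain ⟨t, ht⟩ := h1
  obtain ⟨u, hu⟩ := h4
  rw [h3, h2, hu] at ht
  push_cast at ht
  have : (1 : ℤ) = 2 * ((((p : ℕ) : ℤ) - 1) * u * t + K p * stepU μ ι (m * 2) p +
      K' p * (ι p ^ 2 * stepU μ ι (m * 2) p)) := by linear_combination ht
  omega

/-- The complex number with the coordinates `a` and `b` with respect to the two units. -/
noncomputable def coordinateValue (a b : ℝ) : ℂ := -(2 * Real.pi * a) + 2 * Real.pi * Complex.I * b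

/-- The map of the group to `ℂ ∪ {∞}` that is given by the coordinates. -/
noncomputable def limU (D : Ultrafilter Nat.Primes) (μ ι : Nat.Primes → ℕ)
    (x : UGroup D (natGerm D fun p => μ p ^ 2)) : OnePoint ℂ :=
  open Classical in
  if h : ∃ w : ℝ × ℝ, HasCoordinates D μ ι x w.1 w.2
  then (coordinateValue h.choose.1 h.choose.2 : ℂ) else OnePoint.infty

theorem HasCoordinates.limU_eq (hs : ScaleSeq D μ ι)
    {x : UGroup D (natGerm D fun p => μ p ^ 2)} {a b : ℝ} (hx : HasCoordinates D μ ι x a b) :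
    limU D μ ι x = (coordinateValue a b : ℂ) := by
  have h : ∃ w : ℝ × ℝ, HasCoordinates D μ ι x w.1 w.2 := ⟨(a, b), hx⟩
  rw [limU, dif_pos h]
  obtain ⟨h1, h2⟩ := h.choose_spec.unique hs hx
  rw [h1, h2]

theorem limU_eq_coe (hs : ScaleSeq D μ ι) {x : UGroup D (natGerm D fun p => μ p ^ 2)} {z : ℂ}
    (hx : limU D μ ι x = (z : OnePoint ℂ)) :
    ∃ a b, HasCoordinates D μ ι x a b ∧ z = coordinateValue a b := by
  by_cases h : ∃ w : ℝ × ℝ, HasCoordinates D μ ι x w.1 w.2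
  · obtain ⟨⟨a, b⟩, h⟩ := h
    rw [h.limU_eq hs] at hx
    exact ⟨a, b, h, (OnePoint.coe_injective hx).symm⟩
  · rw [limU, dif_neg h] at hx
    exact absurd hx (OnePoint.infty_ne_coe z)

theorem limU_eq_infty (hs : ScaleSeq D μ ι) {x : UGroup D (natGerm D fun p => μ p ^ 2)} :
    limU D μ ι x = OnePoint.infty ↔ ∀ a b, ¬ HasCoordinates D μ ι x a b := by
  constructor
  · intro hx a b h
    rw [h.limU_eq hs] at hx
    exact OnePoint.coe_ne_infty _ hx
  · intro h
    rw [limU, dif_neg]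
    rintro ⟨w, hw⟩
    exact h _ _ hw

theorem coordinateValue_add (a b a' b' : ℝ) :
    coordinateValue (a + a') (b + b') = coordinateValue a b + coordinateValue a' b' := by
  simp only [coordinateValue]
  push_cast
  ring

theorem isAddPlace_limU (hs : ScaleSeq D μ ι) : IsAddPlace (limU D μ ι) where
  map_zero := by
    rw [hasCoordinates_zero.limU_eq hs]
    simp [coordinateValue]
  map_add := by
    intro x y z w hx hy
    obtain ⟨a, b, h, rfl⟩ := limU_eq_coe hs hx
    obtain ⟨a', b', h', rfl⟩ := limU_eq_coe hs hy
    rw [(h.add hs h').limU_eq hs, coordinateValue_add]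
  map_add_infty := by
    intro x y w hx hy
    obtain ⟨a', b', h', rfl⟩ := limU_eq_coe hs hy
    rw [limU_eq_infty hs] at hx ⊢
    intro a b h
    have := h.add hs h'.neg
    rw [add_neg_cancel_right] at this
    exact hx _ _ this

/-- Every real number is the standard part of a quotient `K / 𝔩`. -/
theorem ScaleSeq.exists_tendsto (hs : ScaleSeq D μ ι) (a : ℝ) :
    ∃ K : Nat.Primes → ℤ, Tendsto (fun p => (K p : ℝ) / (1 * μ p ^ 2 : ℕ)) D (𝓝 a) := by
  refine ⟨fun p => ⌊a * (1 * μ p ^ 2 : ℕ)⌋, ?_⟩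
  have hl : Tendsto (fun p => 1 * μ p ^ 2) D atTop := by
    simp only [one_mul]
    exact tendsto_atTop.2 hs.le_l
  have h0 : Tendsto (fun p => a - 1 / ((1 * μ p ^ 2 : ℕ) : ℝ)) D (𝓝 a) := by
    have := ((tendsto_const_div_atTop_nhds_zero_nat (1 : ℝ)).comp hl).const_sub a
    simpa using this
  have hpos : ∀ p, (0 : ℝ) < (1 * μ p ^ 2 : ℕ) := fun p => by
    exact_mod_cast Nat.mul_pos one_pos (pow_pos (hs.mu_pos p) 2)
  refine tendsto_of_tendsto_of_tendsto_of_le_of_le h0 tendsto_const_nhds (fun p => ?_) fun p => ?_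
  · show a - 1 / _ ≤ _ / _
    rw [le_div_iff₀ (hpos p), sub_mul, one_div_mul_cancel (hpos p).ne']
    exact (Int.sub_one_lt_floor _).le
  · show _ / _ ≤ a
    rw [div_le_iff₀ (hpos p)]
    exact Int.floor_le _

theorem surjective_limU (hs : ScaleSeq D μ ι) : Function.Surjective (limU D μ ι) := by
  intro z
  induction z using OnePoint.rec with
  | infty => exact ⟨UGroup.mk _ 1, (limU_eq_infty hs).2 fun a b => not_hasCoordinates_one hs⟩
  | coe z =>
    obtain ⟨K, hK⟩ := hs.exists_tendsto (-(z.re / (2 * Real.pi)))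
    obtain ⟨K', hK'⟩ := hs.exists_tendsto (z.im / (2 * Real.pi))
    have h : HasCoordinates D μ ι _ _ _ := ⟨1, K, K', one_pos, hK, hK', rfl⟩
    refine ⟨_, (h.limU_eq hs).trans (congrArg _ ?_)⟩
    have hpi : (Real.pi : ℂ) ≠ 0 := by exact_mod_cast Real.pi_ne_zero
    rw [coordinateValue]
    push_cast
    conv_rhs => rw [← Complex.re_add_im z]
    field_simp

/-! ### The two lines -/

theorem natGerm_mul (m : ℕ) (f : Nat.Primes → ℕ) :
    (m : StarZ D) * natGerm D f = ((fun p => ((m * f p : ℕ) : ℤ) : Nat.Primes → ℤ) : StarZ D) := by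
  rw [show (m : StarZ D) = ((fun _ => (m : ℤ) : Nat.Primes → ℤ) : StarZ D) from rfl, natGerm,
    ← Germ.coe_mul]
  refine congrArg _ (funext fun p => ?_)
  simp

theorem scaled_eq_step (hs : ScaleSeq D μ ι) {w : Nat.Primes → ℤ} {step : ℕ → Nat.Primes → ℕ}
    (hw : ∀ m, 0 < m → ∀ᶠ p in D, (step m p : ℤ) * (m * μ p ^ 2) = w p) (m : ℕ)
    (K : Nat.Primes → ℤ) (hm : 0 < m) :
    scaled (natGerm D fun p => μ p ^ 2)
        (toQ (K : StarZ D) / ((m : StarQ D) * toQ (natGerm D fun p => μ p ^ 2))) (w : StarZ D)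
      = UGroup.mk _ ((fun p => K p * step m p : Nat.Primes → ℤ) : StarZ D) := by
  refine scaled_coe (q := fun p => (K p : ℚ) / (m * ((μ p ^ 2 : ℕ) : ℤ))) _ ?_
  filter_upwards [hw m hm] with p hp
  have h1 : (μ p : ℚ) ≠ 0 := by exact_mod_cast (hs.mu_pos p).ne'
  have h2 : (m : ℚ) ≠ 0 := by exact_mod_cast hm.ne'
  rw [← hp]
  push_cast
  field_simp

/-- The elements of a line are the multiples of the steps `w / (m𝔩)` whose coefficients `K` are such
that `K / (m𝔩)` has a standard part. -/
theorem mem_scaleLine (hs : ScaleSeq D μ ι) {w : Nat.Primes → ℤ} {step : ℕ → Nat.Primes → ℕ}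
    (hw : ∀ m, 0 < m → ∀ᶠ p in D, (step m p : ℤ) * (m * μ p ^ 2) = w p)
    {x : UGroup D (natGerm D fun p => μ p ^ 2)} :
    x ∈ scaleLine (natGerm D fun p => μ p ^ 2) (w : StarZ D) ↔
      ∃ (m : ℕ) (K : Nat.Primes → ℤ) (a : ℝ), 0 < m ∧
        Tendsto (fun p => (K p : ℝ) / (m * μ p ^ 2 : ℕ)) D (𝓝 a) ∧
        x = UGroup.mk _ ((fun p => K p * step m p : Nat.Primes → ℤ) : StarZ D) := by
  have hsc := fun m K hm => scaled_eq_step hs hw m K hm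
  constructor
  · rintro ⟨K, l, m, hl0, hm, h1, h2, rfl⟩
    induction K using Germ.inductionOn with | h K => ?_
    rw [natGerm_mul] at h1 h2
    have h1' : ∀ᶠ p in D, -((l * μ p ^ 2 : ℕ) : ℤ) ≤ 2 * K p := Germ.coe_le.1 h1
    have h2' : ∀ᶠ p in D, 2 * K p ≤ ((l * μ p ^ 2 : ℕ) : ℤ) := Germ.coe_le.1 h2
    obtain ⟨a, ha⟩ := exists_tendsto_real_of_abs_le (D := D)
      (u := fun p => (K p : ℝ) / (m * μ p ^ 2 : ℕ)) (C := l) (by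
        filter_upwards [h1', h2'] with p h3 h4
        have h5 : (0 : ℝ) < (m * μ p ^ 2 : ℕ) := by
          exact_mod_cast Nat.mul_pos hm (pow_pos (hs.mu_pos p) 2)
        rw [abs_div, abs_of_pos h5, div_le_iff₀ h5]
        have h6 : |K p| ≤ l * (m * μ p ^ 2 : ℕ) := by
          have h7 : ((l * μ p ^ 2 : ℕ) : ℤ) ≤ l * (m * μ p ^ 2 : ℕ) := by
            have : l * μ p ^ 2 ≤ l * (m * μ p ^ 2) :=
              Nat.mul_le_mul_left _ (Nat.le_mul_of_pos_left _ hm)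
            exact_mod_cast this
          have h8 : (0 : ℤ) ≤ ((l * μ p ^ 2 : ℕ) : ℤ) := Nat.cast_nonneg _
          exact (abs_le.2 ⟨by omega, by omega⟩).trans h7
        exact_mod_cast h6)
    exact ⟨m, K, a, hm, ha, hsc m K hm⟩
  · rintro ⟨m, K, a, hm, ha, rfl⟩
    obtain ⟨C, hC⟩ := exists_nat_gt |a|
    have hb : ∀ᶠ p in D, 2 * |K p| ≤ ((2 * C * m * μ p ^ 2 : ℕ) : ℤ) := by
      filter_upwards [ha.abs.eventually_lt_const hC] with p hp
      have h5 : (0 : ℝ) < (m * μ p ^ 2 : ℕ) := by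
        exact_mod_cast Nat.mul_pos hm (pow_pos (hs.mu_pos p) 2)
      rw [abs_div, abs_of_pos h5, div_lt_iff₀ h5] at hp
      have h6 : |K p| < C * (m * μ p ^ 2 : ℕ) := by exact_mod_cast hp
      push_cast at h6 ⊢
      linarith
    have hC0 : 0 < C := by
      have : (0 : ℝ) < C := (abs_nonneg a).trans_lt hC
      exact_mod_cast this
    refine ⟨(K : StarZ D), 2 * C * m, m, by positivity, hm, ?_, ?_, (hsc m K hm).symm⟩
    · rw [natGerm_mul]
      refine Germ.coe_le.2 (hb.mono fun p hp => ?_)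
      show -((2 * C * m * μ p ^ 2 : ℕ) : ℤ) ≤ 2 * K p
      have := neg_abs_le (K p)
      linarith
    · rw [natGerm_mul]
      refine Germ.coe_le.2 (hb.mono fun p hp => ?_)
      show 2 * K p ≤ ((2 * C * m * μ p ^ 2 : ℕ) : ℤ)
      have := le_abs_self (K p)
      linarith

end AdditiveMap

/-! ### Quadratic sums -/

section QuadraticSum

variable {D : Ultrafilter Nat.Primes}

/-- The internal sum of `ε ^ (a n² w / (2𝔩))` over an interval of length `t² / a`, for a rational
square `a = (r / s)²`; here `t² = c𝔩` and `w = (𝔭 - 1) / c`. -/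
theorem exists_isInternalSum {l c t : Nat.Primes → ℕ} {ε : ∀ p : Nat.Primes, ZMod p}
    (hε : ∀ p, IsPrimitiveRoot (ε p) ((p : ℕ) - 1)) {E : (PF D)ˣ} (hE : (E : PF D) = PF.mk ε)
    (hl : ∀ p, 0 < l p) (hc : ∀ p, 0 < c p) (ht : ∀ p, t p ^ 2 = c p * l p)
    (hdvd : ∀ m : ℕ, 0 < m → ∀ᶠ p : Nat.Primes in D, m * t p ^ 2 ∣ (p : ℕ) - 1)
    (hdiv : ∀ m : ℕ, 0 < m → ∀ᶠ p in D, m ∣ t p) {w : Nat.Primes → ℤ}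
    (hw : ∀ᶠ p : Nat.Primes in D, w p * c p = ((p : ℕ) : ℤ) - 1) {r s : ℕ} (hr : 0 < r)
    (hs : 0 < s) :
    ∃ S : PF D, IsInternalSum
        (fun n => expP E (scaled (natGerm D l)
          (((((r : ℚ) / s) ^ 2 : ℚ) : StarQ D) * (toQ n ^ 2 / (2 * toQ (natGerm D l)))) (w : StarZ D)))
        (-((fun p => (t p : ℚ) ^ 2 / (2 * ((r : ℚ) / s) ^ 2) : Nat.Primes → ℚ) : StarQ D))
        ((fun p => (t p : ℚ) ^ 2 / (2 * ((r : ℚ) / s) ^ 2) : Nat.Primes → ℚ) : StarQ D) S ∧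
      (r : PF D) * S = (s : PF D) * res (natGerm D t) * PF.mk fun p => ε p ^ (((p : ℕ) - 1) / 8) := by
  let A : Nat.Primes → ℚ := fun p => (t p : ℚ) ^ 2 / (2 * ((r : ℚ) / s) ^ 2)
  let g : ∀ p : Nat.Primes, ℤ → ZMod p := fun p n =>
    ε p ^ ⌊((r : ℚ) / s) ^ 2 * ((n : ℚ) ^ 2 / (2 * (l p : ℤ))) * w p⌋
  refine ⟨PF.mk fun p => ∑ n ∈ Finset.Ico ⌈-A p⌉ ⌈A p⌉, g p n,
    ⟨g, fun p => -A p, A, rfl, rfl, fun n => ?_, rfl⟩, ?_⟩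
  · show ipow (E : PF D) _ = _
    rw [hE, ← StarQ.coe_const]
    rfl
  -- the sum is the quadratic Gauss sum for the primitive root of unity `ε ^ q` of order `8N²`
  rw [res_coe, ← PF.mk_natCast r, ← PF.mk_natCast s, PF.mk_mul, PF.mk_mul, PF.mk_mul, PF.mk_eq_mk]
  filter_upwards [hdvd (2 * s ^ 2) (by positivity), hdiv (2 * r) (by positivity), hw]
    with p h1 h2 h3
  obtain ⟨u, hu⟩ := h2
  have hp1 : 0 < (p : ℕ) - 1 := by
    have := p.2.one_lt
    omega
  have ht0 : 0 < t p := by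
    refine Nat.pos_of_ne_zero fun h0 => ?_
    have h4 := ht p
    rw [h0] at h4
    have := Nat.mul_pos (hc p) (hl p)
    omega
  have hu0 : 0 < u := Nat.pos_of_ne_zero fun h0 => by simp [h0] at hu; omega
  -- the number `N` such that the interval is `[-2N², 2N²)`
  obtain ⟨N, hN⟩ : ∃ N, N = u * s := ⟨_, rfl⟩
  have hN0 : 0 < N := hN ▸ Nat.mul_pos hu0 hs
  have hNt : 2 * N * r = t p * s := by
    rw [hN, hu]
    ring
  have h8 : 8 * N ^ 2 ∣ (p : ℕ) - 1 := by
    refine Dvd.dvd.trans ⟨r ^ 2, ?_⟩ h1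
    calc 2 * s ^ 2 * t p ^ 2 = 2 * (t p * s) ^ 2 := by ring
      _ = 2 * (2 * N * r) ^ 2 := by rw [hNt]
      _ = 8 * N ^ 2 * r ^ 2 := by ring
  obtain ⟨q, hq⟩ := h8
  have h8N : 0 < 8 * N ^ 2 := by positivity
  have hrQ : (r : ℚ) ≠ 0 := by exact_mod_cast hr.ne'
  have hsQ : (s : ℚ) ≠ 0 := by exact_mod_cast hs.ne'
  have hlQ : (l p : ℚ) ≠ 0 := by exact_mod_cast (hl p).ne'
  have hcQ : (c p : ℚ) ≠ 0 := by exact_mod_cast (hc p).ne'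
  have hNQ : 2 * (N : ℚ) * r = t p * s := by exact_mod_cast hNt
  have htQ : (t p : ℚ) ^ 2 = c p * l p := by exact_mod_cast ht p
  have hA : A p = ((2 * (N : ℤ) ^ 2 : ℤ) : ℚ) := by
    simp only [A]
    push_cast
    rw [div_eq_iff (by positivity), div_pow]
    field_simp
    linear_combination -(2 * (N : ℚ) * r + t p * s) * hNQ
  have hζ : IsPrimitiveRoot (ε p ^ q) (8 * N ^ 2) := (hε p).pow hp1 (by rw [hq, mul_comm])
  have hwQ : (w p : ℚ) * c p = 8 * N ^ 2 * q := by
    have h4 : w p * c p = ((8 * N ^ 2 * q : ℕ) : ℤ) := by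
      rw [h3, ← natCast_primes_sub_one, hq]
    exact_mod_cast h4
  have hg : ∀ n : ℤ, g p n = (ε p ^ q) ^ (n ^ 2) := by
    intro n
    have h5 : ((r : ℚ) / s) ^ 2 * ((n : ℚ) ^ 2 / (2 * (l p : ℤ))) * w p
        = ((q * n ^ 2 : ℤ) : ℚ) := by
      push_cast
      rw [div_pow]
      field_simp
      apply mul_left_cancel₀ hcQ
      linear_combination (r : ℚ) ^ 2 * n ^ 2 * hwQ
        + 2 * (n : ℚ) ^ 2 * q * (2 * (N : ℚ) * r + t p * s) * hNQ
        + 2 * (n : ℚ) ^ 2 * q * s ^ 2 * htQ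
    simp only [g]
    rw [h5, Int.floor_intCast, zpow_mul, zpow_natCast]
  have hceil : ⌈-A p⌉ = -(2 * (N : ℤ) ^ 2) := by
    rw [hA, ← Int.cast_neg, Int.ceil_intCast]
  rw [hceil, hA, Int.ceil_intCast, Finset.sum_congr rfl fun n _ => hg n, sum_Ico_zpow_sq hN0 hζ,
    hq, show 8 * N ^ 2 * q = 8 * (q * N ^ 2) by ring, Nat.mul_div_cancel_left _ (by norm_num),
    pow_mul, ← mul_assoc]
  congr 1
  have h6 : ((2 * N * r : ℕ) : ZMod p) = ((t p * s : ℕ) : ZMod p) := by rw [hNt]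
  push_cast at h6 ⊢
  linear_combination h6

end QuadraticSum

/-! ### The values of the place -/

section Values

variable {D : Ultrafilter Nat.Primes} {μ ι : Nat.Primes → ℕ} {ε : ∀ p : Nat.Primes, ZMod p}
  {V : ValuationSubring (PF D)} {f : V →+* ℂ} {E : (PF D)ˣ}

theorem isPseudoGenerator_of_isPrimitiveRoot (hε : ∀ p, IsPrimitiveRoot (ε p) ((p : ℕ) - 1))
    (hE : (E : PF D) = PF.mk ε) : IsPseudoGenerator E := by
  intro x hx
  obtain ⟨a, rfl⟩ := PF.mk_surjective x
  have hex : ∀ p : Nat.Primes, ∃ n : ℤ, a p ≠ 0 → ε p ^ n = a p := by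
    intro p
    by_cases h : a p = 0
    · exact ⟨0, fun h' => absurd h h'⟩
    · have : NeZero ((p : ℕ) - 1) := ⟨Nat.sub_ne_zero_of_lt p.2.one_lt⟩
      obtain ⟨n, -, hn⟩ := (hε p).eq_pow_of_pow_eq_one (ZMod.pow_card_sub_one_eq_one h)
      exact ⟨n, fun _ => by rw [zpow_natCast, hn]⟩
  choose n hn using hex
  refine ⟨(n : StarZ D), ?_⟩
  rw [hE, ipow_mk, PF.mk_eq_mk]
  filter_upwards [PF.mk_ne_zero_iff.1 hx] with p hp using hn p hp

/-- The place takes the value of the complex exponential function at every element of the group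
that has coordinates. -/
theorem HasCoordinates.sendsTo (h : IsExpPlace D μ ι ε V f) (hE : (E : PF D) = PF.mk ε)
    {x : UGroup D (natGerm D fun p => μ p ^ 2)} {a b : ℝ} (hx : HasCoordinates D μ ι x a b) :
    SendsTo V f (expP E x) (Complex.exp (coordinateValue a b)) := by
  obtain ⟨m, K, K', hm, hK, hK', rfl⟩ := hx
  have h1 := h.unitU m hm K a hK
  have h2 := h.unitV m hm K' (Complex.exp (2 * Real.pi * Complex.I * b)) (by
    have h3 : Tendsto (fun p => (((K' p : ℝ) / (m * μ p ^ 2 : ℕ) : ℝ) : ℂ)) D (𝓝 (b : ℂ)) :=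
      (Complex.continuous_ofReal.tendsto b).comp hK'
    refine ((h3.const_mul (2 * Real.pi * Complex.I)).cexp).congr fun p => ?_
    push_cast
    rfl)
  have h3 := h1.mul h2
  rw [← Complex.exp_add, PF.mk_mul] at h3
  rw [coordinateValue]
  convert h3 using 1
  rw [expP_mk, hE, ipow_mk, PF.mk_eq_mk]
  refine Eventually.of_forall fun p => ?_
  have h0 := ne_zero_of_isPrimitiveRoot_sub_one (h.isPrimitiveRoot p)
  show ε p ^ (K p * stepU μ ι m p + K' p * stepV μ m p)
    = (ε p ^ stepU μ ι m p) ^ K p * (ε p ^ stepV μ m p) ^ K' p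
  rw [zpow_add₀ h0, mul_comm (K p), mul_comm (K' p), zpow_mul, zpow_mul, zpow_natCast, zpow_natCast]

theorem unitU_eq (ι : Nat.Primes → ℕ) : unitU (natGerm D fun p => ι p ^ 2) =
    ((fun p => (((p : ℕ) : ℤ) - 1) / (ι p ^ 2 : ℕ) : Nat.Primes → ℤ) : StarZ D) := rfl

theorem ScaleSeq.stepU_mul_eq (hs : ScaleSeq D μ ι) (m : ℕ) (hm : 0 < m) :
    ∀ᶠ p : Nat.Primes in D, (stepU μ ι m p : ℤ) * (m * μ p ^ 2)
      = (((p : ℕ) : ℤ) - 1) / (ι p ^ 2 : ℕ) := by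
  filter_upwards [hs.stepU_mul hm] with p hp
  have hi : (0 : ℤ) < (ι p ^ 2 : ℕ) := by exact_mod_cast pow_pos (hs.iota_pos p) 2
  rw [← hp]
  refine (Int.ediv_eq_of_eq_mul_left hi.ne' ?_).symm
  push_cast
  ring

theorem ScaleSeq.stepV_mul_eq (hs : ScaleSeq D μ ι) (m : ℕ) (hm : 0 < m) :
    ∀ᶠ p : Nat.Primes in D, (stepV μ m p : ℤ) * (m * μ p ^ 2) = ((p : ℕ) : ℤ) - 1 := by
  filter_upwards [hs.stepU_mul hm, hs.stepV_eq hm] with p hp h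
  rw [← hp, h]
  push_cast
  ring

theorem hasCoordinates_stepU {m : ℕ} (hm : 0 < m) {K : Nat.Primes → ℤ} {a : ℝ}
    (hK : Tendsto (fun p => (K p : ℝ) / (m * μ p ^ 2 : ℕ)) D (𝓝 a)) :
    HasCoordinates D μ ι
      (UGroup.mk _ ((fun p => K p * stepU μ ι m p : Nat.Primes → ℤ) : StarZ D)) a 0 :=
  ⟨m, K, fun _ => 0, hm, hK, by simp, by simp⟩

theorem hasCoordinates_stepV {m : ℕ} (hm : 0 < m) {K : Nat.Primes → ℤ} {a : ℝ}
    (hK : Tendsto (fun p => (K p : ℝ) / (m * μ p ^ 2 : ℕ)) D (𝓝 a)) :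
    HasCoordinates D μ ι
      (UGroup.mk _ ((fun p => K p * stepV μ m p : Nat.Primes → ℤ) : StarZ D)) 0 a :=
  ⟨m, fun _ => 0, K, hm, by simp, hK, by simp⟩

/-- The image of the line of the multiples of the small unit under a map that depends on the
coordinates only. -/
theorem image_scaleLine_unitU (hs : ScaleSeq D μ ι)
    {Y : Type*} {F : UGroup D (natGerm D fun p => μ p ^ 2) → Y} {G : ℂ → Y}
    (hF : ∀ x a b, HasCoordinates D μ ι x a b → F x = G (coordinateValue a b)) :
    F '' scaleLine (natGerm D fun p => μ p ^ 2) (unitU (natGerm D fun p => ι p ^ 2))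
      = Set.range fun r : ℝ => G r := by
  have hval : ∀ a : ℝ, coordinateValue a 0 = ((-(2 * Real.pi * a) : ℝ) : ℂ) := fun a => by
    rw [coordinateValue]
    push_cast
    ring
  ext y
  constructor
  · rintro ⟨x, hx, rfl⟩
    obtain ⟨m, K, a, hm, ha, rfl⟩ := (mem_scaleLine hs hs.stepU_mul_eq).1 hx
    exact ⟨_, by rw [hF _ _ _ (hasCoordinates_stepU hm ha), hval]⟩
  · rintro ⟨r, rfl⟩
    obtain ⟨K, hK⟩ := hs.exists_tendsto (-(r / (2 * Real.pi)))
    refine ⟨_, (mem_scaleLine hs hs.stepU_mul_eq).2 ⟨1, K, _, one_pos, hK, rfl⟩, ?_⟩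
    rw [hF _ _ _ (hasCoordinates_stepU one_pos hK), hval]
    congr 2
    have := Real.pi_ne_zero
    field_simp

/-- The image of the line of the multiples of the large unit under a map that depends on the
coordinates only. -/
theorem image_scaleLine_unitV (hs : ScaleSeq D μ ι)
    {Y : Type*} {F : UGroup D (natGerm D fun p => μ p ^ 2) → Y} {G : ℂ → Y}
    (hF : ∀ x a b, HasCoordinates D μ ι x a b → F x = G (coordinateValue a b)) :
    F '' scaleLine (natGerm D fun p => μ p ^ 2) (unitV D)
      = Set.range fun r : ℝ => G (Complex.I * r) := by
  have hval : ∀ a : ℝ, coordinateValue 0 a = Complex.I * ((2 * Real.pi * a : ℝ) : ℂ) := fun a => by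
    rw [coordinateValue]
    push_cast
    ring
  ext y
  constructor
  · rintro ⟨x, hx, rfl⟩
    obtain ⟨m, K, a, hm, ha, rfl⟩ := (mem_scaleLine hs hs.stepV_mul_eq).1 hx
    exact ⟨_, by rw [hF _ _ _ (hasCoordinates_stepV hm ha), hval]⟩
  · rintro ⟨r, rfl⟩
    obtain ⟨K, hK⟩ := hs.exists_tendsto (r / (2 * Real.pi))
    refine ⟨_, (mem_scaleLine hs hs.stepV_mul_eq).2 ⟨1, K, _, one_pos, hK, rfl⟩, ?_⟩
    rw [hF _ _ _ (hasCoordinates_stepV one_pos hK), hval]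
    congr 3
    have := Real.pi_ne_zero
    field_simp

/-- The values at the multiples of half the steps. -/
theorem hasCoordinates_scaled (hs : ScaleSeq D μ ι) {l : StarZ D}
    (hl : ∃ m : ℕ, |l| < (m : StarZ D) * natGerm D fun p => μ p ^ 2) {z : ℝ}
    (hz : z = ArchimedeanClass.stdPart (toQ l / toQ (natGerm D fun p => μ p ^ 2))) :
    HasCoordinates D μ ι (scaled (natGerm D fun p => μ p ^ 2)
      (toQ l / (2 * toQ (natGerm D fun p => μ p ^ 2)))
      (unitU (natGerm D fun p => ι p ^ 2))) (z / 2) 0 ∧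
    HasCoordinates D μ ι (scaled (natGerm D fun p => μ p ^ 2)
      (toQ l / (2 * toQ (natGerm D fun p => μ p ^ 2))) (unitV D)) 0 (z / 2) := by
  obtain ⟨m, hm⟩ := hl
  induction l using Germ.inductionOn with | h l => ?_
  have hb : ∀ᶠ p in D, |l p| < ((m * μ p ^ 2 : ℕ) : ℤ) := by
    rw [natGerm_mul, Germ.abs_def, Germ.map_coe] at hm
    exact Germ.coe_lt.1 hm
  have h1 : Tendsto (fun p => (((l p : ℚ) / ((μ p ^ 2 : ℕ) : ℤ) : ℚ) : ℝ)) D (𝓝 z) := by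
    rw [hz]
    refine tendsto_stdPart (q := fun p => (l p : ℚ) / ((μ p ^ 2 : ℕ) : ℤ)) (C := m) ?_
    filter_upwards [hb] with p hp
    have h5 : (0 : ℚ) < ((μ p ^ 2 : ℕ) : ℤ) := by exact_mod_cast pow_pos (hs.mu_pos p) 2
    rw [abs_div, abs_of_pos h5, div_le_iff₀ h5]
    have : |l p| ≤ m * ((μ p ^ 2 : ℕ) : ℤ) := by
      push_cast at hp ⊢
      exact hp.le
    exact_mod_cast this
  have h2 : Tendsto (fun p => (l p : ℝ) / (2 * μ p ^ 2 : ℕ)) D (𝓝 (z / 2)) := by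
    refine (h1.div_const 2).congr fun p => ?_
    have : (μ p : ℝ) ≠ 0 := by exact_mod_cast (hs.mu_pos p).ne'
    push_cast
    field_simp
  have hU := scaled_eq_step hs hs.stepU_mul_eq 2 l two_pos
  have hV := scaled_eq_step hs hs.stepV_mul_eq 2 l two_pos
  rw [Nat.cast_ofNat] at hU hV
  rw [unitU_eq, hU, show unitV D = ((fun p => ((p : ℕ) : ℤ) - 1 : Nat.Primes → ℤ) : StarZ D)
    from rfl, hV]
  exact ⟨hasCoordinates_stepU two_pos h2, hasCoordinates_stepV two_pos h2⟩

theorem ScaleSeq.res_mu_ne_zero (hs : ScaleSeq D μ ι) : res (natGerm D μ) ≠ 0 := by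
  rw [res_coe, PF.mk_ne_zero_iff]
  filter_upwards [hs.l_dvd] with p hp h0
  rw [Int.cast_natCast, ZMod.natCast_eq_zero_iff] at h0
  have h1 := p.2.one_lt
  have h2 := Nat.le_of_dvd (by omega) hp
  have h3 := Nat.le_of_dvd (hs.mu_pos p) h0
  have h4 := Nat.le_self_pow two_ne_zero (μ p)
  omega

theorem IsExpPlace.mu_eq_infty (h : IsExpPlace D μ ι ε V f) (hs : ScaleSeq D μ ι) :
    placeOfValuationSubring V f (res (natGerm D μ)) = OnePoint.infty := by
  rw [placeOfValuationSubring_eq_infty]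
  intro hmem
  have h1 : SendsTo V f (res (natGerm D μ)) (f ⟨_, hmem⟩) := ⟨hmem, rfl⟩
  have h2 := h1.mul h.mu_inv
  rw [mul_inv_cancel₀ hs.res_mu_ne_zero, mul_zero] at h2
  exact one_ne_zero (sendsTo_one.unique h2)

theorem IsExpPlace.surjective (h : IsExpPlace D μ ι ε V f) (hs : ScaleSeq D μ ι)
    (hE : (E : PF D) = PF.mk ε) : Function.Surjective (placeOfValuationSubring V f) := by
  intro z
  induction z using OnePoint.rec with
  | infty => exact ⟨_, h.mu_eq_infty hs⟩
  | coe z =>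
    by_cases hz : z = 0
    · exact ⟨_, placeOfValuationSubring_eq_coe.2 (hz ▸ h.mu_inv)⟩
    · obtain ⟨x, hx⟩ := surjective_limU hs (Complex.log z : OnePoint ℂ)
      obtain ⟨a, b, hab, hv⟩ := limU_eq_coe hs hx
      refine ⟨expP E x, placeOfValuationSubring_eq_coe.2 ?_⟩
      have := hab.sendsTo h hE
      rwa [← hv, Complex.exp_log hz] at this

/-- The element `ε ^ ((𝔭 - 1) / 8)` is sent to a primitive eighth root of unity. -/
theorem IsExpPlace.sendsTo_eighth (h : IsExpPlace D μ ι ε V f) (hs : ScaleSeq D μ ι) :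
    SendsTo V f (PF.mk fun p => ε p ^ (((p : ℕ) - 1) / 8))
      (Complex.exp (Complex.I * (Real.pi / 4))) := by
  have h1 := h.unitV 8 (by norm_num) (fun p => ((μ p ^ 2 : ℕ) : ℤ))
    (Complex.exp (Complex.I * (Real.pi / 4))) (by
      refine tendsto_const_nhds.congr fun p => ?_
      have : (μ p : ℂ) ≠ 0 := by exact_mod_cast (hs.mu_pos p).ne'
      push_cast
      congr 1
      field_simp
      norm_num)
  convert h1 using 1
  rw [PF.mk_eq_mk]
  filter_upwards [hs.stepV_mul_eq 8 (by norm_num)] with p hp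
  have h2 : stepV μ 8 p * μ p ^ 2 = ((p : ℕ) - 1) / 8 := by
    have h3 : stepV μ 8 p * (8 * μ p ^ 2) = (p : ℕ) - 1 := by
      rw [← natCast_primes_sub_one] at hp
      exact_mod_cast hp
    rw [← h3, show stepV μ 8 p * (8 * μ p ^ 2) = 8 * (stepV μ 8 p * μ p ^ 2) by ring,
      Nat.mul_div_cancel_left _ (by norm_num)]
  rw [zpow_natCast, ← pow_mul]
  exact congrArg _ h2.symm

theorem exists_eq_natCast_div_sq {a : ℚ} (ha : 0 < a) (hsq : IsSquare a) :
    ∃ r s : ℕ, 0 < r ∧ 0 < s ∧ a = ((r : ℚ) / s) ^ 2 := by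
  obtain ⟨b, rfl⟩ := hsq
  have hb : b ≠ 0 := by
    rintro rfl
    simp at ha
  refine ⟨b.num.natAbs, b.den, Int.natAbs_pos.2 (Rat.num_ne_zero.2 hb), b.den_pos, ?_⟩
  have h1 : ((b.num.natAbs : ℕ) : ℚ) = |(b.num : ℚ)| := by
    rw [Nat.cast_natAbs, Int.cast_abs]
  rw [h1, div_pow, sq_abs, ← div_pow, Rat.num_div_den, sq]

theorem one_div_sqrt_sq_div {r s : ℕ} :
    1 / √((((r : ℚ) / s) ^ 2 : ℚ) : ℝ) = (s : ℝ) / r := by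
  push_cast
  rw [Real.sqrt_sq (by positivity), one_div_div]

theorem sendsTo_of_natCast_mul_eq (hD : (D : Filter Nat.Primes) ≤ cofinite) (hf : IsLocalHom f)
    {r s : ℕ} (hr : 0 < r) {x y : PF D} {a : ℂ} (h : (r : PF D) * x = s * y)
    (hy : SendsTo V f y a) : SendsTo V f x ((s : ℝ) / r * a) := by
  have := charZero_PF hD
  have hr' : (r : PF D) ≠ 0 := by exact_mod_cast hr.ne'
  have h1 : x = s * (r : PF D)⁻¹ * y := by
    field_simp
    linear_combination h
  rw [h1, div_eq_mul_inv]
  exact ((sendsTo_natCast s).mul ((sendsTo_natCast r).inv hf (by exact_mod_cast hr.ne'))).mul hy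

end Values

end PseudoFinite

/-! ### The exponential map and the quadratic sums under the place -/

theorem mainTheorem1 :
    (∃ D : Ultrafilter Nat.Primes, (D : Filter Nat.Primes) ≤ Filter.cofinite ∧
      ∀ m : ℕ, 0 < m → (m : StarZ D) ∣ bigPrime D - 1) ∧
    ∀ D : Ultrafilter Nat.Primes, (D : Filter Nat.Primes) ≤ Filter.cofinite →
      ((∀ m : ℕ, 0 < m → (m : StarZ D) ∣ bigPrime D - 1) →
        ∃ 𝔩 μ 𝔦 ι : StarZ D, IsScale D 𝔩 μ 𝔦 ι) ∧
      ∀ 𝔩 μ 𝔦 ι : StarZ D, IsScale D 𝔩 μ 𝔦 ι →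
        ∃ ε : (PF D)ˣ, IsPseudoGenerator ε ∧
        ∃ (lmF : PF D → OnePoint ℂ)
          (lmU : UGroup D 𝔩 → OnePoint ℂ),
          IsPlace lmF ∧ Function.Surjective lmF ∧
          IsAddPlace lmU ∧ Function.Surjective lmU ∧
          -- `exp ∘ lmU = lmF ∘ exp_𝔭`, wherever `lmU` is finite
          (∀ (x : UGroup D 𝔩) (z : ℂ), lmU x = (z : OnePoint ℂ) →
            lmF (expP ε x) = (Complex.exp z : OnePoint ℂ)) ∧
          -- `'ℝ'` and `'iℝ'` are mapped onto `ℝ` and `iℝ`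
          lmU '' scaleLine 𝔩 (unitU 𝔦) =
            Set.range (fun r : ℝ => ((r : ℂ) : OnePoint ℂ)) ∧
          lmU '' scaleLine 𝔩 (unitV D) =
            Set.range (fun r : ℝ => ((Complex.I * r : ℂ) : OnePoint ℂ)) ∧
          -- their exponentials are mapped onto the positive reals and the unit circle
          (fun x => lmF (expP ε x)) '' scaleLine 𝔩 (unitU 𝔦) =
            (fun r : ℝ => ((r : ℂ) : OnePoint ℂ)) '' Set.Ioi 0 ∧
          (fun x => lmF (expP ε x)) '' scaleLine 𝔩 (unitV D) =
            (fun w : ℂ => (w : OnePoint ℂ)) '' {w : ℂ | ‖w‖ = 1} ∧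
          -- the values on the two scales
          (∀ l : StarZ D,
            (∃ m : ℕ, |l| < (m : StarZ D) * 𝔩) →
            ∀ z : ℝ, z = ArchimedeanClass.stdPart (toQ l / toQ 𝔩) →
              lmF (expP ε (scaled 𝔩 (toQ l / (2 * toQ 𝔩)) (unitU 𝔦))) =
                (Complex.exp (-(Real.pi * z)) : OnePoint ℂ) ∧
              lmF (expP ε (scaled 𝔩 (toQ l / (2 * toQ 𝔩)) (unitV D))) =
                (Complex.exp (Complex.I * (Real.pi * z)) : OnePoint ℂ)) ∧
          lmF (res μ) = OnePoint.infty ∧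
          lmF (res μ)⁻¹ = ((0 : ℂ) : OnePoint ℂ) ∧
          lmF (res ι) =
            (Complex.exp (-(Complex.I * (Real.pi / 4))) : OnePoint ℂ) ∧
          -- the quadratic sums and the Gaussian and Fresnel integrals
          ∀ a : ℚ, 0 < a → IsSquare a →
            (∃ S : PF D,
              IsInternalSum
                (fun n => expP ε (scaled 𝔩
                  ((a : StarQ D) * (toQ n ^ 2 / (2 * toQ 𝔩))) (unitU 𝔦)))
                (-(toQ 𝔦 * toQ 𝔩 / (2 * (a : StarQ D))))
                (toQ 𝔦 * toQ 𝔩 / (2 * (a : StarQ D))) S ∧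
              lmF ((res μ)⁻¹ * S) =
                (((1 / √(a : ℝ) : ℝ) : ℂ) : OnePoint ℂ)) ∧
            (∃ S : PF D,
              IsInternalSum
                (fun n => expP ε (scaled 𝔩
                  ((a : StarQ D) * (toQ n ^ 2 / (2 * toQ 𝔩))) (unitV D)))
                (-(toQ 𝔩 / (2 * (a : StarQ D))))
                (toQ 𝔩 / (2 * (a : StarQ D))) S ∧
              lmF ((res μ)⁻¹ * S) =
                ((Complex.exp (Complex.I * (Real.pi / 4)) / ((√(a : ℝ) : ℝ) : ℂ) : ℂ) :
                  OnePoint ℂ)) ∧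
            ∫ x : ℝ, Real.exp (-(a * Real.pi * x ^ 2)) = 1 / √(a : ℝ) ∧
            Filter.Tendsto
              (fun R : ℝ => ∫ x in (-R)..R, Complex.exp (Complex.I * (a * Real.pi * x ^ 2)))
              Filter.atTop
              (nhds (Complex.exp (Complex.I * (Real.pi / 4)) / ((√(a : ℝ) : ℝ) : ℂ))) := by
  refine ⟨exists_ultrafilter_forall_dvd, fun D hD => ⟨exists_isScale hD, ?_⟩⟩
  intro 𝔩 μ' 𝔦 ι' hscale
  obtain ⟨μ, ι, hs, rfl, rfl⟩ := hscale.exists_scaleSeq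
  obtain ⟨ε, V, f, h⟩ := hscale.exists_isExpPlace hD hs
  obtain rfl : 𝔩 = natGerm D fun p => μ p ^ 2 := hscale.l_eq.trans (natGerm_sq μ)
  obtain rfl : 𝔦 = natGerm D fun p => ι p ^ 2 := hscale.i_eq.trans (natGerm_sq ι)
  have hε0 : (PF.mk ε : PF D) ≠ 0 := PF.mk_ne_zero_iff.2
    (Filter.Eventually.of_forall fun p => ne_zero_of_isPrimitiveRoot_sub_one (h.isPrimitiveRoot p))
  obtain ⟨E, hE⟩ : ∃ E : (PF D)ˣ, (E : PF D) = PF.mk ε := ⟨Units.mk0 _ hε0, rfl⟩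
  have hexp : ∀ (x : UGroup D (natGerm D fun p => μ p ^ 2)) (a b : ℝ), HasCoordinates D μ ι x a b →
      placeOfValuationSubring V f (expP E x)
        = (Complex.exp (coordinateValue a b) : OnePoint ℂ) :=
    fun x a b hx => placeOfValuationSubring_eq_coe.2 (hx.sendsTo h hE)
  refine ⟨E, isPseudoGenerator_of_isPrimitiveRoot h.isPrimitiveRoot hE,
    placeOfValuationSubring V f, limU D μ ι, isPlace_placeOfValuationSubring h.isLocalHom,
    h.surjective hs hE, isAddPlace_limU hs, surjective_limU hs, fun x z hx => ?_,
    image_scaleLine_unitU hs fun x a b hx => hx.limU_eq hs,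
    image_scaleLine_unitV hs fun x a b hx => hx.limU_eq hs, ?_, ?_, fun l hl z hz => ?_,
    h.mu_eq_infty hs, placeOfValuationSubring_eq_coe.2 h.mu_inv,
    placeOfValuationSubring_eq_coe.2 h.iota, fun a ha hsq => ?_⟩
  · obtain ⟨a, b, hab, rfl⟩ := limU_eq_coe hs hx
    exact hexp x a b hab
  · rw [image_scaleLine_unitU hs (G := fun z => (Complex.exp z : OnePoint ℂ)) hexp]
    ext y
    constructor
    · rintro ⟨r, rfl⟩
      exact ⟨Real.exp r, Real.exp_pos r, by simp⟩
    · rintro ⟨r, hr, rfl⟩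
      refine ⟨Real.log r, ?_⟩
      simp only [← Complex.ofReal_exp, Real.exp_log (Set.mem_Ioi.1 hr)]
  · rw [image_scaleLine_unitV hs (G := fun z => (Complex.exp z : OnePoint ℂ)) hexp]
    ext y
    constructor
    · rintro ⟨r, rfl⟩
      exact ⟨_, Complex.norm_exp_I_mul_ofReal r, rfl⟩
    · rintro ⟨w, hw, rfl⟩
      obtain ⟨r, rfl⟩ := (Complex.norm_eq_one_iff w).1 hw
      exact ⟨r, by simp only [mul_comm Complex.I]⟩
  · obtain ⟨h1, h2⟩ := hasCoordinates_scaled hs hl hz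
    refine ⟨(hexp _ _ _ h1).trans ?_, (hexp _ _ _ h2).trans ?_⟩
    · rw [coordinateValue]
      push_cast
      congr 2
      ring
    · rw [coordinateValue]
      push_cast
      congr 2
      ring
  · refine ⟨?_, ?_, integral_exp_neg_mul_pi_mul_sq _, tendsto_fresnel_integral (by exact_mod_cast ha)⟩
    -- the Gauss sum is `ιμ / √a` times an eighth root of unity, which is inverse to the value of `ι`
    · obtain ⟨r, s, hr, hs0, rfl⟩ := exists_eq_natCast_div_sq ha hsq
      obtain ⟨S, hS, hS2⟩ := exists_isInternalSum (D := D) (l := fun p => μ p ^ 2)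
        (c := fun p => ι p ^ 2) (t := fun p => ι p * μ p) h.isPrimitiveRoot hE
        (fun p => pow_pos (hs.mu_pos p) 2) (fun p => pow_pos (hs.iota_pos p) 2)
        (fun p => mul_pow _ _ _)
        (fun m hm => by simpa only [mul_pow] using hs.dvd_sub_one m hm)
        (fun m hm => (hs.dvd_mu m hm).mono fun p hp => hp.mul_left _)
        (w := fun p => (((p : ℕ) : ℤ) - 1) / (ι p ^ 2 : ℕ))
        (by
          filter_upwards [hs.stepU_mul_eq 1 one_pos, hs.stepU_mul one_pos] with p h1 h2
          rw [← h1, ← h2]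
          push_cast
          ring) hr hs0
      refine ⟨S, ?_, ?_⟩
      · have hA : toQ (natGerm D fun p => ι p ^ 2) * toQ (natGerm D fun p => μ p ^ 2) /
            (2 * ((((r : ℚ) / s) ^ 2 : ℚ) : StarQ D)) = ((fun p => ((ι p * μ p : ℕ) : ℚ) ^ 2 /
              (2 * ((r : ℚ) / s) ^ 2) : Nat.Primes → ℚ) : StarQ D) := by
          rw [← StarQ.coe_const]
          refine Filter.Germ.coe_eq.2 (Filter.Eventually.of_forall fun p => ?_)
          simp [mul_pow]
        rw [hA]
        exact hS
      · rw [one_div_sqrt_sq_div, placeOfValuationSubring_eq_coe]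
        have h1 : (r : PF D) * ((res (natGerm D μ))⁻¹ * S) = (s : PF D) * (res (natGerm D ι) *
            PF.mk fun p => ε p ^ (((p : ℕ) - 1) / 8)) := by
          have h2 : res (natGerm D fun p => ι p * μ p) = res (natGerm D ι) * res (natGerm D μ) := by
            rw [← resHom_apply, ← resHom_apply, ← resHom_apply, ← map_mul]
            refine congrArg _ (congrArg _ (funext fun p => Nat.cast_mul _ _))
          have h3 := hs.res_mu_ne_zero
          rw [h2] at hS2
          rw [mul_left_comm, hS2]
          field_simp
        have h2 := sendsTo_of_natCast_mul_eq hD h.isLocalHom hr h1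
          (h.iota.mul (h.sendsTo_eighth hs))
        rw [← Complex.exp_add, neg_add_cancel, Complex.exp_zero, mul_one] at h2
        exact_mod_cast h2
    -- the Gauss sum is `μ / √a` times the eighth root of unity
    · obtain ⟨r, s, hr, hs0, rfl⟩ := exists_eq_natCast_div_sq ha hsq
      obtain ⟨S, hS, hS2⟩ := exists_isInternalSum (D := D) (l := fun p => μ p ^ 2)
        (c := fun _ => 1) (t := μ) h.isPrimitiveRoot hE
        (fun p => pow_pos (hs.mu_pos p) 2) (fun p => one_pos)
        (fun p => (one_mul _).symm)
        (fun m hm => by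
          filter_upwards [hs.dvd_sub_one m hm] with p hp
          exact Dvd.dvd.trans ⟨ι p ^ 2, by ring⟩ hp)
        hs.dvd_mu (w := fun p => ((p : ℕ) : ℤ) - 1)
        (Filter.Eventually.of_forall fun p => by simp) hr hs0
      refine ⟨S, ?_, ?_⟩
      · have hA : toQ (natGerm D fun p => μ p ^ 2) /
            (2 * ((((r : ℚ) / s) ^ 2 : ℚ) : StarQ D)) = ((fun p => (μ p : ℚ) ^ 2 /
              (2 * ((r : ℚ) / s) ^ 2) : Nat.Primes → ℚ) : StarQ D) := by
          rw [← StarQ.coe_const]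
          refine Filter.Germ.coe_eq.2 (Filter.Eventually.of_forall fun p => ?_)
          simp
        rw [hA]
        exact hS
      · rw [div_eq_mul_one_div, ← Complex.ofReal_one, ← Complex.ofReal_div, one_div_sqrt_sq_div,
          placeOfValuationSubring_eq_coe]
        have h1 : (r : PF D) * ((res (natGerm D μ))⁻¹ * S) = (s : PF D) *
            PF.mk fun p => ε p ^ (((p : ℕ) - 1) / 8) := by
          have h3 := hs.res_mu_ne_zero
          rw [mul_left_comm, hS2]
          field_simp
        have h2 := sendsTo_of_natCast_mul_eq hD h.isLocalHom hr h1 (h.sendsTo_eighth hs)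
        rw [mul_comm (Complex.exp _)]
        exact_mod_cast h2
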